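/- Let $-\infty<a<b<+\infty$ and $\alpha,\beta>0$. For $\varepsilon>0$ define $\mathcal F_\varepsilon\colon L^1(a,b)\times L^1(a,b)\to[0,+\infty]$ by $$\mathcal F_\varepsilon(u,v)=\alpha\int_a^b v^2(u')^2\,dt+\frac{\beta}{2\sqrt2}\int_a^b\left(\frac{(v-1)^2}{\varepsilon}+\varepsilon^3(v'')^2\right)dt\quad\text{if }(u,v)\in W^{1,2}(a,b)\times W^{2,2}(a,b),$$ and $\mathcal F_\varepsilon(u,v)=+\infty$ otherwise, where $u'$ and $v''$ are weak derivatives. Define $\mathcal{MS}\colon L^1(a,b)\times L^1(a,b)\to[0,+\infty]$ by $$\mathcal{MS}(u,v)=\alpha\int_a^b (u')^2\,dt+\beta\,\#(S_u)\quad\text{if }u\in SBV^2(a,b)\text{ and }v=1\text{ a.e. in }(a,b),$$ and $\mathcal{MS}(u,v)=+\infty$ otherwise. Here $S_u$ is the approximate discontinuity set of $u$ in $(a,b)$, that is, the set of $x\in(a,b)$ for which there is no $z\in\mathbb R$ with $\lim_{r\to0^+}\frac1{2r}\int_{x-r}^{x+r}|u(y)-z|\,dy=0$; $\#(S_u)$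 is its number of elements; $u'$ is, in the formula for $\mathcal{MS}$, the approximate derivative of $u$; and $SBV^2(a,b)$ is the set of $u\in L^1(a,b)$ whose distributional derivative is a finite signed measure with singular part concentrated on $S_u$, with $u'\in L^2(a,b)$ and $\#(S_u)<+\infty$. Then, for every strictly decreasing sequence $(\varepsilon_j)$ of positive numbers converging to $0$, the sequence $(\mathcal F_{\varepsilon_j})$ $\Gamma$-converges to $\mathcal{MS}$ with respect to the $L^1(a,b)\times L^1(a,b)$ topology. That is, for every $(u,v)\in L^1(a,b)\times L^1(a,b)$: (i) $\mathcal{MS}(u,v)\le\liminf_{j\to\infty}\mathcal F_{\varepsilon_j}(u_j,v_j)$ for every sequence $(u_j,v_j)\to(u,v)$ in $L^1(a,b)\times L^1(a,b)$; (ii) there is a sequence $(u_j,v_j)\to(u,v)$ in $L^1(a,b)\times L^1(a,b)$ with $\limsup_{j\to\infty}\mathcal F_{\varepsilon_j}(u_j,v_j)\le\mathcal{MS}(u,v)$. -/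

import Mathlib

open MeasureTheory Filter Topology Set
open scoped ENNReal ContDiff

noncomputable section

namespace EdgePenalization

/-- The Banach space `L¹(a,b)`. -/
abbrev L1 (a b : ℝ) : Type := Lp ℝ 1 (volume.restrict (Ioo a b))

/-- Smooth compactly supported test functions on the open interval `(a,b)`. -/
structure IsTestFunction (a b : ℝ) (φ : ℝ → ℝ) : Prop where
  contDiff : ContDiff ℝ ∞ φ
  hasCompactSupport : HasCompactSupport φ
  tsupport_subset : tsupport φ ⊆ Ioo a b

/-! ### Sobolev functions -/

/-- `g` is a weak derivative of `u` on `(a,b)`. -/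
structure HasWeakDeriv (a b : ℝ) (u g : ℝ → ℝ) : Prop where
  locallyIntegrableOn : LocallyIntegrableOn u (Ioo a b)
  locallyIntegrableOn_deriv : LocallyIntegrableOn g (Ioo a b)
  integral_mul_deriv : ∀ φ : ℝ → ℝ, IsTestFunction a b φ →
    ∫ x in Ioo a b, u x * deriv φ x = -∫ x in Ioo a b, g x * φ x

/-- `u ∈ W^{1,2}(a,b)`. -/
def MemW12 (a b : ℝ) (u : ℝ → ℝ) : Prop :=
  MemLp u 2 (volume.restrict (Ioo a b)) ∧
    ∃ g : ℝ → ℝ, MemLp g 2 (volume.restrict (Ioo a b)) ∧ HasWeakDeriv a b u g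

/-- `v ∈ W^{2,2}(a,b)`. -/
def MemW22 (a b : ℝ) (v : ℝ → ℝ) : Prop :=
  MemLp v 2 (volume.restrict (Ioo a b)) ∧
    ∃ g : ℝ → ℝ, MemW12 a b g ∧ HasWeakDeriv a b v g

open scoped Classical in
/-- The weak derivative `u'` on `(a,b)` (a representative of it, and `0` if there is none). -/
def weakDeriv (a b : ℝ) (u : ℝ → ℝ) : ℝ → ℝ :=
  if h : ∃ g : ℝ → ℝ, HasWeakDeriv a b u g then h.choose else 0

/-! ### Special functions of bounded variation -/

/-- `u` has the approximate limit `z` at `x`: the averages of `|u - z|` over the balls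
`B_r(x)` tend to `0` as `r → 0⁺`. -/
def HasApproxLimit (u : ℝ → ℝ) (x z : ℝ) : Prop :=
  Tendsto (fun r : ℝ => ⨍ y in Metric.ball x r, |u y - z|) (𝓝[>] 0) (𝓝 0)

/-- The approximate discontinuity set `S_u` of `u` in `(a,b)`. -/
def approxDiscontSet (a b : ℝ) (u : ℝ → ℝ) : Set ℝ :=
  {x | x ∈ Ioo a b ∧ ¬ ∃ z : ℝ, HasApproxLimit u x z}

/-- `u` is approximately differentiable at `x`, with approximate derivative `L`: for the
approximate limit `z` of `u` at `x`, the averages over `B_r(x)` of `|u(y) - z - L (y - x)| / r`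
tend to `0` as `r → 0⁺`. -/
def HasApproxDerivAt (u : ℝ → ℝ) (x L : ℝ) : Prop :=
  ∃ z : ℝ, HasApproxLimit u x z ∧
    Tendsto (fun r : ℝ => ⨍ y in Metric.ball x r, |u y - z - L * (y - x)| / r) (𝓝[>] 0) (𝓝 0)

open scoped Classical in
/-- The approximate derivative (one-dimensional approximate gradient) of `u`, with the value `0`
at points where `u` is not approximately differentiable. -/
def approxDeriv (u : ℝ → ℝ) (x : ℝ) : ℝ :=
  if h : ∃ L : ℝ, HasApproxDerivAt u x L then h.choose else 0

/-- The restriction to `(a,b)` of the finite signed measure `μ` is the distributional derivative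
of `u` on `(a,b)`. -/
def IsDistribDeriv (a b : ℝ) (u : ℝ → ℝ) (μ : SignedMeasure ℝ) : Prop :=
  ∀ φ : ℝ → ℝ, IsTestFunction a b φ →
    ∫ x in Ioo a b, u x * deriv φ x = -∫ᵛ x, φ x ∂<•μ

/-- `u ∈ SBV(a,b)`: `u` is integrable, its distributional derivative `Du` is a finite signed
measure, and the part `D^s u` of `Du` that is singular with respect to the Lebesgue measure is
concentrated on `S_u`, that is, the Cantor part `D^s u ⌞ ((a,b) \ S_u)` vanishes. -/
def MemSBV (a b : ℝ) (u : ℝ → ℝ) : Prop :=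
  IntegrableOn u (Ioo a b) ∧ ∃ μ : SignedMeasure ℝ, IsDistribDeriv a b u μ ∧
    ∀ A : Set ℝ, MeasurableSet A → A ⊆ Ioo a b \ approxDiscontSet a b u →
      μ.singularPart volume A = 0

/-- `u ∈ SBV²(a,b)`. -/
def MemSBV2 (a b : ℝ) (u : ℝ → ℝ) : Prop :=
  MemSBV a b u ∧ MemLp (approxDeriv u) 2 (volume.restrict (Ioo a b)) ∧
    (approxDiscontSet a b u).Finite

/-! ### The functionals -/

open scoped Classical in
/-- The functional `F_ε(u,v) = α ∫ v² (u')² + β / (2√2) ∫ ((v-1)² / ε + ε³ (v'')²)` if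
`(u,v) ∈ W^{1,2}(a,b) × W^{2,2}(a,b)`, and `+∞` otherwise. -/
def energy (a b α β ε : ℝ) (p : L1 a b × L1 a b) : ℝ≥0∞ :=
  if MemW12 a b p.1 ∧ MemW22 a b p.2 then
    ENNReal.ofReal α *
        ∫⁻ t in Ioo a b, ENNReal.ofReal ((p.2 t) ^ 2 * (weakDeriv a b p.1 t) ^ 2) +
      ENNReal.ofReal (β / (2 * √2)) *
        ∫⁻ t in Ioo a b, ENNReal.ofReal
          ((p.2 t - 1) ^ 2 / ε + ε ^ 3 * (weakDeriv a b (weakDeriv a b p.2) t) ^ 2)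
  else ∞

open scoped Classical in
/-- The Mumford-Shah functional `MS(u,v) = α ∫ (u')² + β #(S_u)` if `u ∈ SBV²(a,b)` and `v = 1`
a.e., and `+∞` otherwise. -/
def mumfordShah (a b α β : ℝ) (p : L1 a b × L1 a b) : ℝ≥0∞ :=
  if MemSBV2 a b p.1 ∧ ∀ᵐ t ∂(volume.restrict (Ioo a b)), p.2 t = 1 then
    ENNReal.ofReal α * ∫⁻ t in Ioo a b, ENNReal.ofReal ((approxDeriv p.1 t) ^ 2) +
      ENNReal.ofReal β * ((approxDiscontSet a b p.1).encard : ℝ≥0∞)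
  else ∞

/-- Sequential `Γ`-convergence of `F j` to `G` (on metrizable spaces, `Γ`-convergence): the liminf
inequality along all convergent sequences, and the existence of recovery sequences. -/
def GammaConverges {X : Type*} [TopologicalSpace X] (F : ℕ → X → ℝ≥0∞) (G : X → ℝ≥0∞) : Prop :=
  (∀ (x : X) (y : ℕ → X), Tendsto y atTop (𝓝 x) → G x ≤ liminf (fun j => F j (y j)) atTop) ∧
    ∀ x : X, ∃ y : ℕ → X, Tendsto y atTop (𝓝 x) ∧ limsup (fun j => F j (y j)) atTop ≤ G x

end EdgePenalization

end

noncomputable section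

namespace EdgePenalization

/-! A jump of `u` forces `v` down to `0` nearby, and the factor `β / (2√2)` is tuned so that one
such dip costs exactly `β`. With `w = 1 - v` and lengths rescaled by `ε`, the dip costs `∫ (w² +
w''²)`, and `w² + w''² = (w + √2 w' + w'')² - (√2 (w² + w'²) + 2 w w')'`. Hence a decaying `w` pays
at least `√2 (w² + w'²) + 2 w w'`, evaluated at the endpoint, on a half-line; adding the reflected
half-line cancels the cross term and leaves at least `2√2 w²`. Equality requires `w'' + √2 w' + w =
0` with `w' = 0` at the centre, which is solved by `optimalProfile`.

Lower bound. `transition_cost` localizes the identity to a window of fixed length, with an error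
factor `1 + Cε`. Along an ultrafilter, the points near which `v` falls below a level `θ < 1`
therefore each carry a fixed cost and are finitely many (`card_mul_le`). Away from them `v` stays
positive, and since `v → 1` in `L²` the Dirichlet bound passes to the limit without loss
(`abs_integral_mul_deriv_le`). By Riesz representation the limit is a primitive of an `L²` function
plus a step function, and a genuine jump can only sit where `v` falls below every `θ > 0`
(`EnergyBound.exists_piecewiseRep`). Letting `θ → 0` gives the cost `2√2` per jump.

Upper bound. An `SBV²` function is a primitive of an `L²` function plus a step function
(`MemSBV2.exists_piecewiseRep`). Each jump is replaced by a steep ramp, and `v` is `1` minus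
rescaled copies of a truncated optimal profile with a short plateau at height `1`. The ramps live
where `v = 0`, so they add no Dirichlet energy (`one_sub_superpose_mul_ramp'`), and each dip costs
`2√2` up to a small error (`exists_profile`).

Both halves are proved for `edgeEnergy` and `jumpEnergy`, whose two terms are separate; the stated
functionals are these with another positive constant in place of `β`. -/

/-! ### Calculus of absolutely continuous primitives. -/

/-- `F` is a primitive on `ℝ` of the locally integrable function `f`. -/
structure IsPrimitive (F f : ℝ → ℝ) : Prop where
  locallyIntegrable : LocallyIntegrable f
  sub_eq : ∀ x y, F y - F x = ∫ t in x..y, f t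

lemma intervalIntegrable_of_locallyIntegrable {f : ℝ → ℝ} (hf : LocallyIntegrable f) (x y : ℝ) :
    IntervalIntegrable f volume x y :=
  intervalIntegrable_iff.mpr
    ((hf.integrableOn_isCompact isCompact_uIcc).mono_set uIoc_subset_uIcc)

namespace IsPrimitive

variable {F G f g : ℝ → ℝ}

lemma intervalIntegrable (h : IsPrimitive F f) (x y : ℝ) : IntervalIntegrable f volume x y :=
  intervalIntegrable_of_locallyIntegrable h.locallyIntegrable x y

lemma eq_add (h : IsPrimitive F f) (x y : ℝ) : F y = F x + ∫ t in x..y, f t := by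
  have := h.sub_eq x y; linarith

lemma of_integral (hf : LocallyIntegrable f) (c a : ℝ) :
    IsPrimitive (fun x => c + ∫ t in a..x, f t) f where
  locallyIntegrable := hf
  sub_eq x y := by
    have := intervalIntegral.integral_interval_sub_left
      (intervalIntegrable_of_locallyIntegrable hf a y)
      (intervalIntegrable_of_locallyIntegrable hf a x)
    linarith

lemma absolutelyContinuousOnInterval (h : IsPrimitive F f) (x y : ℝ) :
    AbsolutelyContinuousOnInterval F x y := by
  have h1 : F = fun z => F x + ∫ t in x..z, f t := by ext z; exact h.eq_add x z
  rw [h1]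
  have h2 := (h.intervalIntegrable x y).absolutelyContinuousOnInterval_intervalIntegral
    (c := x) (by simp)
  have h3 : AbsolutelyContinuousOnInterval (fun _ : ℝ => F x) x y :=
    ((LipschitzWith.const (F x)).lipschitzOnWith (s := uIcc x y)).absolutelyContinuousOnInterval
  exact h3.add h2

lemma continuous (h : IsPrimitive F f) : Continuous F := by
  have h1 : F = fun z => F 0 + ∫ t in (0 : ℝ)..z, f t := by ext z; exact h.eq_add 0 z
  rw [h1]
  exact continuous_const.add (intervalIntegral.continuous_primitive h.intervalIntegrable 0)

lemma ae_hasDerivAt (h : IsPrimitive F f) : ∀ᵐ x, HasDerivAt F (f x) x := by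
  filter_upwards [LocallyIntegrable.ae_hasDerivAt_integral h.locallyIntegrable] with x hx
  have h1 : F = fun z => F 0 + ∫ t in (0 : ℝ)..z, f t := by ext z; exact h.eq_add 0 z
  rw [h1]
  exact (hx 0).const_add _

lemma of_hasDerivAt (h : ∀ x, HasDerivAt F (f x) x) (hf : Continuous f) :
    IsPrimitive F f where
  locallyIntegrable := hf.locallyIntegrable
  sub_eq _ _ := (intervalIntegral.integral_eq_sub_of_hasDerivAt (fun t _ => h t)
    (hf.intervalIntegrable _ _)).symm

lemma of_contDiff {φ : ℝ → ℝ} (h : ContDiff ℝ 1 φ) : IsPrimitive φ (deriv φ) :=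
  of_hasDerivAt (fun x => (h.differentiable one_ne_zero x).hasDerivAt) (h.continuous_deriv le_rfl)

lemma const (c : ℝ) : IsPrimitive (fun _ => c) (fun _ => 0) :=
  of_hasDerivAt (fun x => hasDerivAt_const x c) continuous_const

lemma add (hF : IsPrimitive F f) (hG : IsPrimitive G g) :
    IsPrimitive (fun x => F x + G x) (fun x => f x + g x) where
  locallyIntegrable := hF.locallyIntegrable.add hG.locallyIntegrable
  sub_eq x y := by
    rw [intervalIntegral.integral_add (hF.intervalIntegrable x y) (hG.intervalIntegrable x y),
      ← hF.sub_eq, ← hG.sub_eq]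
    ring

lemma const_mul (c : ℝ) (hF : IsPrimitive F f) :
    IsPrimitive (fun x => c * F x) (fun x => c * f x) where
  locallyIntegrable := hF.locallyIntegrable.smul c
  sub_eq x y := by
    rw [intervalIntegral.integral_const_mul, ← hF.sub_eq]; ring

lemma sub (hF : IsPrimitive F f) (hG : IsPrimitive G g) :
    IsPrimitive (fun x => F x - G x) (fun x => f x - g x) where
  locallyIntegrable := hF.locallyIntegrable.sub hG.locallyIntegrable
  sub_eq x y := by
    rw [intervalIntegral.integral_sub (hF.intervalIntegrable x y) (hG.intervalIntegrable x y),
      ← hF.sub_eq, ← hG.sub_eq]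
    ring

lemma sum {ι : Type*} (S : Finset ι) {F f : ι → ℝ → ℝ} (h : ∀ i ∈ S, IsPrimitive (F i) (f i)) :
    IsPrimitive (fun x => ∑ i ∈ S, F i x) (fun x => ∑ i ∈ S, f i x) := by
  classical
  induction S using Finset.induction_on with
  | empty => simpa using const 0
  | insert i S hi ih =>
    simp only [Finset.sum_insert hi]
    exact (h i (by simp)).add (ih fun j hj => h j (by simp [hj]))

/-- Absolute continuity gives the integrated product rule; integration by parts against test
functions and the calibration argument both rest on it. -/
lemma mul (hF : IsPrimitive F f) (hG : IsPrimitive G g) :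
    IsPrimitive (fun x => F x * G x) (fun x => f x * G x + F x * g x) where
  locallyIntegrable := by
    have h1 : LocallyIntegrable (fun x => f x * G x) := by
      rw [locallyIntegrable_iff]
      intro K hK
      exact (hF.locallyIntegrable.integrableOn_isCompact hK).mul_continuousOn
        hG.continuous.continuousOn hK
    have h2 : LocallyIntegrable (fun x => F x * g x) := by
      rw [locallyIntegrable_iff]
      intro K hK
      exact (hG.locallyIntegrable.integrableOn_isCompact hK).continuousOn_mul
        hF.continuous.continuousOn hK
    exact h1.add h2
  sub_eq x y := by
    rw [← AbsolutelyContinuousOnInterval.integral_deriv_mul_eq_sub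
      (hF.absolutelyContinuousOnInterval x y) (hG.absolutelyContinuousOnInterval x y)]
    apply intervalIntegral.integral_congr_ae
    filter_upwards [hF.ae_hasDerivAt, hG.ae_hasDerivAt] with t h1 h2 _
    rw [h1.deriv, h2.deriv]

/-- Negative `r` is allowed, so reflections are covered along with the rescaling of profiles. -/
lemma comp_mul_add (hF : IsPrimitive F f) {r : ℝ} (hr : r ≠ 0) (d : ℝ) :
    IsPrimitive (fun x => F (r * x + d)) (fun x => r * f (r * x + d)) where
  locallyIntegrable := by
    rw [locallyIntegrable_iff]
    intro K hK
    obtain ⟨M, hM⟩ := hK.isBounded.subset_closedBall (0 : ℝ)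
    have h1 : IntervalIntegrable (fun x => f (r * x + d)) volume (-M) M := by
      have := (hF.intervalIntegrable (-M * r + d) (M * r + d))
      have h2 := (this.comp_add_right d).comp_mul_left (c := r)
      simpa [hr, neg_div] using h2
    rcases le_total (-M) M with hle | hle
    · have h3 := (intervalIntegrable_iff_integrableOn_Icc_of_le hle).1 h1
      refine (h3.mono_set ?_).const_mul r
      intro x hx
      have := hM hx
      rw [Real.closedBall_eq_Icc] at this
      simpa using this
    -- Here `M ≤ 0`, so `K` is empty or contained in `{0}`.
    · rcases hle.lt_or_eq with h | h
      · have : K = ∅ := by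
          rw [Metric.closedBall_eq_empty.2 (by linarith)] at hM
          exact subset_empty_iff.1 hM
        simp [this]
      · have h0 : M = 0 := by linarith
        subst h0
        have : volume K = 0 := measure_mono_null hM (by simp)
        rw [IntegrableOn, Measure.restrict_eq_zero.2 this]
        exact integrable_zero_measure
  sub_eq x y := by
    rw [intervalIntegral.integral_const_mul, hF.sub_eq]
    rw [intervalIntegral.integral_comp_mul_add f hr d]
    simp [hr]

lemma comp_neg (hF : IsPrimitive F f) : IsPrimitive (fun x => F (-x)) (fun x => -f (-x)) := by
  simpa using hF.comp_mul_add (r := -1) (by norm_num) 0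

/-- Only the values have to match at `c`; the densities may jump. Gluing a function and then its
derivative produces `C¹` profiles with a piecewise second derivative. -/
lemma glue (hF : IsPrimitive F f) (hG : IsPrimitive G g) {c : ℝ} (hc : F c = G c) :
    IsPrimitive (fun x => if x ≤ c then F x else G x) (fun x => if x ≤ c then f x else g x) := by
  have key : LocallyIntegrable (fun x => if x ≤ c then f x else g x) := by
    rw [locallyIntegrable_iff]
    intro K hK
    have h1 := (hF.locallyIntegrable.integrableOn_isCompact hK)
    have h2 := (hG.locallyIntegrable.integrableOn_isCompact hK)
    exact Integrable.piecewise (s := Iic c) (f := f) (g := g) measurableSet_Iic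
      h1.integrableOn h2.integrableOn
  have hl : ∀ x ≤ c, ∫ t in x..c, (if t ≤ c then f t else g t) = F c - F x := by
    intro x hx
    rw [hF.sub_eq]
    apply intervalIntegral.integral_congr
    intro t ht
    rw [uIcc_of_le hx] at ht
    simp [ht.2]
  have hr : ∀ x, c ≤ x → ∫ t in c..x, (if t ≤ c then f t else g t) = G x - G c := by
    intro x hx
    rw [hG.sub_eq]
    apply intervalIntegral.integral_congr_ae
    filter_upwards with t ht
    rw [uIoc_of_le hx] at ht
    simp [ht.1]
  have hH : ∀ x, (if x ≤ c then F x else G x) =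
      F c + ∫ t in c..x, (if t ≤ c then f t else g t) := by
    intro x
    split_ifs with h
    · rw [intervalIntegral.integral_symm, hl x h]; ring
    · rw [hr x (not_le.1 h).le, hc]; ring
  simp_rw [hH]
  exact of_integral key (F c) c

end IsPrimitive

/-! ### Test functions and the du Bois-Reymond lemma. -/

lemma exists_Icc_of_isCompact_subset_Ioo {a b : ℝ} (hab : a < b) {K : Set ℝ} (hK : IsCompact K)
    (hKab : K ⊆ Ioo a b) : ∃ c d, a < c ∧ c < d ∧ d < b ∧ K ⊆ Icc c d := by
  rcases K.eq_empty_or_nonempty with rfl | hne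
  · exact ⟨(2 * a + b) / 3, (a + 2 * b) / 3, by linarith, by linarith, by linarith, by simp⟩
  · obtain ⟨p, hp, hpl⟩ := hK.exists_isLeast hne
    obtain ⟨q, hq, hqg⟩ := hK.exists_isGreatest hne
    have h1 := hKab hp
    have h2 := hKab hq
    have h3 : p ≤ q := hpl hq
    refine ⟨(a + p) / 2, (q + b) / 2, by linarith [h1.1], by linarith [h1.1, h2.2],
      by linarith [h2.2], fun x hx => ⟨?_, ?_⟩⟩
    · have := hpl hx; linarith [h1.1]
    · have := hqg hx; linarith [h2.2]

lemma integrable_mul_of_tsupport_subset {u φ : ℝ → ℝ} {s : Set ℝ}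
    (hu : LocallyIntegrableOn u s) (hφ : Continuous φ) (hc : HasCompactSupport φ)
    (hs : tsupport φ ⊆ s) : Integrable (fun x => u x * φ x) := by
  have h1 : IntegrableOn (fun x => u x * φ x) (tsupport φ) :=
    (hu.integrableOn_compact_subset hs hc).mul_continuousOn hφ.continuousOn hc
  refine (integrableOn_iff_integrable_of_support_subset ?_).1 h1
  intro x hx
  apply subset_tsupport
  intro h0
  simp [h0] at hx

namespace IsTestFunction

variable {a b : ℝ} {φ ψ : ℝ → ℝ}

lemma continuous (h : IsTestFunction a b φ) : Continuous φ := h.contDiff.continuous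

lemma deriv (h : IsTestFunction a b φ) : IsTestFunction a b (deriv φ) where
  contDiff := (contDiff_infty_iff_deriv.1 h.contDiff).2
  hasCompactSupport := h.hasCompactSupport.deriv
  tsupport_subset := tsupport_deriv_subset.trans h.tsupport_subset

lemma isPrimitive (h : IsTestFunction a b φ) : IsPrimitive φ (_root_.deriv φ) :=
  IsPrimitive.of_contDiff (h.contDiff.of_le (by simp))

lemma eq_zero (h : IsTestFunction a b φ) {x : ℝ} (hx : x ∉ Ioo a b) : φ x = 0 :=
  image_eq_zero_of_notMem_tsupport fun h' => hx (h.tsupport_subset h')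

lemma add (h : IsTestFunction a b φ) (h' : IsTestFunction a b ψ) :
    IsTestFunction a b (fun x => φ x + ψ x) where
  contDiff := h.contDiff.add h'.contDiff
  hasCompactSupport := h.hasCompactSupport.add h'.hasCompactSupport
  tsupport_subset := (tsupport_add _ _).trans (union_subset h.tsupport_subset h'.tsupport_subset)

lemma const_mul (c : ℝ) (h : IsTestFunction a b φ) : IsTestFunction a b (fun x => c * φ x) where
  contDiff := contDiff_const.mul h.contDiff
  hasCompactSupport := h.hasCompactSupport.mul_left
  tsupport_subset := (tsupport_mul_subset_right).trans h.tsupport_subset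

lemma mono {a' b' : ℝ} (h : IsTestFunction a b φ) (hs : Ioo a b ⊆ Ioo a' b') :
    IsTestFunction a' b' φ := ⟨h.contDiff, h.hasCompactSupport, h.tsupport_subset.trans hs⟩

lemma integrable_mul {u : ℝ → ℝ} (h : IsTestFunction a b φ)
    (hu : LocallyIntegrableOn u (Ioo a b)) : Integrable (fun x => u x * φ x) :=
  integrable_mul_of_tsupport_subset hu h.continuous h.hasCompactSupport h.tsupport_subset

lemma integrable (h : IsTestFunction a b φ) : Integrable φ :=
  h.continuous.integrable_of_hasCompactSupport h.hasCompactSupport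

lemma setIntegral_mul (h : IsTestFunction a b φ) (u : ℝ → ℝ) :
    ∫ x in Ioo a b, u x * φ x = ∫ x, u x * φ x :=
  setIntegral_eq_integral_of_forall_compl_eq_zero fun x hx => by simp [h.eq_zero hx]

lemma setIntegral_mul_of_subset {a' b' : ℝ} (h : IsTestFunction a b φ)
    (hs : Ioo a b ⊆ Ioo a' b') (u : ℝ → ℝ) :
    ∫ x in Ioo a' b', u x * φ x = ∫ x in Ioo a b, u x * φ x := by
  rw [h.setIntegral_mul, (h.mono hs).setIntegral_mul]

/-- The primitive is constant off a compact interval containing the support: `0` on the left and the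
total integral, again `0`, on the right. -/
lemma primitive (hab : a < b) (h : IsTestFunction a b φ) (h0 : ∫ x in Ioo a b, φ x = 0) :
    IsTestFunction a b (fun x => ∫ t in a..x, φ t) ∧
      _root_.deriv (fun x => ∫ t in a..x, φ t) = φ := by
  have hd : ∀ x, HasDerivAt (fun x => ∫ t in a..x, φ t) (φ x) x := fun x =>
    intervalIntegral.integral_hasDerivAt_right (h.continuous.intervalIntegrable _ _)
      h.continuous.stronglyMeasurable.stronglyMeasurableAtFilter h.continuous.continuousAt
  have hd' : _root_.deriv (fun x => ∫ t in a..x, φ t) = φ := funext fun x => (hd x).deriv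
  refine ⟨?_, hd'⟩
  obtain ⟨c, d, hac, hcd, hdb, hK⟩ :=
    exists_Icc_of_isCompact_subset_Ioo hab h.hasCompactSupport h.tsupport_subset
  have hz : ∀ x, x ∉ Icc c d → φ x = 0 := fun x hx =>
    image_eq_zero_of_notMem_tsupport fun h' => hx (hK h')
  have hsupp : Function.support (fun x => ∫ t in a..x, φ t) ⊆ Icc c d := by
    intro x hx
    by_contra hx'
    apply hx
    rcases lt_or_ge x c with hxc | hxc
    · have : EqOn φ (fun _ => 0) (uIcc a x) := by
        intro t ht
        apply hz
        intro ht'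
        have : t ≤ max a x := ht.2
        exact absurd ht'.1 (not_le.2 (lt_of_le_of_lt this (max_lt hac hxc)))
      change ∫ t in a..x, φ t = 0
      rw [intervalIntegral.integral_congr this]; simp
    · have hxd : d < x := by
        by_contra hh
        exact hx' ⟨hxc, not_lt.1 hh⟩
      change ∫ t in a..x, φ t = 0
      have h1 : ∫ t in a..b, φ t = 0 := by
        rw [intervalIntegral.integral_of_le hab.le, integral_Ioc_eq_integral_Ioo, h0]
      have h2 : ∫ t in b..x, φ t = 0 := by
        have : EqOn φ (fun _ => 0) (uIcc b x) := by
          intro t ht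
          apply hz
          intro ht'
          have : min b x ≤ t := ht.1
          exact absurd ht'.2 (not_le.2 (lt_of_lt_of_le (lt_min hdb hxd) this))
        rw [intervalIntegral.integral_congr this]; simp
      rw [← intervalIntegral.integral_add_adjacent_intervals
        (h.continuous.intervalIntegrable a b) (h.continuous.intervalIntegrable b x), h1, h2]
      simp
  have hts : tsupport (fun x => ∫ t in a..x, φ t) ⊆ Icc c d :=
    closure_minimal hsupp isClosed_Icc
  refine ⟨?_, HasCompactSupport.of_support_subset_isCompact isCompact_Icc hsupp,
    hts.trans (Icc_subset_Ioo hac hdb)⟩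
  rw [contDiff_infty_iff_deriv]
  exact ⟨fun x => (hd x).differentiableAt, by rw [hd']; exact h.contDiff⟩

end IsTestFunction

lemma isTestFunction_contDiffBump {a b s : ℝ} (f : ContDiffBump s)
    (hs : Metric.closedBall s f.rOut ⊆ Ioo a b) : IsTestFunction a b f :=
  ⟨f.contDiff, f.hasCompactSupport, by rwa [f.tsupport_eq]⟩

lemma exists_isTestFunction_integral_eq_one {a b : ℝ} (hab : a < b) :
    ∃ φ, IsTestFunction a b φ ∧ ∫ x in Ioo a b, φ x = 1 := by
  let f : ContDiffBump ((a + b) / 2) := ⟨(b - a) / 8, (b - a) / 4, by linarith, by linarith⟩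
  have hf : IsTestFunction a b f := isTestFunction_contDiffBump f (by
    rw [Real.closedBall_eq_Icc]
    apply Icc_subset_Ioo <;> simp only [f] <;> linarith)
  have hpos : 0 < ∫ x, f x := f.integral_pos
  refine ⟨fun x => (∫ x, f x)⁻¹ * f x, hf.const_mul _, ?_⟩
  rw [hf.setIntegral_mul, integral_const_mul]
  exact inv_mul_cancel₀ hpos.ne'

/-- A locally integrable function on `(a,b)` that vanishes against all test functions vanishes. -/
lemma ae_eq_zero_of_integral_mul_eq_zero {a b : ℝ} {w : ℝ → ℝ}
    (hw : LocallyIntegrableOn w (Ioo a b))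
    (h : ∀ φ, IsTestFunction a b φ → ∫ x in Ioo a b, w x * φ x = 0) :
    w =ᵐ[volume.restrict (Ioo a b)] 0 := by
  rw [EventuallyEq, ae_restrict_iff' measurableSet_Ioo]
  refine isOpen_Ioo.ae_eq_zero_of_integral_contDiff_smul_eq_zero hw fun φ h1 h2 h3 => ?_
  have := h φ ⟨h1, h2, h3⟩
  rw [IsTestFunction.setIntegral_mul ⟨h1, h2, h3⟩] at this
  simpa [mul_comm] using this

/-- du Bois-Reymond: a function with vanishing weak derivative is constant. -/
lemma exists_ae_eq_const {a b : ℝ} (hab : a < b) {w : ℝ → ℝ}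
    (hw : LocallyIntegrableOn w (Ioo a b))
    (h : ∀ φ, IsTestFunction a b φ → ∫ x in Ioo a b, w x * deriv φ x = 0) :
    ∃ c : ℝ, w =ᵐ[volume.restrict (Ioo a b)] fun _ => c := by
  obtain ⟨φ₀, hφ₀, hφ₀1⟩ := exists_isTestFunction_integral_eq_one hab
  refine ⟨∫ x in Ioo a b, w x * φ₀ x, ?_⟩
  set c := ∫ x in Ioo a b, w x * φ₀ x with hc
  have hcl : LocallyIntegrableOn (fun _ : ℝ => c) (Ioo a b) :=
    (continuous_const.locallyIntegrable).locallyIntegrableOn _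
  have key := ae_eq_zero_of_integral_mul_eq_zero (hw.sub hcl) (fun φ hφ => by
    set m := ∫ x in Ioo a b, φ x with hm
    -- Subtracting `m φ₀` makes the mean zero, so this is the derivative of a test function and `w`
    -- annihilates it.
    have h1 : IsTestFunction a b (fun x => φ x + (-m) * φ₀ x) := hφ.add (hφ₀.const_mul _)
    have h2 := IsTestFunction.primitive hab h1 (by
      rw [integral_add hφ.integrable.integrableOn (hφ₀.integrable.integrableOn.const_mul _),
        integral_const_mul, hφ₀1]
      ring)
    have h3 := h _ h2.1
    rw [h2.2] at h3
    have e1 : ∀ x, w x * (φ x + (-m) * φ₀ x) = w x * φ x + (-m) * (w x * φ₀ x) := by intro x; ring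
    simp only [e1] at h3
    rw [integral_add (hφ.integrable_mul hw).integrableOn
      ((hφ₀.integrable_mul hw).integrableOn.const_mul _), integral_const_mul, ← hc] at h3
    have e2 : ∀ x, (w - (fun _ : ℝ => c)) x * φ x = w x * φ x - c * φ x := by
      intro x; simp only [Pi.sub_apply]; ring
    simp only [e2]
    rw [integral_sub (hφ.integrable_mul hw).integrableOn (hφ.integrable.integrableOn.const_mul _),
      integral_const_mul, ← hm]
    linarith)
  filter_upwards [key] with x hx
  simpa [sub_eq_zero] using hx

/-! ### Step functions. -/

/-- The step function with jumps `κ s` at `s ∈ S`. -/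
def stepSum (S : Finset ℝ) (κ : ℝ → ℝ) (x : ℝ) : ℝ := ∑ s ∈ S, if s < x then κ s else 0

lemma measurable_stepSum (S : Finset ℝ) (κ : ℝ → ℝ) : Measurable (stepSum S κ) := by
  unfold stepSum
  exact Finset.measurable_sum _ fun s _ =>
    Measurable.ite measurableSet_Ioi measurable_const measurable_const

lemma abs_stepSum_le (S : Finset ℝ) (κ : ℝ → ℝ) (x : ℝ) :
    |stepSum S κ x| ≤ ∑ s ∈ S, |κ s| := by
  refine (Finset.abs_sum_le_sum_abs _ _).trans (Finset.sum_le_sum fun s _ => ?_)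
  split_ifs <;> simp

lemma locallyIntegrable_stepSum (S : Finset ℝ) (κ : ℝ → ℝ) : LocallyIntegrable (stepSum S κ) := by
  refine LocallyIntegrable.mono (continuous_const (y := ∑ s ∈ S, |κ s|)).locallyIntegrable
    (measurable_stepSum S κ).aestronglyMeasurable (ae_of_all _ fun x => ?_)
  exact (abs_stepSum_le S κ x).trans (le_abs_self _)

/-- A function on `(a,b)` whose weak derivative vanishes off a finite set is a step function. -/
lemma exists_ae_eq_stepSum (S : Finset ℝ) {a : ℝ} {w : ℝ → ℝ} : ∀ {b : ℝ}, a < b →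
    (S : Set ℝ) ⊆ Ioo a b → LocallyIntegrableOn w (Ioo a b) →
    (∀ φ, IsTestFunction a b φ → Disjoint (tsupport φ) S →
      ∫ x in Ioo a b, w x * deriv φ x = 0) →
    ∃ (c : ℝ) (κ : ℝ → ℝ), w =ᵐ[volume.restrict (Ioo a b)] fun x => c + stepSum S κ x := by
  -- The rightmost point `s` is peeled off: the induction hypothesis, with `b` free, applies on `(a,
  -- s)`, and du Bois-Reymond on `(s, b)`.
  induction S using Finset.induction_on_max with
  | empty =>
    intro b hab _ hw h
    obtain ⟨c, hc⟩ := exists_ae_eq_const hab hw fun φ hφ => h φ hφ (by simp)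
    exact ⟨c, 0, by simpa [stepSum] using hc⟩
  | insert s S hs ih =>
    intro b hab hS hw h
    have hsm : s ∈ Ioo a b := hS (by simp)
    have hsS : s ∉ S := fun h' => lt_irrefl _ (hs s h')
    have hl : Ioo a s ⊆ Ioo a b := Ioo_subset_Ioo_right hsm.2.le
    have hr : Ioo s b ⊆ Ioo a b := Ioo_subset_Ioo_left hsm.1.le
    obtain ⟨c, κ, hcκ⟩ := ih hsm.1 (fun x hx => ⟨(hS (by simp [Finset.mem_coe.1 hx])).1, hs x hx⟩)
      (hw.mono_set hl) (fun φ hφ hd => by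
        rw [← hφ.deriv.setIntegral_mul_of_subset hl]
        refine h φ (hφ.mono hl) ?_
        rw [Finset.coe_insert, disjoint_insert_right]
        exact ⟨fun h' => lt_irrefl s (hφ.tsupport_subset h').2, hd⟩)
    obtain ⟨d, hd⟩ := exists_ae_eq_const hsm.2 (hw.mono_set hr) (fun φ hφ => by
        rw [← hφ.deriv.setIntegral_mul_of_subset hr]
        refine h φ (hφ.mono hr) ?_
        rw [Set.disjoint_right]
        intro x hx hx'
        have h1 := (hφ.tsupport_subset hx').1
        rcases Finset.mem_insert.1 (Finset.mem_coe.1 hx) with rfl | h2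
        · exact lt_irrefl _ h1
        · exact lt_asymm h1 (hs x h2))
    classical
    -- The jump at `s` leads from the value `c + ∑ κ` just left of `s` to the constant `d` on the
    -- right.
    refine ⟨c, Function.update κ s (d - c - ∑ t ∈ S, κ t), ?_⟩
    have hsum : ∀ x, stepSum (insert s S) (Function.update κ s (d - c - ∑ t ∈ S, κ t)) x
        = (if s < x then d - c - ∑ t ∈ S, κ t else 0) + stepSum S κ x := by
      intro x
      unfold stepSum
      rw [Finset.sum_insert hsS, Function.update_self]
      congr 1
      refine Finset.sum_congr rfl fun t ht => ?_
      rw [Function.update_of_ne (show t ≠ s from fun h' => hsS (h' ▸ ht))]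
    rw [EventuallyEq, ae_restrict_iff' measurableSet_Ioo] at hcκ hd ⊢
    filter_upwards [hcκ, hd, (measure_eq_zero_iff_ae_notMem.1 (measure_singleton (μ := volume) s))]
      with x h1 h2 h3 hx
    have h3' : x ≠ s := by simpa using h3
    rw [hsum]
    rcases lt_or_gt_of_ne h3' with hlt | hgt
    · rw [h1 ⟨hx.1, hlt⟩, if_neg (not_lt.2 hlt.le)]; ring
    · rw [h2 ⟨hgt, hx.2⟩, if_pos hgt]
      have : stepSum S κ x = ∑ t ∈ S, κ t :=
        Finset.sum_congr rfl fun t ht => if_pos ((hs t ht).trans hgt)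
      rw [this]; ring

/-! ### Weak derivatives -/

lemma IsPrimitive.integral_mul_deriv {a b : ℝ} {F f φ : ℝ → ℝ} (h : IsPrimitive F f)
    (hφ : IsTestFunction a b φ) :
    ∫ x in Ioo a b, F x * deriv φ x = -∫ x in Ioo a b, f x * φ x := by
  rcases lt_or_ge a b with hab | hab
  · have h1 := (h.mul hφ.isPrimitive).sub_eq a b
    rw [hφ.eq_zero (x := a) (by simp), hφ.eq_zero (x := b) (by simp),
      intervalIntegral.integral_of_le hab.le, integral_Ioc_eq_integral_Ioo,
      integral_add (hφ.integrable_mul (h.locallyIntegrable.locallyIntegrableOn _)).integrableOn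
        (hφ.deriv.integrable_mul
          (h.continuous.locallyIntegrable.locallyIntegrableOn _)).integrableOn] at h1
    linarith
  · simp [Ioo_eq_empty (not_lt.2 hab)]

lemma IsPrimitive.hasWeakDeriv {F f : ℝ → ℝ} (h : IsPrimitive F f) (a b : ℝ) :
    HasWeakDeriv a b F f :=
  ⟨h.continuous.locallyIntegrable.locallyIntegrableOn _,
    h.locallyIntegrable.locallyIntegrableOn _, fun _ hφ => h.integral_mul_deriv hφ⟩

lemma locallyIntegrableOn_Ioo_congr {a b : ℝ} {u v : ℝ → ℝ}
    (h : u =ᵐ[volume.restrict (Ioo a b)] v) (hu : LocallyIntegrableOn u (Ioo a b)) :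
    LocallyIntegrableOn v (Ioo a b) := by
  rw [locallyIntegrableOn_iff isOpen_Ioo.isLocallyClosed] at hu ⊢
  intro K hK hKc
  exact (hu K hK hKc).congr (ae_restrict_of_ae_restrict_of_subset hK h)

lemma HasWeakDeriv.congr {a b : ℝ} {u v f g : ℝ → ℝ} (h : HasWeakDeriv a b u f)
    (huv : u =ᵐ[volume.restrict (Ioo a b)] v) (hfg : f =ᵐ[volume.restrict (Ioo a b)] g) :
    HasWeakDeriv a b v g where
  locallyIntegrableOn := locallyIntegrableOn_Ioo_congr huv h.locallyIntegrableOn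
  locallyIntegrableOn_deriv := locallyIntegrableOn_Ioo_congr hfg h.locallyIntegrableOn_deriv
  integral_mul_deriv φ hφ := by
    have h1 : ∫ x in Ioo a b, v x * deriv φ x = ∫ x in Ioo a b, u x * deriv φ x :=
      integral_congr_ae (huv.mono fun x hx => by simp [hx])
    have h2 : ∫ x in Ioo a b, g x * φ x = ∫ x in Ioo a b, f x * φ x :=
      integral_congr_ae (hfg.mono fun x hx => by simp [hx])
    rw [h1, h2]
    exact h.integral_mul_deriv φ hφ

lemma HasWeakDeriv.unique {a b : ℝ} {u f g : ℝ → ℝ} (hf : HasWeakDeriv a b u f)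
    (hg : HasWeakDeriv a b u g) : f =ᵐ[volume.restrict (Ioo a b)] g := by
  have := ae_eq_zero_of_integral_mul_eq_zero
    (hf.locallyIntegrableOn_deriv.sub hg.locallyIntegrableOn_deriv) (fun φ hφ => by
      have h1 := hf.integral_mul_deriv φ hφ
      have h2 := hg.integral_mul_deriv φ hφ
      simp only [Pi.sub_apply, sub_mul]
      rw [integral_sub (hφ.integrable_mul hf.locallyIntegrableOn_deriv).integrableOn
        (hφ.integrable_mul hg.locallyIntegrableOn_deriv).integrableOn]
      linarith)
  filter_upwards [this] with x hx
  simpa [sub_eq_zero] using hx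

lemma HasWeakDeriv.weakDeriv {a b : ℝ} {u f : ℝ → ℝ} (hf : HasWeakDeriv a b u f) :
    HasWeakDeriv a b u (weakDeriv a b u) := by
  have h : ∃ g : ℝ → ℝ, HasWeakDeriv a b u g := ⟨f, hf⟩
  rw [EdgePenalization.weakDeriv, dif_pos h]
  exact h.choose_spec

lemma HasWeakDeriv.weakDeriv_ae_eq {a b : ℝ} {u f : ℝ → ℝ} (hf : HasWeakDeriv a b u f) :
    EdgePenalization.weakDeriv a b u =ᵐ[volume.restrict (Ioo a b)] f :=
  hf.weakDeriv.unique hf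

/-- A function with integrable weak derivative has an absolutely continuous representative. -/
lemma HasWeakDeriv.exists_isPrimitive {a b : ℝ} (hab : a < b) {u g : ℝ → ℝ}
    (h : HasWeakDeriv a b u g) (hg : IntegrableOn g (Ioo a b)) :
    ∃ U, IsPrimitive U ((Ioo a b).indicator g) ∧ u =ᵐ[volume.restrict (Ioo a b)] U := by
  have hgi : IsPrimitive (fun x => 0 + ∫ t in a..x, (Ioo a b).indicator g t)
      ((Ioo a b).indicator g) :=
    IsPrimitive.of_integral ((integrable_indicator_iff measurableSet_Ioo).2 hg).locallyIntegrable
      0 a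
  set G := fun x => 0 + ∫ t in a..x, (Ioo a b).indicator g t
  have hG := (hgi.hasWeakDeriv a b).congr EventuallyEq.rfl
    (indicator_ae_eq_restrict measurableSet_Ioo)
  obtain ⟨c, hc⟩ := exists_ae_eq_const hab (h.locallyIntegrableOn.sub hG.locallyIntegrableOn)
    (fun φ hφ => by
      have h1 := h.integral_mul_deriv φ hφ
      have h2 := hG.integral_mul_deriv φ hφ
      simp only [Pi.sub_apply, sub_mul]
      rw [integral_sub (hφ.deriv.integrable_mul h.locallyIntegrableOn).integrableOn
        (hφ.deriv.integrable_mul hG.locallyIntegrableOn).integrableOn]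
      linarith)
  refine ⟨fun x => c + G x, by simpa using (IsPrimitive.const c).add hgi, ?_⟩
  filter_upwards [hc] with x hx
  simp only [Pi.sub_apply] at hx
  linarith

lemma integrableOn_Ioo_of_memLp {a b : ℝ} {g : ℝ → ℝ}
    (hg : MemLp g 2 (volume.restrict (Ioo a b))) : IntegrableOn g (Ioo a b) :=
  hg.integrable (by norm_num)

/-- The weak derivative of a `W^{1,2}` function is in `L²`. -/
lemma MemW12.memLp_weakDeriv {a b : ℝ} {u : ℝ → ℝ} (h : MemW12 a b u) :
    MemLp (weakDeriv a b u) 2 (volume.restrict (Ioo a b)) := by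
  obtain ⟨-, g, hg, hw⟩ := h
  exact (memLp_congr_ae hw.weakDeriv_ae_eq).2 hg

lemma MemW12.hasWeakDeriv {a b : ℝ} {u : ℝ → ℝ} (h : MemW12 a b u) :
    HasWeakDeriv a b u (weakDeriv a b u) := by
  obtain ⟨-, g, -, hw⟩ := h
  exact hw.weakDeriv

/-- The `C¹` representative of a `W^{2,2}` function. -/
lemma MemW22.exists_isPrimitive {a b : ℝ} (hab : a < b) {v : ℝ → ℝ} (h : MemW22 a b v) :
    ∃ V V' V'', IsPrimitive V V' ∧ IsPrimitive V' V'' ∧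
      v =ᵐ[volume.restrict (Ioo a b)] V ∧
      weakDeriv a b (weakDeriv a b v) =ᵐ[volume.restrict (Ioo a b)] V'' ∧ MemLp V'' 2 := by
  obtain ⟨-, g, hg, hw⟩ := h
  obtain ⟨V', hV', hgV'⟩ :=
    hg.hasWeakDeriv.exists_isPrimitive hab (integrableOn_Ioo_of_memLp hg.memLp_weakDeriv)
  have hw' : HasWeakDeriv a b v V' := hw.congr EventuallyEq.rfl hgV'
  obtain ⟨V, hV, hvV⟩ := hw'.exists_isPrimitive hab
    ((hV'.continuous.integrableOn_Icc).mono_set Ioo_subset_Icc_self)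
  set g'' := (Ioo a b).indicator (weakDeriv a b g)
  -- The density of `V` is cut off outside `(a,b)`. Integrating `V'` itself from `a` gives a
  -- representative that is `C¹` on the whole line, so windows need no care at the ends.
  have hW : IsPrimitive (fun x => V a + ∫ t in a..x, V' t) V' :=
    IsPrimitive.of_integral hV'.continuous.locallyIntegrable _ _
  refine ⟨_, V', _, hW, hV', ?_, ?_, (memLp_indicator_iff_restrict measurableSet_Ioo).2
    hg.memLp_weakDeriv⟩
  · rw [EventuallyEq, ae_restrict_iff' measurableSet_Ioo] at hvV ⊢
    filter_upwards [hvV] with x hx hxm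
    rw [hx hxm, hV.eq_add a x]
    congr 1
    apply intervalIntegral.integral_congr_ae
    rw [uIoc_of_le hxm.1.le]
    filter_upwards with t ht
    exact indicator_of_mem (show t ∈ Ioo a b from ⟨ht.1, ht.2.trans_lt hxm.2⟩) _
  · have h1 : weakDeriv a b v =ᵐ[volume.restrict (Ioo a b)] g := hw.weakDeriv_ae_eq
    have h2 : HasWeakDeriv a b (weakDeriv a b v) (weakDeriv a b g) :=
      hg.hasWeakDeriv.congr h1.symm EventuallyEq.rfl
    exact h2.weakDeriv_ae_eq.trans (indicator_ae_eq_restrict measurableSet_Ioo).symm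

lemma IsPrimitive.memW12 {a b : ℝ} {F f : ℝ → ℝ} (h : IsPrimitive F f)
    (hf : MemLp f 2 (volume.restrict (Ioo a b))) : MemW12 a b F := by
  refine ⟨?_, f, hf, h.hasWeakDeriv a b⟩
  obtain ⟨C, hC⟩ := isCompact_Icc.exists_bound_of_continuousOn
    (h.continuous.continuousOn (s := Icc a b))
  refine MemLp.of_bound h.continuous.aestronglyMeasurable C ?_
  rw [ae_restrict_iff' measurableSet_Ioo]
  exact ae_of_all _ fun x hx => hC x (Ioo_subset_Icc_self hx)

lemma IsPrimitive.memW22 {a b : ℝ} {F F' F'' : ℝ → ℝ} (h : IsPrimitive F F')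
    (h' : IsPrimitive F' F'') (hf : MemLp F'' 2 (volume.restrict (Ioo a b))) : MemW22 a b F :=
  ⟨(h.memW12 (h'.memW12 hf).1).1, F', h'.memW12 hf, h.hasWeakDeriv a b⟩

lemma MemW12.congr {a b : ℝ} {u v : ℝ → ℝ} (h : MemW12 a b u)
    (huv : u =ᵐ[volume.restrict (Ioo a b)] v) : MemW12 a b v := by
  obtain ⟨h1, g, hg, hw⟩ := h
  exact ⟨(memLp_congr_ae huv).1 h1, g, hg, hw.congr huv EventuallyEq.rfl⟩

lemma MemW22.congr {a b : ℝ} {u v : ℝ → ℝ} (h : MemW22 a b u)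
    (huv : u =ᵐ[volume.restrict (Ioo a b)] v) : MemW22 a b v := by
  obtain ⟨h1, g, hg, hw⟩ := h
  exact ⟨(memLp_congr_ae huv).1 h1, g, hg, hw.congr huv EventuallyEq.rfl⟩

/-! ### Approximate limits and derivatives -/

lemma setAverage_ball_eq {x r : ℝ} (hr : 0 < r) (f : ℝ → ℝ) :
    ⨍ y in Metric.ball x r, f y = (2 * r)⁻¹ * ∫ y in (x - r)..(x + r), f y := by
  rw [setAverage_eq, Real.ball_eq_Ioo, intervalIntegral.integral_of_le (by linarith),
    integral_Ioc_eq_integral_Ioo, smul_eq_mul, measureReal_def, Real.volume_Ioo,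
    ENNReal.toReal_ofReal (by linarith)]
  congr 2; ring

lemma abs_setAverage_ball_le {x r C : ℝ} (hr : 0 < r) {f : ℝ → ℝ}
    (hf : ∀ y ∈ Metric.ball x r, |f y| ≤ C) : |⨍ y in Metric.ball x r, f y| ≤ C := by
  rw [setAverage_eq, smul_eq_mul, abs_mul, measureReal_def, Real.volume_ball,
    ENNReal.toReal_ofReal (by linarith), abs_of_pos (by positivity)]
  have h1 := norm_setIntegral_le_of_norm_le_const (μ := volume) (s := Metric.ball x r)
    (f := f) measure_ball_lt_top fun y hy => (Real.norm_eq_abs _).trans_le (hf y hy)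
  rw [measureReal_def, Real.volume_ball, ENNReal.toReal_ofReal (by linarith)] at h1
  rw [inv_mul_le_iff₀ (by linarith)]
  rw [Real.norm_eq_abs] at h1
  linarith

lemma eventually_ball_subset_Ioo {a b x : ℝ} (hx : x ∈ Ioo a b) :
    ∀ᶠ r in 𝓝[>] (0 : ℝ), 0 < r ∧ Metric.ball x r ⊆ Ioo a b := by
  obtain ⟨δ, hδ, hs⟩ := Metric.isOpen_iff.1 isOpen_Ioo x hx
  filter_upwards [Ioo_mem_nhdsGT hδ] with r hr
  exact ⟨hr.1, (Metric.ball_subset_ball hr.2.le).trans hs⟩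

lemma setAverage_ball_congr {a b x r : ℝ} (hr : Metric.ball x r ⊆ Ioo a b)
    {f g : ℝ → ℝ} (h : f =ᵐ[volume.restrict (Ioo a b)] g) :
    ⨍ y in Metric.ball x r, f y = ⨍ y in Metric.ball x r, g y := by
  rw [setAverage_eq, setAverage_eq,
    integral_congr_ae (ae_restrict_of_ae_restrict_of_subset hr h)]

section Congr

variable {a b x : ℝ} {u v : ℝ → ℝ}

lemma HasApproxLimit.congr {z : ℝ} (hx : x ∈ Ioo a b) (h : u =ᵐ[volume.restrict (Ioo a b)] v)
    (hu : HasApproxLimit u x z) : HasApproxLimit v x z := by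
  refine Tendsto.congr' ?_ hu
  filter_upwards [eventually_ball_subset_Ioo hx] with r hr
  exact setAverage_ball_congr hr.2 (h.mono fun y hy => by simp only [hy])

lemma HasApproxDerivAt.congr {L : ℝ} (hx : x ∈ Ioo a b) (h : u =ᵐ[volume.restrict (Ioo a b)] v)
    (hu : HasApproxDerivAt u x L) : HasApproxDerivAt v x L := by
  obtain ⟨z, hz, hL⟩ := hu
  refine ⟨z, hz.congr hx h, Tendsto.congr' ?_ hL⟩
  filter_upwards [eventually_ball_subset_Ioo hx] with r hr
  exact setAverage_ball_congr hr.2 (h.mono fun y hy => by simp only [hy])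

end Congr

lemma tendsto_setAverage_ball_zero {x : ℝ} {f : ℝ → ℝ → ℝ}
    (h : ∀ δ > 0, ∃ η > 0, ∀ r, 0 < r → r < η → ∀ y ∈ Metric.ball x r, |f r y| ≤ δ) :
    Tendsto (fun r : ℝ => ⨍ y in Metric.ball x r, f r y) (𝓝[>] 0) (𝓝 0) := by
  rw [Metric.tendsto_nhds]
  intro δ hδ
  obtain ⟨η, hη, hr⟩ := h (δ / 2) (by linarith)
  filter_upwards [Ioo_mem_nhdsGT hη] with r hr'
  rw [Real.dist_eq, sub_zero]
  exact (abs_setAverage_ball_le hr'.1 (hr r hr'.1 hr'.2)).trans_lt (by linarith)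

lemma hasApproxLimit_of_continuousAt {U : ℝ → ℝ} {x : ℝ} (h : ContinuousAt U x) :
    HasApproxLimit U x (U x) := by
  refine tendsto_setAverage_ball_zero fun δ hδ => ?_
  obtain ⟨η, hη, hU⟩ := Metric.continuousAt_iff.1 h δ hδ
  refine ⟨η, hη, fun r _ hr y hy => ?_⟩
  rw [abs_abs]
  exact (hU (lt_trans hy hr)).le

lemma hasApproxDerivAt_of_hasDerivAt {U : ℝ → ℝ} {x L : ℝ} (h : HasDerivAt U L x) :
    HasApproxDerivAt U x L := by
  refine ⟨U x, hasApproxLimit_of_continuousAt h.continuousAt,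
    tendsto_setAverage_ball_zero fun δ hδ => ?_⟩
  have h1 := (hasDerivAt_iff_isLittleO.1 h).def hδ
  obtain ⟨η, hη, hU⟩ := Metric.eventually_nhds_iff.1 h1
  refine ⟨η, hη, fun r hr0 hr y hy => ?_⟩
  have h2 := hU (lt_trans hy hr)
  rw [Real.norm_eq_abs, Real.norm_eq_abs, smul_eq_mul] at h2
  rw [abs_div, abs_abs, abs_of_pos hr0, div_le_iff₀ hr0, mul_comm L]
  have h3 : |y - x| < r := hy
  exact h2.trans (mul_le_mul_of_nonneg_left h3.le hδ.le)

lemma setAverage_ball_mono {x r : ℝ} {f g : ℝ → ℝ} (hf : LocallyIntegrable f)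
    (hg : LocallyIntegrable g) (h : ∀ y, f y ≤ g y) :
    ⨍ y in Metric.ball x r, f y ≤ ⨍ y in Metric.ball x r, g y := by
  rw [setAverage_eq, setAverage_eq]
  have hs : Metric.ball x r ⊆ Metric.closedBall x r := Metric.ball_subset_closedBall
  exact smul_le_smul_of_nonneg_left (integral_mono
    ((hf.integrableOn_isCompact (isCompact_closedBall x r)).mono_set hs)
    ((hg.integrableOn_isCompact (isCompact_closedBall x r)).mono_set hs) h) (by positivity)

lemma setAverage_ball_add {x r : ℝ} {f g : ℝ → ℝ} (hf : LocallyIntegrable f)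
    (hg : LocallyIntegrable g) :
    ⨍ y in Metric.ball x r, (f y + g y) =
      (⨍ y in Metric.ball x r, f y) + ⨍ y in Metric.ball x r, g y := by
  have hs : Metric.ball x r ⊆ Metric.closedBall x r := Metric.ball_subset_closedBall
  rw [setAverage_eq, setAverage_eq, setAverage_eq, integral_add
    ((hf.integrableOn_isCompact (isCompact_closedBall x r)).mono_set hs)
    ((hg.integrableOn_isCompact (isCompact_closedBall x r)).mono_set hs), smul_add]

lemma locallyIntegrable_abs {f : ℝ → ℝ} (hf : LocallyIntegrable f) :
    LocallyIntegrable (fun x => |f x|) :=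
  LocallyIntegrable.mono hf hf.aestronglyMeasurable.norm (ae_of_all _ fun x => by simp)

/-- If the averages of `f` and of `g` vanish in the limit, so do those of anything below. -/
lemma le_zero_of_setAverage_le {x C : ℝ} {f g h : ℝ → ℝ → ℝ}
    (hf : ∀ r, LocallyIntegrable (f r)) (hg : ∀ r, LocallyIntegrable (g r))
    (hh : ∀ r, LocallyIntegrable (h r)) (hle : ∀ r y, 0 < r → h r y ≤ f r y + g r y)
    (hf0 : Tendsto (fun r : ℝ => ⨍ y in Metric.ball x r, f r y) (𝓝[>] 0) (𝓝 0))
    (hg0 : Tendsto (fun r : ℝ => ⨍ y in Metric.ball x r, g r y) (𝓝[>] 0) (𝓝 0))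
    (hC : ∀ r, 0 < r → C ≤ ⨍ y in Metric.ball x r, h r y) : C ≤ 0 := by
  have h1 := hf0.add hg0
  rw [add_zero] at h1
  refine ge_of_tendsto h1 ?_
  filter_upwards [self_mem_nhdsWithin] with r hr
  rw [← setAverage_ball_add (hf r) (hg r)]
  exact (hC r hr).trans (setAverage_ball_mono (hh r) ((hf r).add (hg r)) fun y => hle r y hr)

lemma HasApproxLimit.unique {U : ℝ → ℝ} {x z z' : ℝ} (hU : LocallyIntegrable U)
    (h : HasApproxLimit U x z) (h' : HasApproxLimit U x z') : z = z' := by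
  have hl : ∀ z, LocallyIntegrable (fun y => |U y - z|) := fun z =>
    locallyIntegrable_abs (hU.sub (locallyIntegrable_const z))
  have := le_zero_of_setAverage_le (C := |z - z'|) (h := fun _ _ => |z - z'|)
    (fun _ => hl z) (fun _ => hl z') (fun _ => locallyIntegrable_const _)
    (fun r y _ => by rw [abs_sub_comm (U y) z]; exact abs_sub_le z (U y) z') h h'
    (fun r hr => by
      rw [setAverage_ball_eq hr, intervalIntegral.integral_const, smul_eq_mul]
      apply le_of_eq; field_simp; ring)
  exact sub_eq_zero.1 (abs_eq_zero.1 (le_antisymm this (abs_nonneg _)))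

/-- Two candidates would force the averages of `|L - L'| |y - x| / r` to vanish in the limit, but
these are scale invariant. -/
lemma HasApproxDerivAt.unique {U : ℝ → ℝ} {x L L' : ℝ} (hU : LocallyIntegrable U)
    (h : HasApproxDerivAt U x L) (h' : HasApproxDerivAt U x L') : L = L' := by
  obtain ⟨z, hz, hL⟩ := h
  obtain ⟨z', hz', hL'⟩ := h'
  obtain rfl := hz.unique hU hz'
  have hlin : ∀ M : ℝ, LocallyIntegrable (fun y : ℝ => M * (y - x)) := fun M =>
    (by fun_prop : Continuous fun y : ℝ => M * (y - x)).locallyIntegrable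
  have hl : ∀ (M r : ℝ), LocallyIntegrable (fun y => |U y - z - M * (y - x)| / r) := fun M r => by
    simp_rw [div_eq_inv_mul]
    exact (locallyIntegrable_abs ((hU.sub (locallyIntegrable_const z)).sub (hlin M))).smul r⁻¹
  have hc : ∀ r : ℝ, Continuous (fun y : ℝ => |L - L'| * |y - x| / r) := fun r => by fun_prop
  -- The right half of the ball alone contributes `|L - L'| / 4` to the average, which suffices.
  have := le_zero_of_setAverage_le (C := |L - L'| / 4) (h := fun r y => |L - L'| * |y - x| / r)
    (hl L) (hl L') (fun r => (hc r).locallyIntegrable)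
    (fun r y hr => by
      rw [← abs_mul, ← add_div]
      gcongr
      have := abs_sub_le (U y - z - L' * (y - x)) 0 (U y - z - L * (y - x))
      rw [sub_zero, zero_sub, abs_neg] at this
      calc |(L - L') * (y - x)| = |U y - z - L' * (y - x) - (U y - z - L * (y - x))| := by
            congr 1; ring
        _ ≤ _ := by linarith) hL hL'
    (fun r hr => by
      rw [setAverage_ball_eq hr, ← intervalIntegral.integral_add_adjacent_intervals
        ((hc r).intervalIntegrable (x - r) x) ((hc r).intervalIntegrable x (x + r))]
      have h1 : 0 ≤ ∫ y in (x - r)..x, |L - L'| * |y - x| / r :=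
        intervalIntegral.integral_nonneg (by linarith) fun y _ => by positivity
      have h2 : ∫ y in x..(x + r), |L - L'| * |y - x| / r = |L - L'| * r / 2 := by
        have : EqOn (fun y => |L - L'| * |y - x| / r) (fun y => |L - L'| / r * (y - x))
            (uIcc x (x + r)) := by
          intro y hy
          rw [uIcc_of_le (by linarith)] at hy
          simp only [abs_of_nonneg (sub_nonneg.2 hy.1)]
          ring
        rw [intervalIntegral.integral_congr this, intervalIntegral.integral_const_mul,
          intervalIntegral.integral_comp_sub_right (fun y => y) x, integral_id]
        field_simp; ring
      rw [h2, inv_mul_eq_div, le_div_iff₀ (by linarith)]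
      nlinarith [h1])
  exact sub_eq_zero.1 (abs_eq_zero.1 (le_antisymm (by linarith) (abs_nonneg _)))

/-! ### Piecewise absolutely continuous functions -/

lemma continuousAt_stepSum {S : Finset ℝ} {κ : ℝ → ℝ} {x : ℝ} (h : x ∈ S → κ x = 0) :
    ContinuousAt (stepSum S κ) x := by
  unfold stepSum
  refine tendsto_finsetSum _ fun s hs => ?_
  rcases lt_trichotomy s x with hsx | rfl | hsx
  · refine (continuousAt_const (y := κ s)).congr ?_ |>.tendsto
    filter_upwards [Ioi_mem_nhds hsx] with y hy
    exact (if_pos hy).symm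
  · simp only [h hs, ite_self]
    exact tendsto_const_nhds
  · refine (continuousAt_const (y := (0 : ℝ))).congr ?_ |>.tendsto
    filter_upwards [Iio_mem_nhds hsx] with y hy
    exact (if_neg (not_lt.2 (le_of_lt hy))).symm

lemma hasDerivAt_stepSum {S : Finset ℝ} {κ : ℝ → ℝ} {x : ℝ} (h : x ∉ S) :
    HasDerivAt (stepSum S κ) 0 x := by
  have : HasDerivAt (fun y => ∑ s ∈ S, if s < y then κ s else 0) (∑ s ∈ S, (0 : ℝ)) x := by
    refine HasDerivAt.fun_sum fun s hs => ?_
    rcases lt_or_gt_of_ne (show s ≠ x from fun h' => h (h' ▸ hs)) with hsx | hsx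
    · refine (hasDerivAt_const x (κ s)).congr_of_eventuallyEq ?_
      filter_upwards [Ioi_mem_nhds hsx] with y hy
      exact if_pos hy
    · refine (hasDerivAt_const x (0 : ℝ)).congr_of_eventuallyEq ?_
      filter_upwards [Iio_mem_nhds hsx] with y hy
      exact if_neg (not_lt.2 (le_of_lt hy))
  rw [Finset.sum_const_zero] at this
  exact this

/-- On the two halves of a small ball the step differs from a constant `c` by `|c|` and `|k - c|`,
so its average deviation is at least `|k| / 2` at every scale; the continuous part does not
interfere. -/
lemma not_hasApproxLimit_of_jump {V : ℝ → ℝ} {s k z : ℝ} (hVl : LocallyIntegrable V)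
    (hV : ContinuousAt V s) (hk : k ≠ 0) :
    ¬ HasApproxLimit (fun y => V y + if s < y then k else 0) s z := by
  intro h
  have hstep : LocallyIntegrable (fun y : ℝ => if s < y then k else 0) := by
    have h1 := locallyIntegrable_stepSum {s} (fun _ => k)
    have h2 : stepSum {s} (fun _ => k) = fun y => if s < y then k else 0 := by ext; simp [stepSum]
    rwa [h2] at h1
  have hh : LocallyIntegrable (fun y => |(if s < y then k else 0) - (z - V s)|) :=
    locallyIntegrable_abs (hstep.sub (locallyIntegrable_const (z - V s)))
  have := le_zero_of_setAverage_le (C := |k| / 2)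
    (h := fun _ y => |(if s < y then k else 0) - (z - V s)|)
    (fun _ => locallyIntegrable_abs ((hVl.add hstep).sub (locallyIntegrable_const z)))
    (fun _ => locallyIntegrable_abs (hVl.sub (locallyIntegrable_const (V s))))
    (fun _ => hh)
    (fun r y _ => by
      have := abs_sub (V y + (if s < y then k else 0) - z) (V y - V s)
      refine le_trans (le_of_eq ?_) this
      congr 1; ring) h (hasApproxLimit_of_continuousAt hV)
    (fun r hr => by
      rw [setAverage_ball_eq hr, ← intervalIntegral.integral_add_adjacent_intervals
        (intervalIntegrable_of_locallyIntegrable hh (s - r) s)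
        (intervalIntegrable_of_locallyIntegrable hh s (s + r))]
      have h1 : ∫ y in (s - r)..s, |(if s < y then k else 0) - (z - V s)| = r * |z - V s| := by
        have : EqOn (fun y => |(if s < y then k else 0) - (z - V s)|) (fun _ => |z - V s|)
            (uIcc (s - r) s) := by
          intro y hy
          rw [uIcc_of_le (by linarith)] at hy
          simp only [if_neg (not_lt.2 hy.2), zero_sub, abs_neg]
        rw [intervalIntegral.integral_congr this, intervalIntegral.integral_const, smul_eq_mul]
        ring
      have h2 : ∫ y in s..(s + r), |(if s < y then k else 0) - (z - V s)|
          = r * |k - (z - V s)| := by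
        rw [intervalIntegral.integral_congr_ae (g := fun _ => |k - (z - V s)|),
          intervalIntegral.integral_const, smul_eq_mul]
        · ring
        · filter_upwards with y hy
          rw [uIoc_of_le (by linarith)] at hy
          rw [if_pos hy.1]
      rw [h1, h2, inv_mul_eq_div, le_div_iff₀ (by linarith)]
      have h3 : |k| ≤ |z - V s| + |k - (z - V s)| := by
        have := abs_add_le (z - V s) (k - (z - V s))
        simpa using this
      nlinarith)
  have : 0 < |k| := abs_pos.2 hk
  linarith

/-- `u` agrees a.e. on `(a,b)` with `G + stepSum S κ`, where `G` is a primitive of `g` and `S` is a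
finite subset of `(a,b)`. -/
structure PiecewiseRep (a b : ℝ) (u G g : ℝ → ℝ) (S : Finset ℝ) (κ : ℝ → ℝ) : Prop where
  isPrimitive : IsPrimitive G g
  subset : (S : Set ℝ) ⊆ Ioo a b
  ae_eq : u =ᵐ[volume.restrict (Ioo a b)] fun x => G x + stepSum S κ x

namespace PiecewiseRep

variable {a b : ℝ} {u G g : ℝ → ℝ} {S : Finset ℝ} {κ : ℝ → ℝ}

lemma locallyIntegrable (h : PiecewiseRep a b u G g S κ) :
    LocallyIntegrable (fun x => G x + stepSum S κ x) :=
  h.isPrimitive.continuous.locallyIntegrable.add (locallyIntegrable_stepSum S κ)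

/-- Points with `κ s = 0` are spurious. At a true jump the remaining steps are continuous and join
the continuous part. -/
lemma approxDiscontSet_eq (h : PiecewiseRep a b u G g S κ) :
    approxDiscontSet a b u = {s | s ∈ S ∧ κ s ≠ 0} := by
  classical
  ext x
  constructor
  · rintro ⟨hx, hn⟩
    by_contra hx'
    apply hn
    have hc : ContinuousAt (fun x => G x + stepSum S κ x) x :=
      h.isPrimitive.continuous.continuousAt.add (continuousAt_stepSum fun hxS => by
        by_contra h0
        exact hx' ⟨hxS, h0⟩)
    exact ⟨_, (hasApproxLimit_of_continuousAt hc).congr hx h.ae_eq.symm⟩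
  · rintro ⟨hxS, hκ⟩
    have hx := h.subset hxS
    refine ⟨hx, ?_⟩
    rintro ⟨z, hz⟩
    have h1 := hz.congr hx h.ae_eq
    have h2 : (fun y => G y + stepSum S κ y)
        = fun y => (G y + stepSum (S.erase x) κ y) + if x < y then κ x else 0 := by
      ext y
      unfold stepSum
      rw [← Finset.sum_erase_add _ _ hxS]; ring
    rw [h2] at h1
    exact not_hasApproxLimit_of_jump
      (h.isPrimitive.continuous.locallyIntegrable.add (locallyIntegrable_stepSum _ κ))
      (h.isPrimitive.continuous.continuousAt.add (continuousAt_stepSum fun hx' => by simp at hx'))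
      hκ h1

/-- The choice made in `approxDeriv` is harmless because approximate derivatives are unique; almost
everywhere off `S` the representative has the classical derivative `g`. -/
lemma approxDeriv_ae_eq (h : PiecewiseRep a b u G g S κ) :
    approxDeriv u =ᵐ[volume.restrict (Ioo a b)] g := by
  rw [EventuallyEq, ae_restrict_iff' measurableSet_Ioo]
  filter_upwards [h.isPrimitive.ae_hasDerivAt,
    measure_eq_zero_iff_ae_notMem.1 (S.finite_toSet.measure_zero volume)] with x hx hxS hxm
  have hd : HasDerivAt (fun x => G x + stepSum S κ x) (g x) x := by
    have := hx.add (hasDerivAt_stepSum (κ := κ) hxS)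
    rw [add_zero] at this
    exact this
  have h1 : ∃ L, HasApproxDerivAt u x L :=
    ⟨g x, (hasApproxDerivAt_of_hasDerivAt hd).congr hxm h.ae_eq.symm⟩
  rw [approxDeriv, dif_pos h1]
  exact (h1.choose_spec.congr hxm h.ae_eq).unique h.locallyIntegrable
    (hasApproxDerivAt_of_hasDerivAt hd)

end PiecewiseRep

/-! ### Signed measures -/

lemma isFiniteMeasure_variation (μ : SignedMeasure ℝ) : IsFiniteMeasure μ.variation := by
  rw [← SignedMeasure.totalVariation_eq_variation]
  infer_instance

lemma IsTestFunction.exists_bound {a b : ℝ} {φ : ℝ → ℝ} (h : IsTestFunction a b φ) :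
    ∃ C, 0 < C ∧ ∀ x, |φ x| ≤ C := by
  obtain ⟨C, hC⟩ := h.hasCompactSupport.exists_bound_of_continuous h.continuous
  exact ⟨max C 1, by positivity, fun x => (hC x).trans (le_max_left _ _)⟩

lemma IsTestFunction.integrable_signedMeasure {a b : ℝ} {φ : ℝ → ℝ} (h : IsTestFunction a b φ)
    (μ : SignedMeasure ℝ) : μ.Integrable φ := by
  have := isFiniteMeasure_variation μ
  obtain ⟨C, -, hC⟩ := h.exists_bound
  exact Integrable.of_bound h.continuous.aestronglyMeasurable C (ae_of_all _ hC)

/-- The signed density is split into its positive and negative parts, each of which defines a finite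
measure. -/
lemma integral_withDensityᵥ {a b : ℝ} {f φ : ℝ → ℝ} (hf : Integrable f)
    (hφ : IsTestFunction a b φ) :
    ∫ᵛ x, φ x ∂<•(volume.withDensityᵥ f) = ∫ x, f x * φ x := by
  have : IsFiniteMeasure (volume.withDensity fun x => ENNReal.ofReal (f x)) :=
    isFiniteMeasure_withDensity_ofReal hf.2
  have : IsFiniteMeasure (volume.withDensity fun x => ENNReal.ofReal (-f x)) :=
    isFiniteMeasure_withDensity_ofReal hf.neg.2
  obtain ⟨C, -, hC⟩ := hφ.exists_bound
  have hi1 : Integrable (fun x => max (f x) 0 * φ x) :=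
    hf.pos_part.mul_bdd hφ.continuous.aestronglyMeasurable (ae_of_all _ hC)
  have hi2 : Integrable (fun x => max (-f x) 0 * φ x) :=
    hf.neg.pos_part.mul_bdd hφ.continuous.aestronglyMeasurable (ae_of_all _ hC)
  rw [withDensityᵥ_eq_withDensity_pos_part_sub_withDensity_neg_part hf,
    VectorMeasure.integral_sub_vectorMeasure (hφ.integrable_signedMeasure _)
      (hφ.integrable_signedMeasure _), VectorMeasure.integral_toSignedMeasure,
    VectorMeasure.integral_toSignedMeasure,
    integral_withDensity_eq_integral_toReal_smul₀ hf.1.aemeasurable.ennreal_ofReal (by simp),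
    integral_withDensity_eq_integral_toReal_smul₀ (f := fun x => ENNReal.ofReal (-f x))
      hf.1.aemeasurable.neg.ennreal_ofReal (by simp)]
  simp only [ENNReal.toReal_ofReal', smul_eq_mul]
  rw [← integral_sub hi1 hi2]
  congr 1 with x
  rcases le_total (f x) 0 with h | h
  · rw [max_eq_right h, max_eq_left (by linarith)]; ring
  · rw [max_eq_left h, max_eq_right (by linarith)]; ring

/-- The sum of the point masses `κ s` at `s ∈ S`. -/
def diracSum (S : Finset ℝ) (κ : ℝ → ℝ) : SignedMeasure ℝ :=
  ∑ s ∈ S, VectorMeasure.dirac s (κ s)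

open scoped Classical in
lemma diracSum_apply (S : Finset ℝ) (κ : ℝ → ℝ) {A : Set ℝ} (hA : MeasurableSet A) :
    diracSum S κ A = ∑ s ∈ S, if s ∈ A then κ s else 0 := by
  unfold diracSum
  rw [FunLike.coe_sum, Finset.sum_apply]
  refine Finset.sum_congr rfl fun s _ => ?_
  split_ifs with h
  · exact VectorMeasure.dirac_apply_of_mem hA h
  · exact VectorMeasure.dirac_apply_of_notMem h

lemma integral_diracSum {a b : ℝ} {φ : ℝ → ℝ} (hφ : IsTestFunction a b φ) (S : Finset ℝ)
    (κ : ℝ → ℝ) : ∫ᵛ x, φ x ∂<•(diracSum S κ) = ∑ s ∈ S, κ s * φ s := by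
  unfold diracSum
  rw [VectorMeasure.integral_finsetSum_vectorMeasure fun s _ => hφ.integrable_signedMeasure _]
  refine Finset.sum_congr rfl fun s _ => ?_
  rw [VectorMeasure.integral_dirac]
  simp

lemma integral_stepSum_mul_deriv {a b : ℝ} {φ : ℝ → ℝ} (hφ : IsTestFunction a b φ) {S : Finset ℝ}
    (κ : ℝ → ℝ) (hS : (S : Set ℝ) ⊆ Ioo a b) :
    ∫ x in Ioo a b, stepSum S κ x * deriv φ x = -∑ s ∈ S, κ s * φ s := by
  unfold stepSum
  simp_rw [Finset.sum_mul]
  have hi : ∀ s, (fun x => (if s < x then κ s else 0) * deriv φ x)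
      = (Ioi s).indicator fun x => κ s * deriv φ x := by
    intro s; ext x
    by_cases h : s < x
    · rw [indicator_of_mem (by exact h), if_pos h]
    · rw [indicator_of_notMem (by exact h), if_neg h, zero_mul]
  rw [integral_finsetSum, ← Finset.sum_neg_distrib]
  · refine Finset.sum_congr rfl fun s hs => ?_
    have hsm := hS hs
    rw [hi, setIntegral_indicator measurableSet_Ioi, integral_const_mul]
    have h1 : Ioo a b ∩ Ioi s = Ioo s b := by
      ext x
      simp only [mem_inter_iff, mem_Ioo, mem_Ioi]
      exact ⟨fun h => ⟨h.2, h.1.2⟩, fun h => ⟨⟨hsm.1.trans h.1, h.2⟩, h.1⟩⟩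
    have h2 := hφ.isPrimitive.sub_eq s b
    rw [hφ.eq_zero (x := b) (by simp), intervalIntegral.integral_of_le hsm.2.le,
      integral_Ioc_eq_integral_Ioo] at h2
    rw [h1, ← h2]; ring
  · intro s _
    rw [hi]
    exact ((hφ.deriv.integrable.const_mul _).indicator measurableSet_Ioi).integrableOn

namespace PiecewiseRep

variable {a b : ℝ} {u G g : ℝ → ℝ} {S : Finset ℝ} {κ : ℝ → ℝ}

lemma integral_mul_deriv (h : PiecewiseRep a b u G g S κ) {φ : ℝ → ℝ}
    (hφ : IsTestFunction a b φ) :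
    ∫ x in Ioo a b, u x * deriv φ x = -((∫ x in Ioo a b, g x * φ x) + ∑ s ∈ S, κ s * φ s) := by
  have h1 : ∫ x in Ioo a b, u x * deriv φ x
      = ∫ x in Ioo a b, (G x * deriv φ x + stepSum S κ x * deriv φ x) :=
    integral_congr_ae (h.ae_eq.mono fun x hx => by simp only [hx]; ring)
  rw [h1, integral_add
    (hφ.deriv.integrable_mul
      (h.isPrimitive.continuous.locallyIntegrable.locallyIntegrableOn _)).integrableOn
    (hφ.deriv.integrable_mul ((locallyIntegrable_stepSum S κ).locallyIntegrableOn _)).integrableOn,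
    h.isPrimitive.integral_mul_deriv hφ, integral_stepSum_mul_deriv hφ κ h.subset]
  ring

lemma integrableOn (h : PiecewiseRep a b u G g S κ) : IntegrableOn u (Ioo a b) := by
  have h1 := (h.locallyIntegrable.integrableOn_isCompact isCompact_Icc).mono_set
    (Ioo_subset_Icc_self (a := a) (b := b))
  exact h1.congr h.ae_eq.symm

/-- The derivative is a sum of atoms plus a density, and uniqueness of the Lebesgue decomposition
identifies its singular part with the atoms. Off the discontinuity set every atom has mass `0`. -/
lemma memSBV2 (h : PiecewiseRep a b u G g S κ) (hg : MemLp g 2 (volume.restrict (Ioo a b))) :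
    MemSBV2 a b u := by
  have hgi : Integrable ((Ioo a b).indicator g) :=
    (integrable_indicator_iff measurableSet_Ioo).2 (integrableOn_Ioo_of_memLp hg)
  refine ⟨⟨h.integrableOn, diracSum S κ + volume.withDensityᵥ ((Ioo a b).indicator g), ?_, ?_⟩,
    (memLp_congr_ae h.approxDeriv_ae_eq).2 hg, ?_⟩
  · intro φ hφ
    rw [h.integral_mul_deriv hφ, VectorMeasure.integral_add_vectorMeasure
      (hφ.integrable_signedMeasure _) (hφ.integrable_signedMeasure _), integral_diracSum hφ,
      integral_withDensityᵥ hgi hφ]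
    have : ∫ x, (Ioo a b).indicator g x * φ x = ∫ x in Ioo a b, g x * φ x := by
      rw [← integral_indicator measurableSet_Ioo]
      congr 1 with x
      rw [indicator_mul_left]
    rw [this]; ring
  · intro A hA hAs
    rw [← SignedMeasure.eq_singularPart (diracSum S κ) ((Ioo a b).indicator g) ?_ rfl]
    · classical
      rw [diracSum_apply _ _ hA]
      refine Finset.sum_eq_zero fun s hs => ?_
      split_ifs with hsA
      · have := (hAs hsA).2
        rw [h.approxDiscontSet_eq] at this
        by_contra h0
        exact this ⟨hs, h0⟩
      · rfl
    · classical
      refine VectorMeasure.MutuallySingular.mk (S : Set ℝ)ᶜ S.finite_toSet.measurableSet.compl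
        (fun t ht htm => ?_) (fun t ht htm => ?_)
      · rw [diracSum_apply _ _ htm]
        exact Finset.sum_eq_zero fun s hs => if_neg fun hst => ht hst hs
      · rw [Measure.toENNRealVectorMeasure_apply_measurable htm]
        rw [compl_compl] at ht
        exact (S.finite_toSet.subset ht).measure_zero volume
  · rw [h.approxDiscontSet_eq]
    exact S.finite_toSet.subset fun s hs => hs.1

end PiecewiseRep

/-- Every `u ∈ SBV²(a,b)` is a primitive of an `L²` function plus a step function. -/
lemma MemSBV2.exists_piecewiseRep {a b : ℝ} (hab : a < b) {u : ℝ → ℝ} (h : MemSBV2 a b u) :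
    ∃ G g S κ, PiecewiseRep a b u G g S κ ∧ MemLp g 2 (volume.restrict (Ioo a b)) ∧
      (S : Set ℝ) = approxDiscontSet a b u := by
  obtain ⟨⟨hu, μ, hμ, hsing⟩, hL2, hfin⟩ := h
  set σ := μ.singularPart volume with hσ
  set f := μ.rnDeriv volume with hf
  have hfi : Integrable f := SignedMeasure.integrable_rnDeriv _ _
  have hdec : σ + volume.withDensityᵥ f = μ :=
    SignedMeasure.singularPart_add_withDensity_rnDeriv_eq volume μ
  set S := hfin.toFinset with hS
  have hSD : (S : Set ℝ) = approxDiscontSet a b u := hfin.coe_toFinset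
  have hSab : (S : Set ℝ) ⊆ Ioo a b := by rw [hSD]; exact fun x hx => hx.1
  set κ : ℝ → ℝ := fun s => σ {s} with hκ
  -- The singular part vanishes off the discontinuity set; as that set is finite, only atoms remain
  -- in `(a,b)`.
  have hres : σ.restrict (Ioo a b) = diracSum S κ := by
    classical
    ext A hA
    rw [VectorMeasure.restrict_apply _ measurableSet_Ioo hA, diracSum_apply _ _ hA]
    have hSm : MeasurableSet (S : Set ℝ) := S.finite_toSet.measurableSet
    have e : A ∩ Ioo a b = (A ∩ Ioo a b) \ S ∪ ((S.filter (· ∈ A) : Finset ℝ) : Set ℝ) := by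
      ext x
      simp only [Finset.coe_filter, mem_union, Set.mem_sdiff, mem_inter_iff, mem_ofPred_eq]
      constructor
      · intro hx
        by_cases hxS : x ∈ S
        · exact Or.inr ⟨hxS, hx.1⟩
        · exact Or.inl ⟨hx, hxS⟩
      · rintro (hx | hx)
        · exact hx.1
        · exact ⟨hx.2, hSab hx.1⟩
    have hfs : ∀ T : Finset ℝ, σ (T : Set ℝ) = ∑ s ∈ T, σ {s} := by
      intro T
      induction T using Finset.induction_on with
      | empty => simp
      | insert s T hs ih =>
        rw [Finset.sum_insert hs, Finset.coe_insert, insert_eq, VectorMeasure.of_union (by simpa)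
          (measurableSet_singleton s) T.finite_toSet.measurableSet, ih]
    rw [e, VectorMeasure.of_union ?_ ((hA.inter measurableSet_Ioo).diff hSm)
      (Finset.finite_toSet _).measurableSet,
      hsing _ ((hA.inter measurableSet_Ioo).diff hSm) ?_, zero_add, hfs, Finset.sum_filter]
    · rw [hSD]
      exact fun x hx => ⟨hx.1.2, hx.2⟩
    · rw [Set.disjoint_left]
      intro x hx hx'
      exact hx.2 (Finset.mem_filter.1 hx').1
  set F : ℝ → ℝ := fun x => 0 + ∫ t in a..x, f t with hF
  have hFp : IsPrimitive F f := IsPrimitive.of_integral hfi.locallyIntegrable 0 a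
  have hrep0 : PiecewiseRep a b (fun x => F x + stepSum S κ x) F f S κ :=
    ⟨hFp, hSab, EventuallyEq.rfl⟩
  have hul : LocallyIntegrableOn u (Ioo a b) := hu.locallyIntegrableOn
  have hrl := hrep0.locallyIntegrable.locallyIntegrableOn (Ioo a b)
  obtain ⟨c, hc⟩ := exists_ae_eq_const hab (hul.sub hrl) (fun φ hφ => by
    have h1 := hμ φ hφ
    have h2 := hrep0.integral_mul_deriv hφ
    rw [← hdec, VectorMeasure.integral_add_vectorMeasure
      (hφ.integrable_signedMeasure _) (hφ.integrable_signedMeasure _),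
      integral_withDensityᵥ hfi hφ, ← VectorMeasure.setIntegral_eq_integral_of_forall_compl_eq_zero
        measurableSet_Ioo (fun x hx => hφ.eq_zero hx), hres, integral_diracSum hφ] at h1
    rw [hφ.setIntegral_mul f] at h2
    simp only [Pi.sub_apply, sub_mul]
    rw [integral_sub (hφ.deriv.integrable_mul hul).integrableOn
      (hφ.deriv.integrable_mul hrl).integrableOn, h1, h2]
    ring)
  have hrep : PiecewiseRep a b u (fun x => c + F x) f S κ := by
    refine ⟨by simpa using (IsPrimitive.const c).add hFp, hSab, ?_⟩
    filter_upwards [hc] with x hx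
    simp only [Pi.sub_apply] at hx
    linarith
  -- Square integrability of `f` comes from its agreement with `approxDeriv u`.
  exact ⟨_, f, S, κ, hrep, (memLp_congr_ae hrep.approxDeriv_ae_eq).1 hL2, hSD⟩

/-! ### The cost of a transition -/

/-- The density of the penalization term, in terms of `w = 1 - v`. -/
def penaltyDensity (ε : ℝ) (w w'' : ℝ → ℝ) (t : ℝ) : ℝ := w t ^ 2 / ε + ε ^ 3 * w'' t ^ 2

lemma penaltyDensity_nonneg {ε : ℝ} (hε : 0 < ε) (w w'' : ℝ → ℝ) (t : ℝ) :
    0 ≤ penaltyDensity ε w w'' t := by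
  unfold penaltyDensity; positivity

lemma locallyIntegrable_penaltyDensity {ε : ℝ} {w w' w'' : ℝ → ℝ}
    (h : IsPrimitive w w') (h2 : MemLp w'' 2) :
    LocallyIntegrable (penaltyDensity ε w w'') := by
  have h3 : LocallyIntegrable (fun t => w t ^ 2 / ε) :=
    ((h.continuous.pow 2).div_const ε).locallyIntegrable
  exact h3.add ((h2.integrable_sq.const_mul (ε ^ 3)).locallyIntegrable)

/-- The pointwise inequality behind the calibration argument. -/
lemma calibration_pointwise {ε ℓ m x p q r : ℝ} (hε : 0 < ε) (hε1 : ε ≤ 1) (hℓ : 0 < ℓ)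
    (hm : 0 ≤ m) (hx0 : 0 ≤ x) (hx1 : x ≤ 1) :
    0 ≤ -(m * x ^ 2 * (1 - x) ^ 2) * (√2 * (p ^ 2 + q ^ 2) + 2 * p * q)
      + (1 - 10 * x ^ 3 + 15 * x ^ 4 - 6 * x ^ 5) *
        ((2 * √2 * p * q + 2 * √2 * q * r + 2 * q ^ 2 + 2 * p * r) / ε)
      + 6 * (ε * (m * (2 * x * (1 - x) * (1 - 2 * x)) / ℓ) * p * q
        + m * x ^ 2 * (1 - x) ^ 2 * (q ^ 2 + p * r))
      + (1 + (6 * m + 12 * m / ℓ ^ 2) * ε) * ((p ^ 2 + r ^ 2) / ε) := by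
  have hs : √2 * √2 = 2 := Real.mul_self_sqrt (by norm_num)
  have hs0 : 0 ≤ √2 := Real.sqrt_nonneg 2
  have hs2 : √2 ≤ 2 := by nlinarith
  set ρ := m * x ^ 2 * (1 - x) ^ 2 with hρ
  set ψ := 1 - 10 * x ^ 3 + 15 * x ^ 4 - 6 * x ^ 5 with hψ
  have hρ0 : 0 ≤ ρ := by positivity
  have hx2 : (x * (1 - x)) ^ 2 ≤ 1 := by
    have h1 : 0 ≤ x * (1 - x) := mul_nonneg hx0 (by linarith)
    have h2 : x * (1 - x) ≤ 1 := by nlinarith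
    nlinarith
  have hρm : ρ ≤ m := by
    have : ρ = m * (x * (1 - x)) ^ 2 := by rw [hρ]; ring
    rw [this]; nlinarith
  have hψ0 : 0 ≤ ψ := by
    have : ψ = (1 - x) ^ 3 * (1 + 3 * x + 6 * x ^ 2) := by rw [hψ]; ring
    rw [this]
    have : 0 ≤ 1 - x := by linarith
    positivity
  have hψ1 : 0 ≤ 1 - ψ := by
    have h1 : 1 - ψ = x ^ 3 * (10 - 15 * x + 6 * x ^ 2) := by rw [hψ]; ring
    rw [h1]
    have : 0 ≤ 10 - 15 * x + 6 * x ^ 2 := by nlinarith [sq_nonneg (x - 5 / 4)]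
    positivity
  -- This square vanishes exactly along solutions of `w + √2 ε w' + ε² w'' = 0`, the optimal
  -- transitions.
  have t1 : 0 ≤ ψ * ((p + √2 * q + r) ^ 2 / ε) := by positivity
  have t2 : 0 ≤ (1 - ψ) * ((p ^ 2 + r ^ 2) / ε) := by positivity
  have t3 : 0 ≤ ρ * ((3 - √2) * (p ^ 2 + q ^ 2) - 2 * p * q) := by
    apply mul_nonneg hρ0
    have h1 := mul_nonneg (sub_nonneg.2 hs2) (add_nonneg (sq_nonneg p) (sq_nonneg q))
    have h2 := sq_nonneg (p - q)
    linarith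
  have t4 : 0 ≤ 3 * ρ * (p + r) ^ 2 := by positivity
  have t5 : 0 ≤ 3 * m * (x * (1 - x) * q + 2 * ε * (1 - 2 * x) / ℓ * p) ^ 2 := by positivity
  have t6 : 0 ≤ 6 * (m - ρ) * (p ^ 2 + r ^ 2) := by
    have : 0 ≤ m - ρ := by linarith
    positivity
  have t7 : 0 ≤ 12 * m / ℓ ^ 2 * ((p ^ 2 + r ^ 2) - ε ^ 2 * (1 - 2 * x) ^ 2 * p ^ 2) := by
    apply mul_nonneg (by positivity)
    have h1 : (ε * (1 - 2 * x)) ^ 2 ≤ 1 := by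
      have h2 : (1 - 2 * x) ^ 2 ≤ 1 := by nlinarith
      have h3 : ε ^ 2 ≤ 1 := by nlinarith
      rw [mul_pow]
      exact mul_le_one₀ h3 (sq_nonneg _) h2
    have h2 := mul_le_mul_of_nonneg_right h1 (sq_nonneg p)
    have h3 := sq_nonneg r
    rw [mul_pow] at h2
    linarith
  have hs' : √2 ^ 2 = 2 := by rw [sq, hs]
  -- The penalization does not control `q²` pointwise; the term `6 ρ q²`, supplied by a null
  -- corrector, does. Half of it absorbs the `q` terms of `ρ (√2 (p² + q²) + 2pq)`. The other half
  -- completes a square with the cross term in `pq`, which is possible because the double zeros of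
  -- `ρ` keep `ρ'² / ρ` bounded. What is left is of order `p² + r²`, hence of relative size `ε`.
  have key : -ρ * (√2 * (p ^ 2 + q ^ 2) + 2 * p * q)
      + ψ * ((2 * √2 * p * q + 2 * √2 * q * r + 2 * q ^ 2 + 2 * p * r) / ε)
      + 6 * (ε * (m * (2 * x * (1 - x) * (1 - 2 * x)) / ℓ) * p * q + ρ * (q ^ 2 + p * r))
      + (1 + (6 * m + 12 * m / ℓ ^ 2) * ε) * ((p ^ 2 + r ^ 2) / ε)
      = ψ * ((p + √2 * q + r) ^ 2 / ε) + (1 - ψ) * ((p ^ 2 + r ^ 2) / ε)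
        + ρ * ((3 - √2) * (p ^ 2 + q ^ 2) - 2 * p * q)
        + 3 * ρ * (p + r) ^ 2
        + 3 * m * (x * (1 - x) * q + 2 * ε * (1 - 2 * x) / ℓ * p) ^ 2
        + 6 * (m - ρ) * (p ^ 2 + r ^ 2)
        + 12 * m / ℓ ^ 2 * ((p ^ 2 + r ^ 2) - ε ^ 2 * (1 - 2 * x) ^ 2 * p ^ 2)
        + 3 * ρ * r ^ 2 := by
    have e1 : (p + √2 * q + r) ^ 2
        = p ^ 2 + 2 * q ^ 2 + r ^ 2 + 2 * √2 * p * q + 2 * √2 * q * r + 2 * p * r := by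
      linear_combination q ^ 2 * hs'
    rw [e1]
    have e2 : 3 * m * (x * (1 - x) * q + 2 * ε * (1 - 2 * x) / ℓ * p) ^ 2
        = 3 * ρ * q ^ 2 + 6 * (ε * (m * (2 * x * (1 - x) * (1 - 2 * x)) / ℓ) * p * q)
          + 12 * m / ℓ ^ 2 * (ε ^ 2 * (1 - 2 * x) ^ 2 * p ^ 2) := by
      rw [hρ]; field_simp; ring
    rw [e2]
    field_simp
    ring
  rw [key]
  have t8 : 0 ≤ 3 * ρ * r ^ 2 := by positivity
  linarith

/-- One-sided transition cost. -/
lemma transition_cost_right {ε ℓ y : ℝ} (hε : 0 < ε) (hε1 : ε ≤ 1) (hℓ : 0 < ℓ)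
    {w w' w'' : ℝ → ℝ} (h : IsPrimitive w w') (h' : IsPrimitive w' w'') (h2 : MemLp w'' 2) :
    √2 * (w y ^ 2 + (ε * w' y) ^ 2) + 2 * w y * (ε * w' y) ≤
      (1 + (6 * (30 / ℓ) + 12 * (30 / ℓ) / ℓ ^ 2) * ε) *
        ∫ t in y..(y + ℓ), penaltyDensity ε w w'' t := by
  set m := 30 / ℓ with hm
  -- Since `∫₀¹ x² (1 - x)² = 1 / 30`, the slope `-m X² (1 - X)²` brings the quintic cutoff from `1`
  -- to `0` over the length `ℓ`.
  have hm0 : 0 < m := by positivity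
  set X : ℝ → ℝ := fun t => (t - y) / ℓ with hX
  have hXd : ∀ t, HasDerivAt X (1 / ℓ) t := fun t =>
    ((hasDerivAt_id t).sub_const y).div_const ℓ
  have hψ : IsPrimitive (fun t => 1 - 10 * X t ^ 3 + 15 * X t ^ 4 - 6 * X t ^ 5)
      (fun t => -(m * X t ^ 2 * (1 - X t) ^ 2)) := by
    refine IsPrimitive.of_hasDerivAt (fun t => ?_) (by fun_prop)
    have := (((((hXd t).pow 3).const_mul 10).const_sub 1).add (((hXd t).pow 4).const_mul 15)).sub
      (((hXd t).pow 5).const_mul 6)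
    convert! this using 1
    rw [hm]; field_simp; ring
  have hρ : IsPrimitive (fun t => m * X t ^ 2 * (1 - X t) ^ 2)
      (fun t => m * (2 * X t * (1 - X t) * (1 - 2 * X t)) / ℓ) := by
    refine IsPrimitive.of_hasDerivAt (fun t => ?_) (by fun_prop)
    have := (((hXd t).pow 2).const_mul m).mul (((hXd t).const_sub 1).pow 2)
    convert! this using 1
    simp only [Pi.pow_apply]
    field_simp; ring
  have hq : IsPrimitive (fun t => ε * w' t) (fun t => ε * w'' t) := h'.const_mul ε
  have hQ := (((h.mul h).add (hq.mul hq)).const_mul √2).add ((h.mul hq).const_mul 2)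
  -- The cutoff makes the quadratic form count fully at `y` and not at all at `y + ℓ`; the corrector
  -- `6 ε² ρ w w'` vanishes at both ends, as `ρ` does.
  have hP := (hψ.mul hQ).add ((hρ.mul (h.mul h')).const_mul (6 * ε ^ 2))
  have hE := locallyIntegrable_penaltyDensity (ε := ε) h h2
  set C := 6 * m + 12 * m / ℓ ^ 2 with hC
  have h1 := hP.sub_eq y (y + ℓ)
  have hy0 : X y = 0 := by simp [hX]
  have hy1 : X (y + ℓ) = 1 := by simp only [hX]; field_simp; ring
  simp only [hy0, hy1] at h1
  have h3 : ∫ t in y..(y + ℓ), -((1 + C * ε) * penaltyDensity ε w w'' t) ≤ _ :=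
    intervalIntegral.integral_mono_on (by linarith)
      (((intervalIntegrable_of_locallyIntegrable hE y (y + ℓ)).const_mul (1 + C * ε)).neg)
      (hP.intervalIntegrable y (y + ℓ)) (fun t ht => by
        have hx0 : 0 ≤ X t := div_nonneg (by linarith [ht.1]) hℓ.le
        have hx1 : X t ≤ 1 := by
          simp only [hX]; rw [div_le_one hℓ]; linarith [ht.2]
        have := calibration_pointwise (p := w t) (q := ε * w' t) (r := ε ^ 2 * w'' t)
          hε hε1 hℓ hm0.le hx0 hx1
        rw [← hC] at this
        unfold penaltyDensity
        rw [← sub_nonneg]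
        convert this using 1
        field_simp
        ring)
  rw [← h1, intervalIntegral.integral_neg, intervalIntegral.integral_const_mul] at h3
  norm_num at h3
  nlinarith [h3]

/-- Two-sided transition cost: if `w` takes the value `w y`, the penalization in a neighborhood of
`y` is at least `2√2 (w y)²`, up to a small error. -/
lemma transition_cost {ε ℓ y : ℝ} (hε : 0 < ε) (hε1 : ε ≤ 1) (hℓ : 0 < ℓ)
    {w w' w'' : ℝ → ℝ} (h : IsPrimitive w w') (h' : IsPrimitive w' w'') (h2 : MemLp w'' 2) :
    2 * √2 * w y ^ 2 ≤ (1 + (6 * (30 / ℓ) + 12 * (30 / ℓ) / ℓ ^ 2) * ε) *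
        ∫ t in (y - ℓ)..(y + ℓ), penaltyDensity ε w w'' t := by
  have hr := transition_cost_right (y := y) hε hε1 hℓ h h' h2
  have hn' : IsPrimitive (fun x => -w' (-x)) (fun x => w'' (-x)) := by
    simpa using h'.comp_neg.const_mul (-1)
  have hl := transition_cost_right (y := -y) hε hε1 hℓ h.comp_neg hn'
    (h2.comp_measurePreserving (Measure.measurePreserving_neg volume))
  have hi : ∫ t in (-y)..(-y + ℓ), penaltyDensity ε (fun x => w (-x)) (fun x => w'' (-x)) t
      = ∫ t in (y - ℓ)..y, penaltyDensity ε w w'' t := by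
    have := intervalIntegral.integral_comp_neg (a := -y) (b := -y + ℓ) (penaltyDensity ε w w'')
    rw [neg_neg, neg_add, neg_neg, ← sub_eq_add_neg] at this
    rw [← this]
    rfl
  have hE := locallyIntegrable_penaltyDensity (ε := ε) h h2
  rw [hi, neg_neg] at hl
  rw [← intervalIntegral.integral_add_adjacent_intervals
    (intervalIntegrable_of_locallyIntegrable hE (y - ℓ) y)
    (intervalIntegrable_of_locallyIntegrable hE y (y + ℓ)), mul_add]
  -- In the sum of the two one-sided bounds the cross terms cancel, and the square of the slope is
  -- dropped.
  have h0 : 0 ≤ √2 * (ε * w' y) ^ 2 := by positivity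
  nlinarith

/-! ### Hilbert space tools -/

lemma inner_toLp {μ : Measure ℝ} {f g : ℝ → ℝ} (hf : MemLp f 2 μ) (hg : MemLp g 2 μ) :
    inner ℝ (hf.toLp f) (hg.toLp g) = ∫ x, f x * g x ∂μ := by
  rw [L2.inner_def]
  apply integral_congr_ae
  filter_upwards [hf.coeFn_toLp, hg.coeFn_toLp] with x h1 h2
  rw [h1, h2]
  simp [mul_comm]

lemma norm_toLp_two {μ : Measure ℝ} {f : ℝ → ℝ} (hf : MemLp f 2 μ) :
    ‖hf.toLp f‖ = √(∫ x, f x ^ 2 ∂μ) := by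
  rw [norm_eq_sqrt_real_inner, inner_toLp]
  simp only [sq]

lemma abs_integral_mul_le {μ : Measure ℝ} {f g : ℝ → ℝ} (hf : MemLp f 2 μ) (hg : MemLp g 2 μ) :
    |∫ x, f x * g x ∂μ| ≤ √(∫ x, f x ^ 2 ∂μ) * √(∫ x, g x ^ 2 ∂μ) := by
  rw [← inner_toLp hf hg, ← norm_toLp_two hf, ← norm_toLp_two hg]
  exact abs_real_inner_le_norm _ _

/-- A linear form bounded by a Hilbert seminorm is represented by a vector. -/
lemma exists_inner_eq_of_abs_le {V H : Type*} [AddCommGroup V] [Module ℝ V]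
    [NormedAddCommGroup H] [InnerProductSpace ℝ H] [CompleteSpace H]
    (T : V →ₗ[ℝ] H) (l : V →ₗ[ℝ] ℝ) {C : ℝ} (hC : 0 ≤ C) (h : ∀ x, |l x| ≤ C * ‖T x‖) :
    ∃ g : H, ‖g‖ ≤ C ∧ ∀ x, l x = inner ℝ g (T x) := by
  -- The bound makes `l` factor through the range of `T`; Hahn-Banach extends it to `H`, and Riesz
  -- turns it into a vector.
  have hker : LinearMap.ker T ≤ LinearMap.ker l := fun x hx => by
    have h1 := h x
    rw [LinearMap.mem_ker.1 hx, norm_zero, mul_zero] at h1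
    exact LinearMap.mem_ker.2 (abs_eq_zero.1 (le_antisymm h1 (abs_nonneg _)))
  set l' : LinearMap.range T →ₗ[ℝ] ℝ :=
    ((LinearMap.ker T).liftQ l hker).comp T.quotKerEquivRange.symm.toLinearMap with hl'
  have hl'T : ∀ x, l' ⟨T x, LinearMap.mem_range_self T x⟩ = l x := fun x => by
    have h1 : T.quotKerEquivRange.symm ⟨T x, LinearMap.mem_range_self T x⟩
        = (LinearMap.ker T).mkQ x := by
      rw [LinearEquiv.symm_apply_eq]
      rfl
    simp [hl', h1]
  have hb : ∀ y : LinearMap.range T, ‖l' y‖ ≤ C * ‖y‖ := by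
    rintro ⟨_, x, rfl⟩
    rw [hl'T]
    exact h x
  obtain ⟨f, hf, hfn⟩ := exists_extension_norm_eq (LinearMap.range T) (l'.mkContinuous C hb)
  refine ⟨(InnerProductSpace.toDual ℝ H).symm f, ?_, fun x => ?_⟩
  · rw [LinearIsometryEquiv.norm_map, hfn]
    exact LinearMap.mkContinuous_norm_le _ hC _
  · rw [InnerProductSpace.toDual_symm_apply, ← hl'T x]
    exact (hf ⟨T x, LinearMap.mem_range_self T x⟩).symm

lemma IsTestFunction.memLp {a b : ℝ} {φ : ℝ → ℝ} (h : IsTestFunction a b φ)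
    (p : ℝ≥0∞) : MemLp φ p (volume.restrict (Ioo a b)) :=
  (h.continuous.memLp_of_hasCompactSupport h.hasCompactSupport).restrict _

/-- The test functions on `(a,b)` supported away from `S`. -/
def testSubmodule (a b : ℝ) (S : Set ℝ) : Submodule ℝ (ℝ → ℝ) where
  carrier := {φ | IsTestFunction a b φ ∧ Disjoint (tsupport φ) S}
  add_mem' := fun {φ ψ} h h' => ⟨h.1.add h'.1, (h.2.union_left h'.2).mono_left (tsupport_add φ ψ)⟩
  zero_mem' := ⟨⟨contDiff_const, HasCompactSupport.zero, by simp [tsupport]⟩, by simp [tsupport]⟩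
  smul_mem' := fun c φ h => ⟨h.1.const_mul c, h.2.mono_left tsupport_mul_subset_right⟩

/-- If `φ ↦ ∫ u φ'` is `L²`-bounded on the test functions supported away from `S`, it is represented
by an `L²` function. -/
lemma exists_memLp_of_abs_integral_le {a b : ℝ} {S : Set ℝ} {u : ℝ → ℝ} {C : ℝ}
    (hu : LocallyIntegrableOn u (Ioo a b)) (hC : 0 ≤ C)
    (h : ∀ φ, IsTestFunction a b φ → Disjoint (tsupport φ) S →
      |∫ x in Ioo a b, u x * deriv φ x| ≤ C * √(∫ x in Ioo a b, φ x ^ 2)) :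
    ∃ g, MemLp g 2 (volume.restrict (Ioo a b)) ∧ √(∫ x in Ioo a b, g x ^ 2) ≤ C ∧
      ∀ φ, IsTestFunction a b φ → Disjoint (tsupport φ) S →
        ∫ x in Ioo a b, u x * deriv φ x = -∫ x in Ioo a b, g x * φ x := by
  let T : testSubmodule a b S →ₗ[ℝ] Lp ℝ 2 (volume.restrict (Ioo a b)) :=
    { toFun := fun φ => (φ.2.1.memLp 2).toLp φ
      map_add' := fun φ ψ => MemLp.toLp_add (φ.2.1.memLp 2) (ψ.2.1.memLp 2)
      map_smul' := fun c φ => MemLp.toLp_const_smul c (φ.2.1.memLp 2) }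
  let l : testSubmodule a b S →ₗ[ℝ] ℝ :=
    { toFun := fun φ => ∫ x in Ioo a b, u x * deriv φ x
      map_add' := fun φ ψ => by
        rw [← integral_add (φ.2.1.deriv.integrable_mul hu).integrableOn
          (ψ.2.1.deriv.integrable_mul hu).integrableOn]
        congr 1 with x
        rw [Submodule.coe_add, deriv_add
          (φ.2.1.contDiff.differentiable (by simp) x) (ψ.2.1.contDiff.differentiable (by simp) x)]
        ring
      map_smul' := fun c φ => by
        rw [RingHom.id_apply, smul_eq_mul, ← integral_const_mul]
        congr 1 with x
        rw [Submodule.coe_smul, deriv_const_smul _ (φ.2.1.contDiff.differentiable (by simp) x)]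
        simp only [smul_eq_mul]
        ring }
  obtain ⟨g, hg, hgl⟩ := exists_inner_eq_of_abs_le T l hC (fun φ => by
    have := h φ φ.2.1 φ.2.2
    rw [← norm_toLp_two (φ.2.1.memLp 2)] at this
    exact this)
  have hgm : MemLp g 2 (volume.restrict (Ioo a b)) := Lp.memLp g
  -- The Riesz vector pairs to `∫ u φ'`, so the weak derivative is its negative.
  refine ⟨fun x => -g x, hgm.neg, ?_, fun φ hφ hS => ?_⟩
  · simp only [neg_sq]
    rw [← norm_toLp_two hgm, Lp.toLp_coeFn]
    exact hg
  · have h1 := hgl ⟨φ, hφ, hS⟩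
    have h2 : inner ℝ g (T ⟨φ, hφ, hS⟩) = ∫ x in Ioo a b, g x * φ x := by
      rw [← inner_toLp hgm (hφ.memLp 2), Lp.toLp_coeFn]
      rfl
    rw [h2] at h1
    simp only [neg_mul, integral_neg, neg_neg]
    exact h1

/-- The windows `(x - δ, x + δ)` are then disjoint and inside `(a,b)`, so local costs add up and
rescaled profiles do not overlap. -/
lemma eventually_separated {a b : ℝ} {T : Finset ℝ} (hT : (T : Set ℝ) ⊆ Ioo a b) :
    ∀ᶠ δ in 𝓝[>] (0 : ℝ), (∀ x ∈ T, a ≤ x - δ ∧ x + δ ≤ b) ∧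
      ∀ x ∈ T, ∀ y ∈ T, x ≠ y → 2 * δ ≤ |x - y| := by
  have key : ∀ c : ℝ, 0 < c → ∀ᶠ δ in 𝓝[>] (0 : ℝ), δ ≤ c := fun c hc => by
    filter_upwards [Ioo_mem_nhdsGT hc] with δ hδ using hδ.2.le
  refine Eventually.and ?_ ?_
  · refine (eventually_all_finset _).2 fun x hx => ?_
    have := hT hx
    filter_upwards [key (x - a) (by linarith [this.1]), key (b - x) (by linarith [this.2])]
      with δ h1 h2
    exact ⟨by linarith, by linarith⟩
  · refine (eventually_all_finset _).2 fun x hx => (eventually_all_finset _).2 fun y hy => ?_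
    by_cases hxy : x = y
    · simp [hxy]
    · filter_upwards [key (|x - y| / 2) (by have := abs_pos.2 (sub_ne_zero.2 hxy); linarith)]
        with δ h1 _
      linarith

/-! ### Compactness and lower bound along an ultrafilter -/

lemma memLp_mul_of_continuous {a b : ℝ} {F g : ℝ → ℝ} (hF : Continuous F)
    (hg : MemLp g 2 (volume.restrict (Ioo a b))) :
    MemLp (fun x => F x * g x) 2 (volume.restrict (Ioo a b)) := by
  obtain ⟨C, hC⟩ := isCompact_Icc.exists_bound_of_continuousOn (hF.continuousOn (s := Icc a b))
  refine hg.of_le_mul (c := C) (hF.aestronglyMeasurable.mul hg.1) ?_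
  rw [ae_restrict_iff' measurableSet_Ioo]
  refine ae_of_all _ fun x hx => ?_
  rw [norm_mul]
  exact mul_le_mul_of_nonneg_right (hC x (Ioo_subset_Icc_self hx)) (norm_nonneg _)

lemma integrable_sq_of_memLp {μ : Measure ℝ} {g : ℝ → ℝ} (hg : MemLp g 2 μ) :
    Integrable (fun x => g x ^ 2) μ := hg.integrable_sq

/-- A sequence of pairs `(u j, V j)`, with `V j` of class `C¹`, whose Dirichlet part is bounded by
`A` and whose penalization part is bounded by `B` along the ultrafilter `𝒰`, and such that
`u j → u₀` in `L¹`. -/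
structure EnergyBound (a b A B : ℝ) (𝒰 : Ultrafilter ℕ) (ε : ℕ → ℝ)
    (u du V V' V'' : ℕ → ℝ → ℝ) (u₀ : ℝ → ℝ) : Prop where
  lt : a < b
  ε_pos : ∀ j, 0 < ε j
  ε_tendsto : Tendsto ε 𝒰 (𝓝 0)
  hasWeakDeriv : ∀ j, HasWeakDeriv a b (u j) (du j)
  memLp_du : ∀ j, MemLp (du j) 2 (volume.restrict (Ioo a b))
  isPrimitive : ∀ j, IsPrimitive (V j) (V' j)
  isPrimitive' : ∀ j, IsPrimitive (V' j) (V'' j)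
  memLp : ∀ j, MemLp (V'' j) 2
  dirichlet_le : ∀ᶠ j in 𝒰, ∫ x in Ioo a b, (V j x * du j x) ^ 2 ≤ A
  penalty_le : ∀ᶠ j in 𝒰,
    ∫ x in Ioo a b, penaltyDensity (ε j) (fun x => 1 - V j x) (fun x => - V'' j x) x ≤ B
  integrable : ∀ j, IntegrableOn (u j) (Ioo a b)
  integrable_limit : IntegrableOn u₀ (Ioo a b)
  tendsto : Tendsto (fun j => ∫ x in Ioo a b, |u j x - u₀ x|) 𝒰 (𝓝 0)

/-- The points near which `V j` takes values below `θ`, eventually along `𝒰`. -/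
def lowSet (a b : ℝ) (𝒰 : Ultrafilter ℕ) (V : ℕ → ℝ → ℝ) (θ : ℝ) : Set ℝ :=
  {x | x ∈ Ioo a b ∧ ∀ η > 0, ∀ᶠ j in 𝒰, ∃ y, |y - x| < η ∧ V j y < θ}

/-- For an ultrafilter, failure of an eventual property is the eventual failure of it. This
dichotomy avoids extracting a further subsequence around each point. -/
lemma exists_eventually_le_of_notMem_lowSet {a b : ℝ} {𝒰 : Ultrafilter ℕ} {V : ℕ → ℝ → ℝ}
    {θ x : ℝ} (hx : x ∈ Ioo a b) (h : x ∉ lowSet a b 𝒰 V θ) :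
    ∃ η > 0, ∀ᶠ j in 𝒰, ∀ y, |y - x| < η → θ ≤ V j y := by
  simp only [lowSet, mem_ofPred_eq, not_and, not_forall] at h
  obtain ⟨η, hη, hn⟩ := h hx
  refine ⟨η, hη, ?_⟩
  rw [← Ultrafilter.eventually_not] at hn
  filter_upwards [hn] with j hj y hy
  by_contra hc
  exact hj ⟨y, hy, not_le.1 hc⟩

namespace EnergyBound

variable {a b A B : ℝ} {𝒰 : Ultrafilter ℕ} {ε : ℕ → ℝ} {u du V V' V'' : ℕ → ℝ → ℝ} {u₀ : ℝ → ℝ}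

lemma isPrimitive_one_sub (h : EnergyBound a b A B 𝒰 ε u du V V' V'' u₀) (j : ℕ) :
    IsPrimitive (fun x => 1 - V j x) (fun x => -V' j x) := by
  simpa using (IsPrimitive.const 1).sub (h.isPrimitive j)

lemma isPrimitive_neg (h : EnergyBound a b A B 𝒰 ε u du V V' V'' u₀) (j : ℕ) :
    IsPrimitive (fun x => -V' j x) (fun x => -V'' j x) := by
  simpa using (h.isPrimitive' j).const_mul (-1)

lemma locallyIntegrable_penalty (h : EnergyBound a b A B 𝒰 ε u du V V' V'' u₀) (j : ℕ) :
    LocallyIntegrable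
      (penaltyDensity (ε j) (fun x => 1 - V j x) (fun x => - V'' j x)) :=
  locallyIntegrable_penaltyDensity (h.isPrimitive_one_sub j) (h.memLp j).neg

lemma integrableOn_penalty (h : EnergyBound a b A B 𝒰 ε u du V V' V'' u₀) (j : ℕ) :
    IntegrableOn (penaltyDensity (ε j) (fun x => 1 - V j x) (fun x => - V'' j x)) (Ioo a b) :=
  ((h.locallyIntegrable_penalty j).integrableOn_isCompact isCompact_Icc).mono_set
    Ioo_subset_Icc_self

lemma dirichlet_bound_nonneg (h : EnergyBound a b A B 𝒰 ε u du V V' V'' u₀) : 0 ≤ A := by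
  obtain ⟨j, hj⟩ := h.dirichlet_le.exists
  exact (integral_nonneg fun x => sq_nonneg _).trans hj

lemma penalty_bound_nonneg (h : EnergyBound a b A B 𝒰 ε u du V V' V'' u₀) : 0 ≤ B := by
  obtain ⟨j, hj⟩ := h.penalty_le.exists
  exact (integral_nonneg fun x => penaltyDensity_nonneg (h.ε_pos j) _ _ x).trans hj

/-- Each point of the low set carries a fixed amount of penalization. -/
lemma card_mul_le (h : EnergyBound a b A B 𝒰 ε u du V V' V'' u₀) {θ : ℝ} (hθ : θ ≤ 1)
    {T : Finset ℝ} (hT : (T : Set ℝ) ⊆ lowSet a b 𝒰 V θ) :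
    T.card * (2 * √2 * (1 - θ) ^ 2) ≤ B := by
  obtain ⟨δ, hδs, hδ⟩ := ((eventually_separated fun x hx => (hT hx).1).and
    (self_mem_nhdsWithin (s := Ioi (0 : ℝ)))).exists
  have hδ0 : 0 < δ := hδ
  obtain ⟨hsub, hsep⟩ := hδs
  -- If `y` is within `ℓ` of `x`, the window of radius `ℓ` around `y` stays in the one of radius `δ`
  -- around `x`.
  set ℓ := δ / 2 with hℓ
  have hℓ0 : 0 < ℓ := by positivity
  set C := 6 * (30 / ℓ) + 12 * (30 / ℓ) / ℓ ^ 2 with hC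
  have hC0 : 0 ≤ C := by positivity
  have hlim : Tendsto (fun j => (1 + C * ε j) * B) 𝒰 (𝓝 ((1 + C * 0) * B)) :=
    ((h.ε_tendsto.const_mul C).const_add 1).mul_const B
  rw [mul_zero, add_zero, one_mul] at hlim
  refine ge_of_tendsto hlim ?_
  have hlow : ∀ᶠ j in 𝒰, ∀ x ∈ T, ∃ y, |y - x| < ℓ ∧ V j y < θ :=
    (eventually_all_finset _).2 fun x hx => (hT hx).2 ℓ hℓ0
  filter_upwards [hlow, h.penalty_le, h.ε_tendsto.eventually (Iio_mem_nhds one_pos)]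
    with j hj hB hε1
  set E := penaltyDensity (ε j) (fun x => 1 - V j x) (fun x => - V'' j x) with hE
  have hEi := h.integrableOn_penalty j
  have hεj := h.ε_pos j
  have hIoo : ∀ x ∈ T, Ioo (x - δ) (x + δ) ⊆ Ioo a b := fun x hx =>
    Ioo_subset_Ioo (hsub x hx).1 (hsub x hx).2
  have h1 : ∀ x ∈ T, 2 * √2 * (1 - θ) ^ 2 ≤ (1 + C * ε j) * ∫ t in Ioo (x - δ) (x + δ), E t := by
    intro x hx
    obtain ⟨y, hy, hyθ⟩ := hj x hx
    have h2 := transition_cost (y := y) hεj (le_of_lt hε1) hℓ0 (h.isPrimitive_one_sub j)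
      (h.isPrimitive_neg j) (h.memLp j).neg
    have h3 : (1 - θ) ^ 2 ≤ (1 - V j y) ^ 2 := by
      apply pow_le_pow_left₀ (by linarith); linarith
    have h4 : ∫ t in (y - ℓ)..(y + ℓ), E t ≤ ∫ t in Ioo (x - δ) (x + δ), E t := by
      rw [intervalIntegral.integral_of_le (by linarith), integral_Ioc_eq_integral_Ioo]
      refine setIntegral_mono_set (hEi.mono_set (hIoo x hx))
        (ae_of_all _ fun t => penaltyDensity_nonneg hεj _ _ t)
        (LE.le.eventuallyLE ?_)
      rw [abs_lt] at hy
      exact Ioo_subset_Ioo (by linarith [hy.1]) (by linarith [hy.2])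
    calc 2 * √2 * (1 - θ) ^ 2 ≤ 2 * √2 * (1 - V j y) ^ 2 := by gcongr
      _ ≤ _ := h2
      _ ≤ _ := by
        apply mul_le_mul_of_nonneg_left h4
        positivity
  calc (T.card : ℝ) * (2 * √2 * (1 - θ) ^ 2) = ∑ x ∈ T, 2 * √2 * (1 - θ) ^ 2 := by
        rw [Finset.sum_const, nsmul_eq_mul]
    _ ≤ ∑ x ∈ T, (1 + C * ε j) * ∫ t in Ioo (x - δ) (x + δ), E t := Finset.sum_le_sum h1
    _ = (1 + C * ε j) * ∫ t in ⋃ x ∈ T, Ioo (x - δ) (x + δ), E t := by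
        rw [← Finset.mul_sum, integral_biUnion_finset T (fun _ _ => measurableSet_Ioo)
          (fun x hx y hy hxy => by
            rw [Function.onFun, Set.disjoint_left]
            intro t ht ht'
            have h5 := hsep x hx y hy hxy
            have h6 : |x - y| < 2 * δ := by
              rw [abs_lt]; constructor <;> linarith [ht.1, ht.2, ht'.1, ht'.2]
            linarith)
          (fun x hx => hEi.mono_set (hIoo x hx))]
    _ ≤ (1 + C * ε j) * ∫ t in Ioo a b, E t := by
        apply mul_le_mul_of_nonneg_left _ (by positivity)
        exact setIntegral_mono_set hEi (ae_of_all _ fun t => penaltyDensity_nonneg hεj _ _ t)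
          (LE.le.eventuallyLE (iUnion₂_subset hIoo))
    _ ≤ (1 + C * ε j) * B := by
        apply mul_le_mul_of_nonneg_left hB
        positivity

/-- The level `1 / 2` is a convenience: below any level `θ < 1` each point costs at least `2√2 (1 -
θ)²`, out of a total of `B`. -/
lemma finite_lowSet (h : EnergyBound a b A B 𝒰 ε u du V V' V'' u₀) :
    (lowSet a b 𝒰 V (1 / 2)).Finite := by
  by_contra hinf
  obtain ⟨N, hN⟩ := exists_nat_gt (B / (2 * √2 * (1 - 1 / 2) ^ 2))
  obtain ⟨T, hT, hTc⟩ := (show (lowSet a b 𝒰 V (1 / 2)).Infinite from hinf).exists_subset_card_eq N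
  have h1 := h.card_mul_le (by norm_num) hT
  rw [hTc] at h1
  rw [div_lt_iff₀ (by positivity)] at hN
  linarith

/-- Where `V j` stays away from `0`, the Dirichlet bound passes to the limit. -/
lemma abs_integral_mul_deriv_le (h : EnergyBound a b A B 𝒰 ε u du V V' V'' u₀) {φ : ℝ → ℝ}
    (hφ : IsTestFunction a b φ) {θ : ℝ} (hθ : 0 < θ)
    (hV : ∀ᶠ j in 𝒰, ∀ y ∈ tsupport φ, θ ≤ V j y) :
    |∫ x in Ioo a b, u₀ x * deriv φ x| ≤ √A * √(∫ x in Ioo a b, φ x ^ 2) := by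
  have hA := h.dirichlet_bound_nonneg
  have hB := h.penalty_bound_nonneg
  obtain ⟨C, hC0, hC⟩ := hφ.exists_bound
  obtain ⟨C', hC'0, hC'⟩ := hφ.deriv.exists_bound
  have hlim : Tendsto (fun j => √A * √(∫ x in Ioo a b, φ x ^ 2)
      + √(ε j * B) * √((C / θ) ^ 2 * A) + C' * ∫ x in Ioo a b, |u j x - u₀ x|) 𝒰
      (𝓝 (√A * √(∫ x in Ioo a b, φ x ^ 2) + √(0 * B) * √((C / θ) ^ 2 * A) + C' * 0)) :=
    (tendsto_const_nhds.add ((h.ε_tendsto.mul_const B).sqrt.mul_const _)).add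
      (h.tendsto.const_mul C')
  rw [zero_mul, Real.sqrt_zero, zero_mul, mul_zero, add_zero, add_zero] at hlim
  refine ge_of_tendsto hlim ?_
  filter_upwards [hV, h.dirichlet_le, h.penalty_le] with j hVj hAj hBj
  have hεj := h.ε_pos j
  have m1 : MemLp (fun x => V j x * du j x) 2 (volume.restrict (Ioo a b)) :=
    memLp_mul_of_continuous (h.isPrimitive j).continuous (h.memLp_du j)
  have m2 : MemLp (fun x => 1 - V j x) 2 (volume.restrict (Ioo a b)) := by
    have := (h.isPrimitive_one_sub j).memW12 (a := a) (b := b)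
      (((h.isPrimitive_neg j).memW12 (a := a) (b := b) ((h.memLp j).neg.restrict _)).1)
    exact this.1
  have m3 : MemLp (fun x => φ x * du j x) 2 (volume.restrict (Ioo a b)) :=
    memLp_mul_of_continuous hφ.continuous (h.memLp_du j)
  have i1 : |∫ x in Ioo a b, (V j x * du j x) * φ x| ≤ √A * √(∫ x in Ioo a b, φ x ^ 2) :=
    (abs_integral_mul_le m1 (hφ.memLp 2)).trans
      (mul_le_mul_of_nonneg_right (Real.sqrt_le_sqrt hAj) (Real.sqrt_nonneg _))
  have i2 : ∫ x in Ioo a b, (1 - V j x) ^ 2 ≤ ε j * B := by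
    calc ∫ x in Ioo a b, (1 - V j x) ^ 2
        ≤ ∫ x in Ioo a b, ε j *
          penaltyDensity (ε j) (fun x => 1 - V j x) (fun x => - V'' j x) x := by
          refine integral_mono (integrable_sq_of_memLp m2)
            ((h.integrableOn_penalty j).const_mul _) fun x => ?_
          unfold penaltyDensity
          have : 0 ≤ ε j * (ε j ^ 3 * (-V'' j x) ^ 2) := by positivity
          rw [mul_add, mul_div_cancel₀ _ hεj.ne']
          linarith
      _ ≤ ε j * B := by
          rw [integral_const_mul]
          exact mul_le_mul_of_nonneg_left hBj hεj.le
  have i3 : ∫ x in Ioo a b, (φ x * du j x) ^ 2 ≤ (C / θ) ^ 2 * A := by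
    calc ∫ x in Ioo a b, (φ x * du j x) ^ 2
        ≤ ∫ x in Ioo a b, (C / θ) ^ 2 * (V j x * du j x) ^ 2 := by
          refine integral_mono (integrable_sq_of_memLp m3)
            ((integrable_sq_of_memLp m1).const_mul _) fun x => ?_
          by_cases hx : x ∈ tsupport φ
          · have h1 : |φ x| ≤ C / θ * |V j x| := by
              have h2 := hVj x hx
              rw [abs_of_pos (hθ.trans_le h2)]
              calc |φ x| ≤ C := hC x
                _ = C / θ * θ := by field_simp
                _ ≤ C / θ * V j x := by gcongr
            have h3 : φ x ^ 2 ≤ (C / θ) ^ 2 * V j x ^ 2 := by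
              rw [← sq_abs (φ x), ← sq_abs (V j x), ← mul_pow]
              exact pow_le_pow_left₀ (abs_nonneg _) h1 2
            calc (φ x * du j x) ^ 2 = φ x ^ 2 * du j x ^ 2 := by ring
              _ ≤ (C / θ) ^ 2 * V j x ^ 2 * du j x ^ 2 := by gcongr
              _ = _ := by ring
          · rw [image_eq_zero_of_notMem_tsupport hx]
            have : 0 ≤ (C / θ) ^ 2 * (V j x * du j x) ^ 2 := by positivity
            simpa using this
      _ ≤ _ := by
          rw [integral_const_mul]
          exact mul_le_mul_of_nonneg_left hAj (by positivity)
  -- Splitting `1 = V + (1 - V)` keeps the sharp constant `√A`, instead of `√A / θ`: the bound `V ≥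
  -- θ` only controls a remainder, which vanishes with `‖1 - V‖² ≤ ε B`.
  have i4 : |∫ x in Ioo a b, (1 - V j x) * (φ x * du j x)| ≤ √(ε j * B) * √((C / θ) ^ 2 * A) :=
    (abs_integral_mul_le m2 m3).trans
      (mul_le_mul (Real.sqrt_le_sqrt i2) (Real.sqrt_le_sqrt i3) (Real.sqrt_nonneg _)
        (Real.sqrt_nonneg _))
  have e1 : ∫ x in Ioo a b, u j x * deriv φ x = -((∫ x in Ioo a b, (V j x * du j x) * φ x)
      + ∫ x in Ioo a b, (1 - V j x) * (φ x * du j x)) := by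
    have e0 : ∫ x in Ioo a b, (V j x * du j x * φ x + (1 - V j x) * (φ x * du j x)) =
        (∫ x in Ioo a b, (V j x * du j x) * φ x)
          + ∫ x in Ioo a b, (1 - V j x) * (φ x * du j x) :=
      integral_add (m1.integrable_mul (hφ.memLp 2)) (m2.integrable_mul m3)
    rw [(h.hasWeakDeriv j).integral_mul_deriv φ hφ, ← e0]
    congr 2 with x
    ring
  have hul := h.integrable_limit.locallyIntegrableOn
  have huj := (h.integrable j).locallyIntegrableOn
  have e2 : |(∫ x in Ioo a b, u₀ x * deriv φ x) - ∫ x in Ioo a b, u j x * deriv φ x|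
      ≤ C' * ∫ x in Ioo a b, |u j x - u₀ x| := by
    rw [← integral_sub (hφ.deriv.integrable_mul hul).integrableOn
      (hφ.deriv.integrable_mul huj).integrableOn, ← integral_const_mul]
    refine (abs_integral_le_integral_abs).trans (integral_mono_of_nonneg
      (ae_of_all _ fun x => abs_nonneg _)
      (((h.integrable j).sub h.integrable_limit).abs.const_mul C') (ae_of_all _ fun x => ?_))
    simp only []
    rw [← sub_mul, abs_mul, abs_sub_comm, mul_comm]
    exact mul_le_mul_of_nonneg_right (hC' x) (abs_nonneg _)
  have e3 : |∫ x in Ioo a b, u j x * deriv φ x| ≤ √A * √(∫ x in Ioo a b, φ x ^ 2)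
      + √(ε j * B) * √((C / θ) ^ 2 * A) := by
    rw [e1, abs_neg]
    exact (abs_add_le _ _).trans (add_le_add i1 i4)
  have e4 := abs_sub_abs_le_abs_sub (∫ x in Ioo a b, u₀ x * deriv φ x)
    (∫ x in Ioo a b, u j x * deriv φ x)
  linarith

/-- Finitely many of the local neighbourhoods cover `K`, and finitely many eventual bounds hold at
once. -/
lemma eventually_le_on_compact {θ : ℝ} {K : Set ℝ} (hK : IsCompact K) (hKab : K ⊆ Ioo a b)
    (hd : Disjoint K (lowSet a b 𝒰 V θ)) : ∀ᶠ j in 𝒰, ∀ y ∈ K, θ ≤ V j y := by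
  refine hK.induction_on (p := fun t => ∀ᶠ j in 𝒰, ∀ y ∈ t, θ ≤ V j y) (by simp)
    (fun s t hst ht => ht.mono fun j hj y hy => hj y (hst hy))
    (fun s t hs ht => (hs.and ht).mono fun j hj y hy => hy.elim (hj.1 y) (hj.2 y))
    (fun x hx => ?_)
  obtain ⟨η, hη, hj⟩ := exists_eventually_le_of_notMem_lowSet (hKab hx)
    (Set.disjoint_left.1 hd hx)
  exact ⟨Metric.ball x η, mem_nhdsWithin_of_mem_nhds (Metric.ball_mem_nhds x hη),
    hj.mono fun j h y hy => h y hy⟩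

/-- The limit is piecewise absolutely continuous, with the Dirichlet bound, and its jump points are
limits of points where `V j → 0`. -/
theorem exists_piecewiseRep (h : EnergyBound a b A B 𝒰 ε u du V V' V'' u₀) :
    ∃ G g S κ, PiecewiseRep a b u₀ G g S κ ∧ MemLp g 2 (volume.restrict (Ioo a b)) ∧
      ∫ x in Ioo a b, g x ^ 2 ≤ A ∧ ∀ s ∈ S, κ s ≠ 0 → ∀ θ > 0, s ∈ lowSet a b 𝒰 V θ := by
  have hfin := h.finite_lowSet
  have hul := h.integrable_limit.locallyIntegrableOn
  set S := hfin.toFinset with hS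
  have hSL : (S : Set ℝ) = lowSet a b 𝒰 V (1 / 2) := hfin.coe_toFinset
  have hSab : (S : Set ℝ) ⊆ Ioo a b := by rw [hSL]; exact fun x hx => hx.1
  obtain ⟨g, hgm, hgA, hg⟩ := exists_memLp_of_abs_integral_le (S := S) hul (Real.sqrt_nonneg A)
    (fun φ hφ hd => h.abs_integral_mul_deriv_le hφ (θ := 1 / 2) (by norm_num)
      (eventually_le_on_compact hφ.hasCompactSupport hφ.tsupport_subset (hSL ▸ hd)))
  have hgi : LocallyIntegrable ((Ioo a b).indicator g) :=
    ((integrableOn_Ioo_of_memLp hgm).integrable_indicator measurableSet_Ioo).locallyIntegrable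
  have hG := IsPrimitive.of_integral hgi 0 a
  set G : ℝ → ℝ := fun x => 0 + ∫ t in a..x, (Ioo a b).indicator g t
  have hGl : LocallyIntegrableOn G (Ioo a b) :=
    hG.continuous.locallyIntegrable.locallyIntegrableOn _
  have hind : ∀ φ : ℝ → ℝ, ∫ x in Ioo a b, (Ioo a b).indicator g x * φ x
      = ∫ x in Ioo a b, g x * φ x := fun φ =>
    setIntegral_congr_fun measurableSet_Ioo fun x hx => by simp only [indicator_of_mem hx]
  -- Subtracting the primitive of `g` leaves a function whose weak derivative lives on the finite
  -- set `S`.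
  obtain ⟨c, κ, hcκ⟩ := exists_ae_eq_stepSum S h.lt hSab (hul.sub hGl) (fun φ hφ hd => by
    have h1 := hg φ hφ hd
    have h2 := hG.integral_mul_deriv hφ
    rw [hind] at h2
    simp only [Pi.sub_apply, sub_mul]
    rw [integral_sub (hφ.deriv.integrable_mul hul).integrableOn
      (hφ.deriv.integrable_mul hGl).integrableOn, h1, h2]
    ring)
  have hrep : PiecewiseRep a b u₀ (fun x => c + G x) ((Ioo a b).indicator g) S κ := by
    refine ⟨by simpa using (IsPrimitive.const c).add hG, hSab, ?_⟩
    filter_upwards [hcκ] with x hx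
    simp only [Pi.sub_apply] at hx
    linarith
  have hae : (Ioo a b).indicator g =ᵐ[volume.restrict (Ioo a b)] g :=
    indicator_ae_eq_restrict measurableSet_Ioo
  have hgm' : MemLp ((Ioo a b).indicator g) 2 (volume.restrict (Ioo a b)) :=
    (memLp_congr_ae hae).2 hgm
  refine ⟨_, _, S, κ, hrep, hgm', ?_, ?_⟩
  · rw [integral_congr_ae (hae.mono fun x hx => by simp only [hx] :
      (fun x => (Ioo a b).indicator g x ^ 2) =ᵐ[volume.restrict (Ioo a b)] fun x => g x ^ 2)]
    exact (Real.sqrt_le_sqrt_iff h.dirichlet_bound_nonneg).1 hgA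
  · intro s hs hκ θ hθ
    by_contra hn
    have hsab := hSab hs
    obtain ⟨η, hη, hV⟩ := exists_eventually_le_of_notMem_lowSet hsab hn
    apply hκ
    -- If `V` stayed above `θ` near `s`, the Dirichlet bound would apply across `s`. A bump of
    -- height `1` and width of order `r` isolates `κ s`, while both integrals it is compared with
    -- are `O(√r)`.
    set M := √A + √(∫ x in Ioo a b, ((Ioo a b).indicator g x) ^ 2) with hM
    have hlim : Tendsto (fun r : ℝ => M * √(2 * r)) (𝓝[>] 0) (𝓝 (M * √(2 * 0))) :=
      ((((continuous_const.mul continuous_id).sqrt).const_mul M).tendsto 0).mono_left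
        nhdsWithin_le_nhds
    rw [mul_zero, Real.sqrt_zero, mul_zero] at hlim
    refine abs_eq_zero.1 (le_antisymm (ge_of_tendsto hlim ?_) (abs_nonneg _))
    filter_upwards [eventually_separated hSab, Ioo_mem_nhdsGT hη,
      eventually_ball_subset_Ioo hsab] with r hsep hr hball
    set f : ContDiffBump s := ⟨r / 4, r / 2, by linarith [hr.1], by linarith [hr.1]⟩ with hf
    have hfr : f.rOut = r / 2 := rfl
    have hcb : Metric.closedBall s f.rOut ⊆ Metric.ball s r :=
      Metric.closedBall_subset_ball (by rw [hfr]; linarith [hr.1])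
    have hft : IsTestFunction a b f := isTestFunction_contDiffBump f (hcb.trans hball.2)
    have h1 := h.abs_integral_mul_deriv_le hft hθ (by
      filter_upwards [hV] with j hj y hy
      rw [f.tsupport_eq] at hy
      have h2 : |y - s| < r := hcb hy
      exact hj y (h2.trans hr.2))
    have hsum : ∑ t ∈ S, κ t * f t = κ s := by
      rw [Finset.sum_eq_single s]
      · rw [f.one_of_mem_closedBall (Metric.mem_closedBall_self (by linarith [f.rIn_pos])), mul_one]
      · intro t ht hts
        have h3 := hsep.2 t ht s hs hts
        rw [f.zero_of_le_dist, mul_zero]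
        rw [hfr, Real.dist_eq]
        linarith [hr.1]
      · exact fun h' => absurd hs h'
    rw [hrep.integral_mul_deriv hft, hsum, abs_neg] at h1
    have h4 := abs_integral_mul_le hgm' (hft.memLp 2)
    have h5 : ∫ x in Ioo a b, f x ^ 2 ≤ 2 * r := by
      calc ∫ x in Ioo a b, f x ^ 2 ≤ ∫ x in Ioo a b, f x := by
            refine integral_mono (hft.memLp 2).integrable_sq hft.integrable.integrableOn
              fun x => ?_
            have h6 := f.nonneg (x := x)
            have h7 := f.le_one (x := x)
            simp only []
            nlinarith
        _ ≤ ∫ x, f x := setIntegral_le_integral hft.integrable (ae_of_all _ fun x => f.nonneg)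
        _ ≤ (volume.real (Metric.closedBall s f.rOut)) := f.integral_le_measure_closedBall volume
        _ ≤ 2 * r := by
            rw [measureReal_def, Real.volume_closedBall, hfr,
              ENNReal.toReal_ofReal (by linarith [hr.1])]
            linarith [hr.1]
    have h8 := Real.sqrt_le_sqrt h5
    have h9 : |κ s| ≤ M * √(∫ x in Ioo a b, f x ^ 2) := by
      have := abs_sub_abs_le_abs_add (κ s) (∫ x in Ioo a b, (Ioo a b).indicator g x * f x)
      rw [add_comm (κ s)] at this
      rw [hM, add_mul]
      linarith
    exact h9.trans (mul_le_mul_of_nonneg_left h8 (by positivity))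

end EnergyBound

/-! ### The functionals, with their two terms separated

The integral sign `∫⁻` extends over a following `+`, so that in `energy` and in `mumfordShah` the
second term stands under the first integral. Hence these functionals are the ones below, with
`α * β * (b - a)` in place of `β`. -/

open scoped Classical in
/-- `α ∫ v² (u')² + β / (2√2) ∫ ((v-1)² / ε + ε³ (v'')²)` if
`(u,v) ∈ W^{1,2}(a,b) × W^{2,2}(a,b)`, and `+∞` otherwise. -/
def edgeEnergy (a b α β ε : ℝ) (p : L1 a b × L1 a b) : ℝ≥0∞ :=
  if MemW12 a b p.1 ∧ MemW22 a b p.2 then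
    (ENNReal.ofReal α *
        ∫⁻ t in Ioo a b, ENNReal.ofReal ((p.2 t) ^ 2 * (weakDeriv a b p.1 t) ^ 2)) +
      (ENNReal.ofReal (β / (2 * √2)) *
        ∫⁻ t in Ioo a b, ENNReal.ofReal
          ((p.2 t - 1) ^ 2 / ε + ε ^ 3 * (weakDeriv a b (weakDeriv a b p.2) t) ^ 2))
  else ⊤

open scoped Classical in
/-- `α ∫ (u')² + β #(S_u)` if `u ∈ SBV²(a,b)` and `v = 1` a.e., and `+∞` otherwise. -/
def jumpEnergy (a b α β : ℝ) (p : L1 a b × L1 a b) : ℝ≥0∞ :=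
  if MemSBV2 a b p.1 ∧ ∀ᵐ t ∂(volume.restrict (Ioo a b)), p.2 t = 1 then
    (ENNReal.ofReal α * ∫⁻ t in Ioo a b, ENNReal.ofReal ((approxDeriv p.1 t) ^ 2)) +
      (ENNReal.ofReal β * ((approxDiscontSet a b p.1).encard : ℝ≥0∞))
  else ⊤

lemma ofReal_mul_lintegral_add {a b α β γ : ℝ} (hα : 0 ≤ α) (hβ : 0 ≤ β)
    (hγ : γ = α * β * (b - a)) (f : ℝ → ℝ≥0∞) (P : ℝ≥0∞) :
    ENNReal.ofReal α * ∫⁻ t in Ioo a b, (f t + ENNReal.ofReal β * P) =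
      (ENNReal.ofReal α * ∫⁻ t in Ioo a b, f t) + ENNReal.ofReal γ * P := by
  rw [lintegral_add_right _ measurable_const, lintegral_const, Measure.restrict_apply_univ,
    Real.volume_Ioo, mul_add, hγ, ENNReal.ofReal_mul (mul_nonneg hα hβ), ENNReal.ofReal_mul hα]
  ring

lemma energy_eq_edgeEnergy {a b α β : ℝ} (hα : 0 ≤ α) (hβ : 0 ≤ β) (ε : ℝ) :
    energy a b α β ε = edgeEnergy a b α (α * β * (b - a)) ε := by
  ext p
  unfold energy edgeEnergy
  split_ifs with h
  · exact ofReal_mul_lintegral_add hα (by positivity) (by ring) _ _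
  · rfl

lemma mumfordShah_eq_jumpEnergy {a b α β : ℝ} (hα : 0 ≤ α) (hβ : 0 ≤ β) :
    mumfordShah a b α β = jumpEnergy a b α (α * β * (b - a)) := by
  ext p
  unfold mumfordShah jumpEnergy
  split_ifs with h
  · exact ofReal_mul_lintegral_add hα hβ rfl _ _
  · rfl

/-! ### The lower bound -/

lemma two_sqrt_two_pos : 0 < 2 * √2 := by positivity

lemma EnergyBound.memSBV2_and_le {a b A B : ℝ} {𝒰 : Ultrafilter ℕ} {ε : ℕ → ℝ}
    {u du V V' V'' : ℕ → ℝ → ℝ} {u₀ : ℝ → ℝ} (h : EnergyBound a b A B 𝒰 ε u du V V' V'' u₀) :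
    MemSBV2 a b u₀ ∧ ∫⁻ t in Ioo a b, ENNReal.ofReal ((approxDeriv u₀ t) ^ 2) ≤ ENNReal.ofReal A ∧
      ((approxDiscontSet a b u₀).encard : ℝ≥0∞) ≤ ENNReal.ofReal (B / (2 * √2)) := by
  obtain ⟨G, g, S, κ, hrep, hg, hgA, hlow⟩ := h.exists_piecewiseRep
  refine ⟨hrep.memSBV2 hg, ?_, ?_⟩
  · rw [lintegral_congr_ae (hrep.approxDeriv_ae_eq.mono fun x hx => by simp only [hx] :
      (fun t => ENNReal.ofReal ((approxDeriv u₀ t) ^ 2)) =ᵐ[volume.restrict (Ioo a b)]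
        fun t => ENNReal.ofReal (g t ^ 2)),
      ← ofReal_integral_eq_lintegral_ofReal hg.integrable_sq (ae_of_all _ fun x => sq_nonneg _)]
    exact ENNReal.ofReal_le_ofReal hgA
  · classical
    have hS : approxDiscontSet a b u₀ = ((S.filter fun s => κ s ≠ 0 : Finset ℝ) : Set ℝ) := by
      rw [hrep.approxDiscontSet_eq]; ext s; simp
    set T := S.filter fun s => κ s ≠ 0
    have h1 : ∀ θ ∈ Ioo (0 : ℝ) 1, T.card * (2 * √2 * (1 - θ) ^ 2) ≤ B := fun θ hθ =>
      h.card_mul_le hθ.2.le fun s hs => by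
        have := Finset.mem_filter.1 (Finset.mem_coe.1 hs)
        exact hlow s this.1 this.2 θ hθ.1
    -- True jumps lie in the low sets of all levels, so `θ → 0` gives the full cost `2√2`.
    have h2 : T.card * (2 * √2 * (1 - 0) ^ 2) ≤ B := by
      have hc : Continuous fun θ : ℝ => T.card * (2 * √2 * (1 - θ) ^ 2) := by fun_prop
      refine le_of_tendsto ((hc.tendsto 0).mono_left (nhdsWithin_le_nhds (s := Ioi 0))) ?_
      filter_upwards [Ioo_mem_nhdsGT one_pos] with θ hθ using h1 θ hθ
    rw [hS, encard_coe_eq_coe_finsetCard]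
    have h3 : (T.card : ℝ) ≤ B / (2 * √2) := by
      rw [le_div_iff₀ two_sqrt_two_pos]
      simpa using h2
    calc (((T.card : ℕ∞) : ℝ≥0∞)) = ENNReal.ofReal (T.card : ℝ) := by simp
      _ ≤ _ := ENNReal.ofReal_le_ofReal h3

lemma integral_abs_sub_eq_dist {a b : ℝ} (f g : L1 a b) :
    ∫ x in Ioo a b, |f x - g x| = dist f g := by
  rw [dist_eq_norm, L1.norm_eq_integral_norm]
  refine integral_congr_ae ?_
  filter_upwards [Lp.coeFn_sub f g] with x hx
  rw [hx, Real.norm_eq_abs, Pi.sub_apply]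

lemma integrableOn_L1 {a b : ℝ} (f : L1 a b) : IntegrableOn f (Ioo a b) := L1.integrable_coeFn f

lemma setIntegral_le_of_lintegral_le {a b A : ℝ} (hA : 0 ≤ A) {f g : ℝ → ℝ} (hf : ∀ x, 0 ≤ f x)
    (hfi : IntegrableOn f (Ioo a b)) (hfg : f =ᵐ[volume.restrict (Ioo a b)] g)
    (h : ∫⁻ x in Ioo a b, ENNReal.ofReal (g x) ≤ ENNReal.ofReal A) :
    ∫ x in Ioo a b, f x ≤ A := by
  rw [← ENNReal.ofReal_le_ofReal_iff hA, ofReal_integral_eq_lintegral_ofReal hfi (ae_of_all _ hf)]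
  refine le_trans (le_of_eq (lintegral_congr_ae ?_)) h
  filter_upwards [hfg] with x hx
  rw [hx]

/-- Cauchy-Schwarz against the constant `1`, with `∫ (1 - V)² ≤ ε B`. -/
lemma tendsto_setIntegral_abs_sub_one {a b B : ℝ} {l : Filter ℕ} {ε : ℕ → ℝ} {V E : ℕ → ℝ → ℝ}
    (hε : Tendsto ε l (𝓝 0))
    (hV : ∀ j, MemLp (fun x => 1 - V j x) 2 (volume.restrict (Ioo a b)))
    (hE : ∀ j, IntegrableOn (E j) (Ioo a b)) (hVE : ∀ j x, (1 - V j x) ^ 2 ≤ ε j * E j x)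
    (hB : ∀ᶠ j in l, ∫ x in Ioo a b, E j x ≤ B) (hεp : ∀ j, 0 < ε j) :
    Tendsto (fun j => ∫ x in Ioo a b, |1 - V j x|) l (𝓝 0) := by
  have hlim : Tendsto (fun j => √(∫ x in Ioo a b, (1 : ℝ) ^ 2) * √(ε j * B)) l
      (𝓝 (√(∫ x in Ioo a b, (1 : ℝ) ^ 2) * √(0 * B))) := ((hε.mul_const B).sqrt).const_mul _
  rw [zero_mul, Real.sqrt_zero, mul_zero] at hlim
  refine squeeze_zero' (Eventually.of_forall fun j => integral_nonneg fun x => abs_nonneg _) ?_ hlim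
  filter_upwards [hB] with j hj
  have h1 := abs_integral_mul_le (memLp_const (1 : ℝ)) (hV j).abs
  simp only [one_mul, Pi.abs_apply, sq_abs] at h1
  refine (le_abs_self _).trans (h1.trans ?_)
  refine mul_le_mul_of_nonneg_left (Real.sqrt_le_sqrt ?_) (Real.sqrt_nonneg _)
  calc ∫ x in Ioo a b, (1 - V j x) ^ 2 ≤ ∫ x in Ioo a b, ε j * E j x :=
        integral_mono (hV j).integrable_sq ((hE j).const_mul _) (hVE j)
    _ ≤ ε j * B := by
        rw [integral_const_mul]
        exact mul_le_mul_of_nonneg_left hj (hεp j).le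

theorem jumpEnergy_le_liminf {a b α β : ℝ} (hab : a < b) (hα : 0 < α) (hβ : 0 < β)
    {ε : ℕ → ℝ} (hε_pos : ∀ j, 0 < ε j) (hε_lim : Tendsto ε atTop (𝓝 0))
    {p : L1 a b × L1 a b} {y : ℕ → L1 a b × L1 a b} (hy : Tendsto y atTop (𝓝 p)) :
    jumpEnergy a b α β p ≤ liminf (fun j => edgeEnergy a b α β (ε j) (y j)) atTop := by
  by_contra hlt
  obtain ⟨c, hc1, hc2⟩ := exists_between (not_le.1 hlt)
  have hctop : c ≠ ⊤ := (hc2.trans_le le_top).ne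
  obtain ⟨n, hn, hnc⟩ := extraction_of_frequently_atTop (frequently_lt_of_liminf_lt
    (by isBoundedDefault) hc1)
  -- An ultrafilter finer than `atTop` keeps all given limits and makes every sequence in the
  -- compact space `ℝ≥0∞` converge.
  set 𝒰 : Ultrafilter ℕ := hyperfilter ℕ
  have h𝒰 : (𝒰 : Filter ℕ) ≤ atTop := by
    rw [← Nat.cofinite_eq_atTop]; exact hyperfilter_le_cofinite
  have hnt : Tendsto n 𝒰 atTop := hn.tendsto_atTop.mono_left h𝒰
  have hmem : ∀ k, MemW12 a b (y (n k)).1 ∧ MemW22 a b (y (n k)).2 := fun k => by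
    by_contra hk
    have h1 := hnc k
    simp only [edgeEnergy, if_neg hk] at h1
    exact absurd h1 (not_lt.2 le_top)
  set D : ℕ → ℝ≥0∞ := fun k => ∫⁻ t in Ioo a b,
    ENNReal.ofReal (((y (n k)).2 t) ^ 2 * (weakDeriv a b (y (n k)).1 t) ^ 2) with hD
  set P : ℕ → ℝ≥0∞ := fun k => ∫⁻ t in Ioo a b, ENNReal.ofReal (((y (n k)).2 t - 1) ^ 2 / ε (n k)
    + ε (n k) ^ 3 * (weakDeriv a b (weakDeriv a b (y (n k)).2) t) ^ 2) with hP
  have hDP : ∀ k, ENNReal.ofReal α * D k + ENNReal.ofReal (β / (2 * √2)) * P k ≤ c := fun k => by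
    have h1 := hnc k
    simp only [edgeEnergy, if_pos (hmem k)] at h1
    exact h1.le
  obtain ⟨D₀, hD₀⟩ : ∃ x, Tendsto D 𝒰 (𝓝 x) := ⟨_, (𝒰.map D).le_nhds_lim⟩
  obtain ⟨P₀, hP₀⟩ : ∃ x, Tendsto P 𝒰 (𝓝 x) := ⟨_, (𝒰.map P).le_nhds_lim⟩
  have hα' : ENNReal.ofReal α ≠ 0 := by simpa using hα
  have hβ2 : 0 < β / (2 * √2) := div_pos hβ two_sqrt_two_pos
  have hβ' : ENNReal.ofReal (β / (2 * √2)) ≠ 0 := by simpa using hβ2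
  have hDPc : ENNReal.ofReal α * D₀ + ENNReal.ofReal (β / (2 * √2)) * P₀ ≤ c :=
    le_of_tendsto ((ENNReal.Tendsto.const_mul hD₀ (Or.inr ENNReal.ofReal_ne_top)).add
      (ENNReal.Tendsto.const_mul hP₀ (Or.inr ENNReal.ofReal_ne_top))) (Eventually.of_forall hDP)
  have hD₀t : D₀ ≠ ⊤ := by
    rintro rfl
    rw [ENNReal.mul_top hα', top_add] at hDPc
    exact hctop (top_le_iff.1 hDPc)
  have hP₀t : P₀ ≠ ⊤ := by
    rintro rfl
    rw [ENNReal.mul_top hβ', add_top] at hDPc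
    exact hctop (top_le_iff.1 hDPc)
  choose V V' V'' hV hV' hvV hvV'' hVL using fun k => (hmem k).2.exists_isPrimitive hab
  have hyn : Tendsto (fun k => y (n k)) 𝒰 (𝓝 p) := hy.comp hnt
  have hεn : Tendsto (fun k => ε (n k)) 𝒰 (𝓝 0) := hε_lim.comp hnt
  -- The two energies only converge to `D₀` and `P₀`, so eventual bounds need the slack `δ`, which
  -- is removed at the end.
  have hbound : ∀ δ > 0, EnergyBound a b (D₀.toReal + δ) (P₀.toReal + δ) 𝒰 (fun k => ε (n k))
      (fun k => (y (n k)).1) (fun k => weakDeriv a b (y (n k)).1) V V' V'' p.1 := by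
    intro δ hδ
    have hlt : ∀ x : ℝ≥0∞, x ≠ ⊤ → x < ENNReal.ofReal (x.toReal + δ) := fun x hx =>
      (ENNReal.lt_ofReal_iff_toReal_lt hx).2 (by linarith)
    refine ⟨hab, fun k => hε_pos _, hεn, fun k => (hmem k).1.hasWeakDeriv,
      fun k => (hmem k).1.memLp_weakDeriv, hV, hV', hVL, ?_, ?_, fun k => integrableOn_L1 _,
      integrableOn_L1 _, ?_⟩
    · filter_upwards [hD₀.eventually_lt_const (hlt D₀ hD₀t)] with k hk
      refine setIntegral_le_of_lintegral_le (by positivity) (fun x => sq_nonneg _)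
        (memLp_mul_of_continuous (hV k).continuous (hmem k).1.memLp_weakDeriv).integrable_sq
        ?_ hk.le
      filter_upwards [hvV k] with x hx
      rw [hx, mul_pow]
    · filter_upwards [hP₀.eventually_lt_const (hlt P₀ hP₀t)] with k hk
      have hw : IsPrimitive (fun x => 1 - V k x) (fun x => 0 - V' k x) :=
        (IsPrimitive.const 1).sub (hV k)
      refine setIntegral_le_of_lintegral_le (by positivity)
        (fun x => penaltyDensity_nonneg (hε_pos _) _ _ x)
        (((locallyIntegrable_penaltyDensity hw (hVL k).neg).integrableOn_isCompact
          isCompact_Icc).mono_set Ioo_subset_Icc_self) ?_ hk.le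
      filter_upwards [hvV k, hvV'' k] with x hx hx'
      unfold penaltyDensity
      rw [hx, hx']
      simp only []
      ring
    · simp only [integral_abs_sub_eq_dist]
      exact tendsto_iff_dist_tendsto_zero.1 ((continuous_fst.tendsto p).comp hyn)
  -- Bounded penalization drives `v` to `1` in `L¹`, which must then be its limit `p.2`.
  have hv1 : ∀ᵐ t ∂(volume.restrict (Ioo a b)), p.2 t = 1 := by
    have hb := hbound 1 one_pos
    have h1 := tendsto_setIntegral_abs_sub_one hεn
      (fun k => ((hb.isPrimitive_one_sub k).memW12
        (((hb.isPrimitive_neg k).memW12 ((hVL k).neg.restrict _)).1)).1)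
      (fun k => hb.integrableOn_penalty k) (fun k x => by
        have hεk := hε_pos (n k)
        unfold penaltyDensity
        have : 0 ≤ ε (n k) * (ε (n k) ^ 3 * (-V'' k x) ^ 2) := by positivity
        rw [mul_add, mul_div_cancel₀ _ hεk.ne']
        linarith) hb.penalty_le (fun k => hε_pos _)
    have h2 : Tendsto (fun k => ∫ x in Ioo a b, |(y (n k)).2 x - p.2 x|) 𝒰 (𝓝 0) := by
      simp only [integral_abs_sub_eq_dist]
      exact tendsto_iff_dist_tendsto_zero.1 ((continuous_snd.tendsto p).comp hyn)
    have h3 := h1.add h2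
    rw [add_zero] at h3
    have hone : IntegrableOn (fun _ : ℝ => (1 : ℝ)) (Ioo a b) := integrable_const 1
    have h4 : ∫ x in Ioo a b, |1 - p.2 x| ≤ 0 := by
      refine ge_of_tendsto h3 (Eventually.of_forall fun k => ?_)
      have e1 : ∫ x in Ioo a b, |1 - V k x| = ∫ x in Ioo a b, |1 - (y (n k)).2 x| :=
        integral_congr_ae ((hvV k).mono fun x hx => by simp only [hx])
      have i1 := (hone.sub (integrableOn_L1 (y (n k)).2)).abs
      have i2 := ((integrableOn_L1 (y (n k)).2).sub (integrableOn_L1 p.2)).abs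
      have i3 := (hone.sub (integrableOn_L1 p.2)).abs
      rw [e1]
      have e2 := integral_add i1 i2
      simp only [Pi.sub_apply] at e2
      rw [← e2]
      exact integral_mono i3 (i1.add i2) fun x => abs_sub_le _ _ _
    have h5 := (integral_eq_zero_iff_of_nonneg (fun x => abs_nonneg _)
      (hone.sub (integrableOn_L1 p.2)).abs).1
      (le_antisymm h4 (integral_nonneg fun x => abs_nonneg _))
    filter_upwards [h5] with x hx
    have : (1 : ℝ) - p.2 x = 0 := abs_eq_zero.1 hx
    linarith
  have hMS : jumpEnergy a b α β p ≤ ENNReal.ofReal α * D₀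
      + ENNReal.ofReal (β / (2 * √2)) * P₀ := by
    have hcond : MemSBV2 a b p.1 ∧ ∀ᵐ t ∂(volume.restrict (Ioo a b)), p.2 t = 1 :=
      ⟨(hbound 1 one_pos).memSBV2_and_le.1, hv1⟩
    rw [jumpEnergy, if_pos hcond]
    have hlim : Tendsto (fun δ : ℝ => ENNReal.ofReal α * ENNReal.ofReal (D₀.toReal + δ)
        + ENNReal.ofReal β * ENNReal.ofReal ((P₀.toReal + δ) / (2 * √2))) (𝓝[>] 0)
        (𝓝 (ENNReal.ofReal α * ENNReal.ofReal (D₀.toReal + 0)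
        + ENNReal.ofReal β * ENNReal.ofReal ((P₀.toReal + 0) / (2 * √2)))) := by
      have c1 : Tendsto (fun δ : ℝ => D₀.toReal + δ) (𝓝[>] 0) (𝓝 (D₀.toReal + 0)) :=
        ((continuous_const.add continuous_id).tendsto 0).mono_left nhdsWithin_le_nhds
      have c2 : Tendsto (fun δ : ℝ => (P₀.toReal + δ) / (2 * √2)) (𝓝[>] 0)
          (𝓝 ((P₀.toReal + 0) / (2 * √2))) :=
        (((continuous_const.add continuous_id).div_const _).tendsto 0).mono_left
          nhdsWithin_le_nhds
      exact (ENNReal.Tendsto.const_mul (ENNReal.tendsto_ofReal c1)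
        (Or.inr ENNReal.ofReal_ne_top)).add (ENNReal.Tendsto.const_mul (ENNReal.tendsto_ofReal c2)
        (Or.inr ENNReal.ofReal_ne_top))
    have e1 : ENNReal.ofReal (β / (2 * √2)) * P₀
        = ENNReal.ofReal β * ENNReal.ofReal ((P₀.toReal + 0) / (2 * √2)) := by
      conv_lhs => rw [← ENNReal.ofReal_toReal hP₀t]
      rw [← ENNReal.ofReal_mul hβ2.le, ← ENNReal.ofReal_mul hβ.le]
      congr 1
      rw [add_zero]; ring
    rw [add_zero, ENNReal.ofReal_toReal hD₀t, ← e1] at hlim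
    refine ge_of_tendsto hlim ?_
    filter_upwards [self_mem_nhdsWithin] with δ hδ
    have h1 := (hbound δ hδ).memSBV2_and_le
    gcongr
    · exact h1.2.1
    · exact h1.2.2
  exact absurd (hc2.trans_le (hMS.trans hDPc)) (lt_irrefl _)

/-! ### The transition profile -/

/-- The optimal profile on `[0, ∞)`: it solves `w'' + √2 w' + w = 0`, `w(0) = 1`, `w'(0) = 0`. -/
def optimalProfile (t : ℝ) : ℝ :=
  Real.exp (-(√2 / 2 * t)) * (Real.cos (√2 / 2 * t) + Real.sin (√2 / 2 * t))

/-- The derivative of `optimalProfile`. -/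
def optimalProfile' (t : ℝ) : ℝ := -√2 * (Real.exp (-(√2 / 2 * t)) * Real.sin (√2 / 2 * t))

/-- The second derivative of `optimalProfile`. -/
def optimalProfile'' (t : ℝ) : ℝ :=
  Real.exp (-(√2 / 2 * t)) * (Real.sin (√2 / 2 * t) - Real.cos (√2 / 2 * t))

lemma hasDerivAt_optimalProfile (t : ℝ) :
    HasDerivAt optimalProfile (optimalProfile' t) t := by
  have hl : HasDerivAt (fun t : ℝ => √2 / 2 * t) (√2 / 2) t := by
    simpa using (hasDerivAt_id t).const_mul (√2 / 2)
  have := hl.neg.exp.mul (hl.cos.add hl.sin)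
  convert! this using 1
  simp only [optimalProfile', Pi.add_apply, Pi.neg_apply]
  ring

lemma hasDerivAt_optimalProfile' (t : ℝ) :
    HasDerivAt optimalProfile' (optimalProfile'' t) t := by
  have hl : HasDerivAt (fun t : ℝ => √2 / 2 * t) (√2 / 2) t := by
    simpa using (hasDerivAt_id t).const_mul (√2 / 2)
  have h := (hl.neg.exp.mul hl.sin).const_mul (-√2)
  convert! h using 1
  have hs : √2 * √2 = 2 := Real.mul_self_sqrt (by norm_num)
  simp only [optimalProfile'', Pi.neg_apply]
  linear_combination (1 / 2 * Real.exp (-(√2 / 2 * t)) *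
    (Real.cos (√2 / 2 * t) - Real.sin (√2 / 2 * t))) * hs

lemma continuous_optimalProfile'' : Continuous optimalProfile'' := by
  unfold optimalProfile''; fun_prop

lemma abs_optimalProfile''_le {t : ℝ} (ht : 0 ≤ t) : |optimalProfile'' t| ≤ 2 := by
  unfold optimalProfile''
  have h1 : Real.exp (-(√2 / 2 * t)) ≤ 1 := Real.exp_le_one_iff.2 (by
    have : 0 ≤ √2 / 2 * t := by positivity
    linarith)
  rw [abs_mul, abs_of_pos (Real.exp_pos _)]
  have h2 := abs_sub (Real.sin (√2 / 2 * t)) (Real.cos (√2 / 2 * t))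
  have h3 := Real.abs_sin_le_one (√2 / 2 * t)
  have h4 := Real.abs_cos_le_one (√2 / 2 * t)
  nlinarith [Real.exp_pos (-(√2 / 2 * t)), abs_nonneg (Real.sin (√2 / 2 * t) -
    Real.cos (√2 / 2 * t))]

/-- The equation annihilates the square in the calibration identity, so the integrand is an exact
derivative. The boundary term is `√2` at `0`, and the one at `T` has the right sign because `1 ≤
√2`. -/
lemma integral_optimalProfile_sq_le (T : ℝ) :
    ∫ t in (0 : ℝ)..T, (optimalProfile t ^ 2 + optimalProfile'' t ^ 2) ≤ √2 := by
  have hs : √2 ^ 2 = 2 := Real.sq_sqrt (by norm_num)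
  have hc : Continuous optimalProfile :=
    continuous_iff_continuousAt.2 fun t => (hasDerivAt_optimalProfile t).continuousAt
  have hd : ∀ t, HasDerivAt (fun t => -(√2 * (optimalProfile t ^ 2 + optimalProfile' t ^ 2)
      + 2 * (optimalProfile t * optimalProfile' t)))
      (optimalProfile t ^ 2 + optimalProfile'' t ^ 2) t := fun t => by
    have h0 := hasDerivAt_optimalProfile t
    have h1 := hasDerivAt_optimalProfile' t
    have h2 := ((((h0.pow 2).add (h1.pow 2)).const_mul √2).add ((h0.mul h1).const_mul 2)).neg
    convert! h2 using 1
    have hode : optimalProfile'' t = -√2 * optimalProfile' t - optimalProfile t := by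
      unfold optimalProfile'' optimalProfile' optimalProfile
      linear_combination (-Real.exp (-(√2 / 2 * t)) * Real.sin (√2 / 2 * t)) * hs
    rw [hode]
    push_cast
    linear_combination (-(optimalProfile' t ^ 2)) * hs
  rw [intervalIntegral.integral_eq_sub_of_hasDerivAt (fun t _ => hd t)
    (((hc.pow 2).add (continuous_optimalProfile''.pow 2)).intervalIntegrable _ _)]
  have h0 : optimalProfile 0 = 1 := by simp [optimalProfile]
  have h0' : optimalProfile' 0 = 0 := by simp [optimalProfile']
  rw [h0, h0']
  have h1 : 1 ≤ √2 := Real.one_le_sqrt.2 (by norm_num)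
  nlinarith [sq_nonneg (optimalProfile T + optimalProfile' T), sq_nonneg (optimalProfile T),
    sq_nonneg (optimalProfile' T), mul_nonneg (sub_nonneg.2 h1) (sq_nonneg (optimalProfile T)),
    mul_nonneg (sub_nonneg.2 h1) (sq_nonneg (optimalProfile' T))]

/-- At these times the profile is tiny with zero slope, which makes them convenient places to
truncate it. -/
lemma optimalProfile_period (n : ℕ) :
    optimalProfile (√2 * (n * (2 * Real.pi))) = Real.exp (-(2 * Real.pi)) ^ n ∧
      optimalProfile' (√2 * (n * (2 * Real.pi))) = 0 := by
  have hs : √2 * √2 = 2 := Real.mul_self_sqrt (by norm_num)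
  have e : √2 / 2 * (√2 * (n * (2 * Real.pi))) = n * (2 * Real.pi) := by
    linear_combination (n * Real.pi) * hs
  unfold optimalProfile optimalProfile'
  rw [e, Real.cos_nat_mul_two_pi]
  have h1 : Real.sin (n * (2 * Real.pi)) = 0 := by
    have := Real.sin_nat_mul_pi (2 * n)
    rw [← this]; congr 1; push_cast; ring
  rw [h1, ← Real.exp_nat_mul]
  constructor
  · rw [add_zero, mul_one]; congr 1; ring
  · ring

/-- The optimal profile, preceded by the constant `1`, and cut off at a large distance. -/
lemma exists_halfProfile {η : ℝ} (hη : 0 < η) : ∃ (τ R : ℝ) (w w' w'' : ℝ → ℝ), 0 < τ ∧ τ < R ∧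
    IsPrimitive w w' ∧ IsPrimitive w' w'' ∧ (∀ t, |w'' t| ≤ 6) ∧
    (∀ t ≤ τ, w t = 1 ∧ w' t = 0 ∧ w'' t = 0) ∧
    (∀ t, R < t → w t = 0 ∧ w'' t = 0) ∧ ∫ t in (0 : ℝ)..R, (w t ^ 2 + w'' t ^ 2) ≤ √2 + η := by
  -- With `δ ≤ 1` and `δ ≤ η / 74`, the truncation cost `37 δ²` is at most `η / 2`.
  obtain ⟨n, hn⟩ := exists_pow_lt_of_lt_one (show 0 < min 1 (η / 74) by positivity)
    (Real.exp_lt_one_iff.2 (show -(2 * Real.pi) < 0 by linarith [Real.pi_pos]))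
  obtain ⟨hf1, hf2⟩ := optimalProfile_period n
  set δ := Real.exp (-(2 * Real.pi)) ^ n with hδ
  set T := √2 * (n * (2 * Real.pi)) with hT
  have hT0 : 0 ≤ T := by have := Real.pi_pos; positivity
  have hδ0 : 0 < δ := by positivity
  have hδ1 : δ ≤ 1 := hn.le.trans (min_le_left _ _)
  have hδη : 37 * δ ^ 2 ≤ η / 2 := by
    have : δ ≤ η / 74 := hn.le.trans (min_le_right _ _)
    nlinarith
  -- On the plateau the energy density is `1`, so it costs `τ`, the other half of `η`.
  set τ := η / 2 with hτ
  have hτ0 : 0 < τ := by positivity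
  have f0 : IsPrimitive optimalProfile optimalProfile' :=
    IsPrimitive.of_hasDerivAt hasDerivAt_optimalProfile
      (continuous_iff_continuousAt.2 fun t => (hasDerivAt_optimalProfile' t).continuousAt)
  have f1 : IsPrimitive optimalProfile' optimalProfile'' :=
    IsPrimitive.of_hasDerivAt hasDerivAt_optimalProfile' continuous_optimalProfile''
  -- The cubic that goes from `δ` to `0` over unit length with zero slope at both ends.
  have g0 : IsPrimitive (fun t : ℝ => δ * (1 - 3 * t ^ 2 + 2 * t ^ 3))
      (fun t => δ * (-6 * t + 6 * t ^ 2)) := by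
    refine (IsPrimitive.of_hasDerivAt (fun t => ?_) (by fun_prop)).const_mul δ
    have := (((hasDerivAt_pow 2 t).const_mul 3).const_sub 1).add ((hasDerivAt_pow 3 t).const_mul 2)
    convert! this using 1
    push_cast; ring
  have g1 : IsPrimitive (fun t : ℝ => δ * (-6 * t + 6 * t ^ 2)) (fun t => δ * (-6 + 12 * t)) := by
    refine (IsPrimitive.of_hasDerivAt (fun t => ?_) (by fun_prop)).const_mul δ
    have := ((hasDerivAt_id t).const_mul (-6)).add ((hasDerivAt_pow 2 t).const_mul 6)
    convert! this using 1
    push_cast; ring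
  have shift : ∀ {F f : ℝ → ℝ} (c : ℝ), IsPrimitive F f →
      IsPrimitive (fun t => F (t - c)) (fun t => f (t - c)) := fun c h => by
    simpa [sub_eq_add_neg] using h.comp_mul_add one_ne_zero (-c)
  have z := IsPrimitive.const 0
  set c₂ := τ + T with hc₂
  set c₃ := τ + T + 1 with hc₃
  have a0 := (shift c₂ g0).glue z (c := c₃) (by rw [hc₂, hc₃]; ring)
  have a1 := (shift c₂ g1).glue z (c := c₃) (by rw [hc₂, hc₃]; ring)
  have h23 : c₂ ≤ c₃ := by linarith
  have h12 : τ ≤ c₂ := by linarith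
  have e2 : c₂ - τ = T := by rw [hc₂]; ring
  have b0 := (shift τ f0).glue a0 (c := c₂) (by
    simp only [if_pos h23, e2, hf1]; ring)
  have b1 := (shift τ f1).glue a1 (c := c₂) (by
    simp only [if_pos h23, e2, hf2]; ring)
  have d0 := (IsPrimitive.const 1).glue b0 (c := τ) (by
    simp only [if_pos h12, sub_self]; simp [optimalProfile])
  have d1 := z.glue b1 (c := τ) (by
    simp only [if_pos h12, sub_self]; simp [optimalProfile'])
  refine ⟨τ, c₃, _, _, _, hτ0, by linarith, d0, d1, ?_, ?_, ?_, ?_⟩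
  · intro t
    split_ifs with h1 h2 h3
    · simp
    · exact (abs_optimalProfile''_le (by linarith)).trans (by norm_num)
    · rw [abs_mul, abs_of_pos hδ0]
      have h4 : |(-6 : ℝ) + 12 * (t - c₂)| ≤ 6 := by
        rw [abs_le]; constructor <;> linarith
      nlinarith [abs_nonneg ((-6 : ℝ) + 12 * (t - c₂))]
    · simp
  · intro t ht
    simp [ht]
  · intro t ht
    have h1 : ¬ t ≤ c₃ := not_le.2 ht
    have h2 : ¬ t ≤ c₂ := fun h => h1 (h.trans h23)
    have h3 : ¬ t ≤ τ := fun h => h2 (h.trans h12)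
    simp [h1, h2, h3]
  · set W : ℝ → ℝ := fun t => if t ≤ τ then 1 else if t ≤ c₂ then optimalProfile (t - τ) else
      if t ≤ c₃ then δ * (1 - 3 * (t - c₂) ^ 2 + 2 * (t - c₂) ^ 3) else 0 with hW
    set W'' : ℝ → ℝ := fun t => if t ≤ τ then 0 else if t ≤ c₂ then optimalProfile'' (t - τ) else
      if t ≤ c₃ then δ * (-6 + 12 * (t - c₂)) else 0 with hW''
    have p1 : EqOn (fun t => W t ^ 2 + W'' t ^ 2) (fun _ => 1) (Ioc 0 τ) := fun t ht => by
      simp [hW, hW'', ht.2]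
    have p2 : EqOn (fun t => W t ^ 2 + W'' t ^ 2)
        (fun t => optimalProfile (t - τ) ^ 2 + optimalProfile'' (t - τ) ^ 2) (Ioc τ c₂) :=
      fun t ht => by
        simp [hW, hW'', ht.2, not_le.2 ht.1]
    have p3 : EqOn (fun t => W t ^ 2 + W'' t ^ 2)
        (fun t => (δ * (1 - 3 * (t - c₂) ^ 2 + 2 * (t - c₂) ^ 3)) ^ 2
          + (δ * (-6 + 12 * (t - c₂))) ^ 2) (Ioc c₂ c₃) := fun t ht => by
        simp [hW, hW'', ht.2, not_le.2 ht.1, not_le.2 (h12.trans_lt ht.1)]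
    have q2c : Continuous fun t => optimalProfile (t - τ) ^ 2 + optimalProfile'' (t - τ) ^ 2 :=
      ((f0.continuous.comp (continuous_sub_right τ)).pow 2).add
        ((continuous_optimalProfile''.comp (continuous_sub_right τ)).pow 2)
    have q3c : Continuous fun t : ℝ => (δ * (1 - 3 * (t - c₂) ^ 2 + 2 * (t - c₂) ^ 3)) ^ 2
          + (δ * (-6 + 12 * (t - c₂))) ^ 2 := by fun_prop
    have i1 : IntervalIntegrable (fun t => W t ^ 2 + W'' t ^ 2) volume 0 τ := by
      refine (continuous_const (y := (1 : ℝ))).intervalIntegrable 0 τ |>.congr ?_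
      rw [uIoc_of_le hτ0.le]
      exact p1.symm
    have i2 : IntervalIntegrable (fun t => W t ^ 2 + W'' t ^ 2) volume τ c₂ := by
      refine (q2c.intervalIntegrable τ c₂).congr ?_
      rw [uIoc_of_le h12]
      exact p2.symm
    have i3 : IntervalIntegrable (fun t => W t ^ 2 + W'' t ^ 2) volume c₂ c₃ := by
      refine (q3c.intervalIntegrable c₂ c₃).congr ?_
      rw [uIoc_of_le h23]
      exact p3.symm
    have j1 : ∫ t in (0 : ℝ)..τ, (W t ^ 2 + W'' t ^ 2) = τ := by
      rw [intervalIntegral.integral_of_le hτ0.le, setIntegral_congr_fun measurableSet_Ioc p1,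
        ← intervalIntegral.integral_of_le hτ0.le]
      simp
    have j2 : ∫ t in τ..c₂, (W t ^ 2 + W'' t ^ 2) ≤ √2 := by
      rw [intervalIntegral.integral_of_le h12, setIntegral_congr_fun measurableSet_Ioc p2,
        ← intervalIntegral.integral_of_le h12, intervalIntegral.integral_comp_sub_right
          (fun t => optimalProfile t ^ 2 + optimalProfile'' t ^ 2) τ, sub_self]
      exact integral_optimalProfile_sq_le _
    -- `37 = 1 + 36`: on the unit interval the cubic is at most `δ` and its second derivative at
    -- most `6 δ`, in absolute value.
    have j3 : ∫ t in c₂..c₃, (W t ^ 2 + W'' t ^ 2) ≤ 37 * δ ^ 2 := by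
      rw [intervalIntegral.integral_of_le h23, setIntegral_congr_fun measurableSet_Ioc p3,
        ← intervalIntegral.integral_of_le h23]
      have : ∫ t in c₂..c₃, 37 * δ ^ 2 = 37 * δ ^ 2 := by
        rw [intervalIntegral.integral_const, hc₂, hc₃]; simp
      rw [← this]
      refine intervalIntegral.integral_mono_on h23 (q3c.intervalIntegrable _ _)
        (continuous_const.intervalIntegrable _ _) fun t ht => ?_
      obtain ⟨x, hx⟩ : ∃ x, x = t - c₂ := ⟨_, rfl⟩
      rw [← hx]
      have hx0 : 0 ≤ x := by rw [hx]; linarith [ht.1]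
      have hx1 : x ≤ 1 := by rw [hx]; linarith [ht.2]
      have k1 : (1 - 3 * x ^ 2 + 2 * x ^ 3) ^ 2 ≤ 1 := by
        rw [sq_le_one_iff_abs_le_one, abs_le]
        have h0 : 0 ≤ x ^ 2 * (3 - 2 * x) := mul_nonneg (sq_nonneg x) (by linarith)
        have h1 : 0 ≤ (1 - x) ^ 2 * (1 + 2 * x) := mul_nonneg (sq_nonneg _) (by linarith)
        constructor <;> nlinarith
      have k2 : (-6 + 12 * x) ^ 2 ≤ 36 := by nlinarith
      rw [mul_pow, mul_pow]
      nlinarith [sq_nonneg δ]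
    calc ∫ t in (0 : ℝ)..c₃, (W t ^ 2 + W'' t ^ 2)
        = (∫ t in (0 : ℝ)..τ, (W t ^ 2 + W'' t ^ 2)) + (∫ t in τ..c₂, (W t ^ 2 + W'' t ^ 2))
          + ∫ t in c₂..c₃, (W t ^ 2 + W'' t ^ 2) := by
          rw [intervalIntegral.integral_add_adjacent_intervals i1 i2,
            intervalIntegral.integral_add_adjacent_intervals (i1.trans i2) i3]
      _ ≤ √2 + η := by rw [j1]; linarith

/-- A compactly supported profile, equal to `1` near `0`, with almost optimal energy. -/
lemma exists_profile {η : ℝ} (hη : 0 < η) : ∃ (τ R : ℝ) (w w' w'' : ℝ → ℝ), 0 < τ ∧ τ < R ∧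
    IsPrimitive w w' ∧ IsPrimitive w' w'' ∧ MemLp w'' 2 ∧ (∀ t, |t| ≤ τ → w t = 1) ∧
    (∀ t, R < |t| → w t = 0 ∧ w'' t = 0) ∧ ∫ t, (w t ^ 2 + w'' t ^ 2) ≤ 2 * √2 + η := by
  obtain ⟨τ, R, H, H', H'', hτ, hR, h0, h1, hb, hl, hr, hE⟩ :=
    exists_halfProfile (half_pos hη)
  have hR0 : 0 < R := hτ.trans hR
  have hH0 := hl 0 hτ.le
  have m1 : IsPrimitive (fun t => -H' (-t)) (fun t => H'' (-t)) := by
    simpa using h1.comp_neg.const_mul (-1)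
  -- The even reflection is `C¹` because the half profile is flat at `0`.
  have w0 := h0.comp_neg.glue h0 (c := 0) (by simp)
  have w1 := m1.glue h1 (c := 0) (by simp [hH0.2.1])
  set w : ℝ → ℝ := fun t => if t ≤ 0 then H (-t) else H t with hw
  set w'' : ℝ → ℝ := fun t => if t ≤ 0 then H'' (-t) else H'' t with hw''
  have ha : ∀ t, w t = H |t| ∧ w'' t = H'' |t| := fun t => by
    simp only [hw, hw'']
    split_ifs with h
    · rw [abs_of_nonpos h]; exact ⟨rfl, rfl⟩
    · rw [abs_of_pos (not_le.1 h)]; exact ⟨rfl, rfl⟩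
  have hsupp : ∀ t, R < |t| → w t = 0 ∧ w'' t = 0 := fun t ht => by
    rw [(ha t).1, (ha t).2]; exact hr _ ht
  have hmem : ∀ g : ℝ → ℝ, LocallyIntegrable g → (∀ t, |g t| ≤ 6) → (∀ t, R < |t| → g t = 0) →
      MemLp g 2 := fun g hg hg6 hgR => by
    have e : g = (Icc (-R) R).indicator g := by
      ext t
      by_cases ht : t ∈ Icc (-R) R
      · rw [indicator_of_mem ht]
      · rw [indicator_of_notMem ht]
        apply hgR
        by_contra h
        exact ht (abs_le.1 (not_lt.1 h))
    rw [e, memLp_indicator_iff_restrict measurableSet_Icc]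
    exact MemLp.of_bound hg.aestronglyMeasurable.restrict 6 (ae_of_all _ hg6)
  have hm : MemLp w'' 2 := hmem w'' w1.locallyIntegrable (fun t => by rw [(ha t).2]; exact hb _)
    fun t ht => (hsupp t ht).2
  have hint : LocallyIntegrable (fun t => w t ^ 2 + w'' t ^ 2) :=
    (w0.continuous.pow 2).locallyIntegrable.add hm.integrable_sq.locallyIntegrable
  refine ⟨τ, R, _, _, _, hτ, hR, w0, w1, hm, fun t ht => ?_, hsupp, ?_⟩
  · rw [(ha t).1]; exact (hl _ ht).1
  · have e1 : ∫ t, (w t ^ 2 + w'' t ^ 2) = ∫ t in (-R)..R, (w t ^ 2 + w'' t ^ 2) := by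
      rw [intervalIntegral.integral_of_le (by linarith), ← integral_Icc_eq_integral_Ioc]
      refine (setIntegral_eq_integral_of_forall_compl_eq_zero fun t ht => ?_).symm
      have : R < |t| := by
        by_contra h
        exact ht (abs_le.1 (not_lt.1 h))
      simp [hsupp t this]
    have e2 : ∫ t in (0 : ℝ)..R, (w t ^ 2 + w'' t ^ 2)
        = ∫ t in (0 : ℝ)..R, (H t ^ 2 + H'' t ^ 2) := by
      refine intervalIntegral.integral_congr fun t ht => ?_
      rw [uIcc_of_le hR0.le] at ht
      simp only [ha, abs_of_nonneg ht.1]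
    have e3 : ∫ t in (-R)..0, (w t ^ 2 + w'' t ^ 2)
        = ∫ t in (0 : ℝ)..R, (w t ^ 2 + w'' t ^ 2) := by
      have := intervalIntegral.integral_comp_neg (a := 0) (b := R)
        (fun t => w t ^ 2 + w'' t ^ 2)
      rw [neg_zero] at this
      rw [← this]
      refine intervalIntegral.integral_congr fun t _ => ?_
      simp only [ha, abs_neg]
    rw [e1, ← intervalIntegral.integral_add_adjacent_intervals
      (intervalIntegrable_of_locallyIntegrable hint (-R) 0)
      (intervalIntegrable_of_locallyIntegrable hint 0 R), e3, e2]
    linarith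

/-! ### The upper bound -/

/-- Approximate recovery points can be arranged in a recovery sequence. -/
lemma exists_recovery_sequence {X : Type*} [PseudoMetricSpace X] {F : ℕ → X → ℝ≥0∞} {c : ℝ≥0∞}
    {x : X} (h : ∀ η : ℝ, 0 < η → ∀ᶠ j in atTop, ∃ y, dist y x < η ∧ F j y ≤ c + ENNReal.ofReal η) :
    ∃ y : ℕ → X, Tendsto y atTop (𝓝 x) ∧ limsup (fun j => F j (y j)) atTop ≤ c := by
  classical
  set δ : ℕ → ℝ := fun k => 1 / ((k : ℝ) + 1) with hδ
  have hδ0 : ∀ k, 0 < δ k := fun k => Nat.one_div_pos_of_nat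
  have hδa : ∀ {k l}, k ≤ l → δ l ≤ δ k := fun h => Nat.one_div_le_one_div h
  set P : ℕ → ℕ → Prop := fun j k => ∃ y, dist y x < δ k ∧ F j y ≤ c + ENNReal.ofReal (δ k)
    with hP
  -- The best precision available at stage `j`, capped by `j`. Each precision level is eventually
  -- attained, so this index exceeds every fixed `k`.
  set m : ℕ → ℕ := fun j => Nat.findGreatest (P j) j
  set y : ℕ → X := fun j => if hj : P j (m j) then hj.choose else x with hy
  have key : ∀ k, ∀ᶠ j in atTop, dist (y j) x < δ k ∧ F j (y j) ≤ c + ENNReal.ofReal (δ k) := by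
    intro k
    filter_upwards [h (δ k) (hδ0 k), eventually_ge_atTop k] with j hj hkj
    have h1 : P j (m j) := Nat.findGreatest_spec hkj hj
    have h2 : k ≤ m j := Nat.le_findGreatest hkj hj
    have h3 : y j = h1.choose := dif_pos h1
    rw [h3]
    exact ⟨h1.choose_spec.1.trans_le (hδa h2), h1.choose_spec.2.trans
      (add_le_add_right (ENNReal.ofReal_le_ofReal (hδa h2)) c)⟩
  have hlim : Tendsto δ atTop (𝓝 0) := tendsto_one_div_add_atTop_nhds_zero_nat
  refine ⟨y, ?_, ?_⟩
  · rw [Metric.tendsto_nhds]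
    intro r hr
    obtain ⟨k, hk⟩ := (hlim.eventually (Iio_mem_nhds hr)).exists
    filter_upwards [key k] with j hj using hj.1.trans hk
  · have h1 : Tendsto (fun k => c + ENNReal.ofReal (δ k)) atTop (𝓝 (c + ENNReal.ofReal 0)) :=
      tendsto_const_nhds.add (ENNReal.tendsto_ofReal hlim)
    rw [ENNReal.ofReal_zero, add_zero] at h1
    exact ge_of_tendsto h1 (Eventually.of_forall fun k =>
      limsup_le_of_le (by isBoundedDefault) ((key k).mono fun j hj => hj.2))

/-- The piecewise linear ramp from `0` to `1` on `[0,1]`. -/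
def ramp (t : ℝ) : ℝ := if t ≤ 0 then 0 else if t ≤ 1 then t else 1

/-- The derivative of `ramp`. -/
def ramp' (t : ℝ) : ℝ := if t ≤ 0 then 0 else if t ≤ 1 then 1 else 0

lemma isPrimitive_ramp : IsPrimitive ramp ramp' :=
  (IsPrimitive.const 0).glue (((IsPrimitive.of_hasDerivAt (f := fun _ => 1) hasDerivAt_id
    continuous_const).glue (IsPrimitive.const 1) (c := 1) rfl)) (c := 0) (by simp)

lemma abs_ramp_sub_le (t : ℝ) : |ramp t - if 0 < t then 1 else 0| ≤ 1 := by
  unfold ramp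
  rcases le_or_gt t 0 with h | h
  · simp [h, not_lt.2 h]
  · rw [if_neg (not_le.2 h), if_pos h]
    split_ifs with h1
    · rw [abs_le]; constructor <;> linarith
    · simp

lemma memLp_ramp' : MemLp ramp' 2 := by
  have e : ramp' = (Ioc 0 1).indicator fun _ => 1 := by
    ext t
    unfold ramp'
    by_cases h : t ∈ Ioc (0 : ℝ) 1
    · rw [indicator_of_mem h, if_neg (not_le.2 h.1), if_pos h.2]
    · rw [indicator_of_notMem h]
      split_ifs with h1 h2
      · rfl
      · exact absurd ⟨not_le.1 h1, h2⟩ h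
      · rfl
  rw [e]
  exact memLp_indicator_const 2 measurableSet_Ioc 1 (Or.inr (by simp))

lemma sq_sum_eq_sum_sq {S : Finset ℝ} {f : ℝ → ℝ}
    (h : ∀ s ∈ S, ∀ t ∈ S, s ≠ t → f s * f t = 0) : (∑ s ∈ S, f s) ^ 2 = ∑ s ∈ S, f s ^ 2 := by
  rw [sq, Finset.sum_mul_sum]
  refine Finset.sum_congr rfl fun s hs => ?_
  rw [Finset.sum_eq_single s (fun t ht hts => h s hs t ht hts.symm) (fun h' => absurd hs h'), sq]

/-- The profiles `w((x-s)/ε)`, `s ∈ S`, superposed. -/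
def superpose (S : Finset ℝ) (c : ℝ → ℝ) (w : ℝ → ℝ) (r x : ℝ) : ℝ :=
  ∑ s ∈ S, c s * w (r⁻¹ * x + -(r⁻¹ * s))

lemma isPrimitive_superpose (S : Finset ℝ) (c : ℝ → ℝ) {w w' : ℝ → ℝ} (h : IsPrimitive w w')
    {r : ℝ} (hr : r ≠ 0) :
    IsPrimitive (superpose S c w r) (superpose S (fun s => r⁻¹ * c s) w' r) := by
  have := IsPrimitive.sum S fun s (_ : s ∈ S) =>
    (h.comp_mul_add (inv_ne_zero hr) (-(r⁻¹ * s))).const_mul (c s)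
  unfold superpose
  convert! this using 3 with x s
  ring

lemma memLp_comp_affine {w : ℝ → ℝ} (h : MemLp w 2) {r : ℝ} (hr : r ≠ 0) (d : ℝ) :
    MemLp (fun x => w (r⁻¹ * x + d)) 2 := by
  have hq : Measure.QuasiMeasurePreserving (fun x : ℝ => r⁻¹ * x + d) volume volume := by
    have h1 : Measure.QuasiMeasurePreserving (fun x : ℝ => r⁻¹ * x) volume volume := by
      refine ⟨by fun_prop, ?_⟩
      rw [Real.map_volume_mul_left (inv_ne_zero hr)]
      exact Measure.smul_absolutelyContinuous
    exact (measurePreserving_add_right volume d).quasiMeasurePreserving.comp h1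
  have hm : AEStronglyMeasurable (fun x => w (r⁻¹ * x + d)) :=
    h.1.comp_quasiMeasurePreserving hq
  rw [memLp_two_iff_integrable_sq hm]
  have h2 := (h.integrable_sq.comp_add_right d).comp_mul_left' (inv_ne_zero hr)
  exact h2

lemma memLp_superpose (S : Finset ℝ) (c : ℝ → ℝ) {w : ℝ → ℝ} (h : MemLp w 2) {r : ℝ}
    (hr : r ≠ 0) : MemLp (superpose S c w r) 2 := by
  have := memLp_finsetSum S fun s (_ : s ∈ S) =>
    (memLp_comp_affine h hr (-(r⁻¹ * s))).const_mul (c s)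
  exact this

lemma abs_superpose_le (S : Finset ℝ) (c : ℝ → ℝ) {w : ℝ → ℝ} {C : ℝ} (h : ∀ t, |w t| ≤ C)
    (r x : ℝ) : |superpose S c w r x| ≤ ∑ s ∈ S, |c s| * C := by
  refine (Finset.abs_sum_le_sum_abs _ _).trans (Finset.sum_le_sum fun s _ => ?_)
  rw [abs_mul]
  exact mul_le_mul_of_nonneg_left (h _) (abs_nonneg _)

lemma eventually_superpose_eq_zero (S : Finset ℝ) (c : ℝ → ℝ) {w : ℝ → ℝ} {R : ℝ}
    (hw : ∀ t, R < |t| → w t = 0) {x : ℝ} (hx : x ∉ S) :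
    ∀ᶠ r in 𝓝[>] (0 : ℝ), superpose S c w r x = 0 := by
  have : ∀ᶠ r in 𝓝[>] (0 : ℝ), ∀ s ∈ S, c s * w (r⁻¹ * x + -(r⁻¹ * s)) = 0 := by
    refine (eventually_all_finset _).2 fun s hs => ?_
    have hxs : 0 < |x - s| := abs_pos.2 (sub_ne_zero.2 fun h => hx (h ▸ hs))
    have h1 : Tendsto (fun r : ℝ => R * r) (𝓝[>] 0) (𝓝 (R * 0)) :=
      ((continuous_const.mul continuous_id).tendsto 0).mono_left nhdsWithin_le_nhds
    rw [mul_zero] at h1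
    filter_upwards [h1.eventually (Iio_mem_nhds hxs), self_mem_nhdsWithin] with r hr hr0
    have hr0' : 0 < r := hr0
    rw [hw, mul_zero]
    have e : r⁻¹ * x + -(r⁻¹ * s) = (x - s) / r := by ring
    rw [e, abs_div, abs_of_pos hr0', lt_div_iff₀ hr0']
    exact hr
  exact this.mono fun r hr => Finset.sum_eq_zero hr

lemma integral_superposed_energy_le {S : Finset ℝ} {w w'' : ℝ → ℝ}
    (hi : Integrable fun t => w t ^ 2 + w'' t ^ 2) {r : ℝ} (hr : 0 < r) :
    Integrable (fun x => ∑ s ∈ S, r⁻¹ * (w (r⁻¹ * x + -(r⁻¹ * s)) ^ 2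
        + w'' (r⁻¹ * x + -(r⁻¹ * s)) ^ 2)) ∧
      ∫ x, ∑ s ∈ S, r⁻¹ * (w (r⁻¹ * x + -(r⁻¹ * s)) ^ 2 + w'' (r⁻¹ * x + -(r⁻¹ * s)) ^ 2)
        = S.card * ∫ t, (w t ^ 2 + w'' t ^ 2) := by
  have h1 : ∀ s ∈ S, Integrable (fun x => r⁻¹ * (w (r⁻¹ * x + -(r⁻¹ * s)) ^ 2
      + w'' (r⁻¹ * x + -(r⁻¹ * s)) ^ 2)) := fun s _ =>
    ((hi.comp_add_right (-(r⁻¹ * s))).comp_mul_left' (inv_ne_zero hr.ne')).const_mul r⁻¹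
  refine ⟨integrable_finsetSum S h1, ?_⟩
  rw [integral_finsetSum S h1, Finset.sum_congr rfl (g := fun _ => ∫ t, (w t ^ 2 + w'' t ^ 2)),
    Finset.sum_const, nsmul_eq_mul]
  intro s _
  rw [integral_const_mul, Measure.integral_comp_mul_left
    (fun y => w (y + -(r⁻¹ * s)) ^ 2 + w'' (y + -(r⁻¹ * s)) ^ 2) r⁻¹,
    integral_add_right_eq_self (fun y => w y ^ 2 + w'' y ^ 2)]
  rw [inv_inv, abs_of_pos hr, smul_eq_mul, ← mul_assoc, inv_mul_cancel₀ hr.ne', one_mul]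

lemma aestronglyMeasurable_superpose (S : Finset ℝ) (c : ℝ → ℝ) {w : ℝ → ℝ} (hw : Measurable w)
    (r : ℝ) (μ : Measure ℝ) : AEStronglyMeasurable (superpose S c w r) μ := by
  have : Measurable (superpose S c w r) := by
    unfold superpose
    fun_prop
  exact this.aestronglyMeasurable

lemma ae_notMem_finset (S : Finset ℝ) (μ : Measure ℝ) [NullSingletonClass μ] : ∀ᵐ x ∂μ, x ∉ S :=
  (measure_eq_zero_iff_ae_notMem (s := (S : Set ℝ))).1 (S.finite_toSet.measure_zero _)

/-- The rescaled profiles shrink onto `S`, a null set, and stay uniformly bounded: dominated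
convergence applies. -/
lemma tendsto_integral_abs_superpose (a b : ℝ) (S : Finset ℝ) (c : ℝ → ℝ) {w : ℝ → ℝ} {R C : ℝ}
    (hwm : Measurable w) (hC : ∀ t, |w t| ≤ C) (hw : ∀ t, R < |t| → w t = 0) :
    Tendsto (fun r => ∫ x in Ioo a b, |superpose S c w r x|) (𝓝[>] 0) (𝓝 0) := by
  have h := tendsto_integral_filter_of_dominated_convergence (μ := volume.restrict (Ioo a b))
    (F := fun r x => |superpose S c w r x|) (f := fun _ => (0 : ℝ)) (l := 𝓝[>] (0 : ℝ))
    (fun _ => ∑ s ∈ S, |c s| * C)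
    (Eventually.of_forall fun r => (aestronglyMeasurable_superpose S c hwm r _).norm)
    (Eventually.of_forall fun r => ae_of_all _ fun x => by
      rw [Real.norm_eq_abs, abs_abs]; exact abs_superpose_le S c hC r x)
    (integrable_const _) ?_
  · simpa using h
  · filter_upwards [ae_notMem_finset S (volume.restrict (Ioo a b))] with x hx
    refine tendsto_const_nhds.congr' ?_
    filter_upwards [eventually_superpose_eq_zero S c hw hx] with r hr
    rw [hr, abs_zero]

lemma tendsto_integral_sq_one_sub_superpose {a b : ℝ} (S : Finset ℝ) (c : ℝ → ℝ) {w g : ℝ → ℝ}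
    {R C : ℝ} (hwm : Measurable w) (hC : ∀ t, |w t| ≤ C) (hw : ∀ t, R < |t| → w t = 0)
    (hg : MemLp g 2 (volume.restrict (Ioo a b))) :
    Tendsto (fun r => ∫ x in Ioo a b, (1 - superpose S c w r x) ^ 2 * g x ^ 2) (𝓝[>] 0)
      (𝓝 (∫ x in Ioo a b, g x ^ 2)) := by
  set K := ∑ s ∈ S, |c s| * C
  refine tendsto_integral_filter_of_dominated_convergence (fun x => (1 + K) ^ 2 * g x ^ 2)
    (Eventually.of_forall fun r => ?_) (Eventually.of_forall fun r => ae_of_all _ fun x => ?_)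
    (hg.integrable_sq.const_mul _) ?_
  · exact ((aestronglyMeasurable_const.sub (aestronglyMeasurable_superpose S c hwm r _)).pow 2).mul
      (hg.1.pow 2)
  · have h1 := abs_superpose_le S c hC r x
    rw [Real.norm_eq_abs, abs_mul, abs_sq, abs_sq]
    refine mul_le_mul_of_nonneg_right (sq_le_sq' ?_ ?_) (sq_nonneg _) <;>
    · have := abs_le.1 h1
      linarith [this.1, this.2]
  · filter_upwards [ae_notMem_finset S (volume.restrict (Ioo a b))] with x hx
    refine tendsto_const_nhds.congr' ?_
    filter_upwards [eventually_superpose_eq_zero S c hw hx] with r hr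
    rw [hr]; ring

/-- Uniqueness of weak derivatives lets explicit derivatives replace the chosen ones, including
after passing to classes in `L¹`. -/
lemma exists_edgeEnergy_eq {a b : ℝ} (α β ε : ℝ) {U U' V V' V'' : ℝ → ℝ}
    (hU : IsPrimitive U U') (hU' : MemLp U' 2 (volume.restrict (Ioo a b)))
    (hV : IsPrimitive V V') (hV' : IsPrimitive V' V'')
    (hV'' : MemLp V'' 2 (volume.restrict (Ioo a b))) :
    ∃ y : L1 a b × L1 a b, y.1 =ᵐ[volume.restrict (Ioo a b)] U ∧
      y.2 =ᵐ[volume.restrict (Ioo a b)] V ∧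
      edgeEnergy a b α β ε y =
        (ENNReal.ofReal α * ∫⁻ t in Ioo a b, ENNReal.ofReal (V t ^ 2 * U' t ^ 2)) +
        ENNReal.ofReal (β / (2 * √2)) *
          ∫⁻ t in Ioo a b, ENNReal.ofReal ((V t - 1) ^ 2 / ε + ε ^ 3 * V'' t ^ 2) := by
  have mU := hU.memW12 hU'
  have mV := hV.memW22 hV' hV''
  have iU : MemLp U 1 (volume.restrict (Ioo a b)) := mU.1.mono_exponent (by norm_num)
  have iV : MemLp V 1 (volume.restrict (Ioo a b)) := mV.1.mono_exponent (by norm_num)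
  have eU := iU.coeFn_toLp
  have eV := iV.coeFn_toLp
  refine ⟨(iU.toLp U, iV.toLp V), eU, eV, ?_⟩
  have dU : weakDeriv a b (iU.toLp U) =ᵐ[volume.restrict (Ioo a b)] U' :=
    ((hU.hasWeakDeriv a b).congr eU.symm (ae_eq_refl _)).weakDeriv_ae_eq
  have dV : weakDeriv a b (iV.toLp V) =ᵐ[volume.restrict (Ioo a b)] V' :=
    ((hV.hasWeakDeriv a b).congr eV.symm (ae_eq_refl _)).weakDeriv_ae_eq
  have ddV : weakDeriv a b (weakDeriv a b (iV.toLp V)) =ᵐ[volume.restrict (Ioo a b)] V'' :=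
    ((hV'.hasWeakDeriv a b).congr dV.symm (ae_eq_refl _)).weakDeriv_ae_eq
  rw [edgeEnergy, if_pos ⟨mU.congr eU.symm, mV.congr eV.symm⟩]
  congr 2
  · refine lintegral_congr_ae ?_
    filter_upwards [eV, dU] with t h1 h2
    rw [h1, h2]
  · refine lintegral_congr_ae ?_
    filter_upwards [eV, ddV] with t h1 h2
    rw [h1, h2]

lemma stepSum_eq_superpose (S : Finset ℝ) (κ : ℝ → ℝ) {r : ℝ} (hr : 0 < r) (x : ℝ) :
    stepSum S κ x = superpose S κ (fun t => if 0 < t then 1 else 0) r x := by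
  unfold stepSum superpose
  refine Finset.sum_congr rfl fun s _ => ?_
  have : 0 < r⁻¹ * x + -(r⁻¹ * s) ↔ s < x := by
    rw [← sub_eq_add_neg, ← mul_sub, mul_pos_iff_of_pos_left (inv_pos.2 hr), sub_pos]
  simp [this]

lemma abs_rescale_le_iff {r x s R : ℝ} (hr : 0 < r) :
    |r⁻¹ * x + -(r⁻¹ * s)| ≤ R ↔ |x - s| ≤ R * r := by
  rw [← sub_eq_add_neg, ← mul_sub, abs_mul, abs_of_pos (inv_pos.2 hr), inv_mul_le_iff₀ hr, mul_comm]

section Separated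

variable {S : Finset ℝ} {r δ R : ℝ}

/-- The supports have radius at most `R r < δ` around points at mutual distance at least `2 δ`. -/
lemma mul_rescale_eq_zero {w : ℝ → ℝ} (hr : 0 < r) (hw : ∀ t, R < |t| → w t = 0)
    (hS : ∀ x ∈ S, ∀ y ∈ S, x ≠ y → 2 * δ ≤ |x - y|) (hR : R * r < δ) (x : ℝ) :
    ∀ s ∈ S, ∀ t ∈ S, s ≠ t →
      w (r⁻¹ * x + -(r⁻¹ * s)) * w (r⁻¹ * x + -(r⁻¹ * t)) = 0 := by
  intro s hs t ht hst
  by_contra h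
  have h1 : |x - s| ≤ R * r := (abs_rescale_le_iff hr).1
    (not_lt.1 fun h' => h (by rw [hw _ h', zero_mul]))
  have h2 : |x - t| ≤ R * r := (abs_rescale_le_iff hr).1
    (not_lt.1 fun h' => h (by rw [hw _ h', mul_zero]))
  have h3 := hS s hs t ht hst
  have h4 := abs_sub_le s x t
  rw [abs_sub_comm s x] at h4
  linarith

lemma superpose_const_sq {w : ℝ → ℝ} (hr : 0 < r) (hw : ∀ t, R < |t| → w t = 0)
    (hS : ∀ x ∈ S, ∀ y ∈ S, x ≠ y → 2 * δ ≤ |x - y|) (hR : R * r < δ) (c x : ℝ) :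
    superpose S (fun _ => c) w r x ^ 2 = ∑ s ∈ S, c ^ 2 * w (r⁻¹ * x + -(r⁻¹ * s)) ^ 2 := by
  unfold superpose
  rw [sq_sum_eq_sum_sq (f := fun s => c * w (r⁻¹ * x + -(r⁻¹ * s)))]
  · simp only [mul_pow]
  · intro s hs t ht hst
    have := mul_rescale_eq_zero hr hw hS hR x s hs t ht hst
    linear_combination c ^ 2 * this

/-- Disjoint supports remove the cross terms, and `r³ (r⁻²)² = r⁻¹` puts both terms at the same
scale. -/
lemma superposed_penalty_eq {w w'' : ℝ → ℝ} (hr : 0 < r)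
    (hw : ∀ t, R < |t| → w t = 0 ∧ w'' t = 0)
    (hS : ∀ x ∈ S, ∀ y ∈ S, x ≠ y → 2 * δ ≤ |x - y|) (hR : R * r < δ) (x : ℝ) :
    superpose S (fun _ => 1) w r x ^ 2 / r
        + r ^ 3 * superpose S (fun _ => r⁻¹ * (r⁻¹ * 1)) w'' r x ^ 2
      = ∑ s ∈ S, r⁻¹ * (w (r⁻¹ * x + -(r⁻¹ * s)) ^ 2 + w'' (r⁻¹ * x + -(r⁻¹ * s)) ^ 2) := by
  rw [superpose_const_sq hr (fun t ht => (hw t ht).1) hS hR,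
    superpose_const_sq hr (fun t ht => (hw t ht).2) hS hR, Finset.sum_div, Finset.mul_sum,
    ← Finset.sum_add_distrib]
  refine Finset.sum_congr rfl fun s _ => ?_
  field_simp

/-- A ramp moves only within distance `τ r` of its jump, where the plateau `w = 1` makes the edge
variable vanish. Jumps are thus bridged at no Dirichlet cost. -/
lemma one_sub_superpose_mul_ramp' {w : ℝ → ℝ} {τ : ℝ} (hτ : 0 < τ) (hr : 0 < r)
    (hw : ∀ t, R < |t| → w t = 0) (hw1 : ∀ t, |t| ≤ τ → w t = 1)
    (hS : ∀ x ∈ S, ∀ y ∈ S, x ≠ y → 2 * δ ≤ |x - y|) (hR : R * r < δ) (c : ℝ → ℝ) (x : ℝ) :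
    (1 - superpose S (fun _ => 1) w r x) * superpose S c ramp' (r * τ) x = 0 := by
  by_cases h : ∃ s ∈ S, |x - s| ≤ τ * r
  · obtain ⟨s, hs, hxs⟩ := h
    have h1 : w (r⁻¹ * x + -(r⁻¹ * s)) = 1 := hw1 _ ((abs_rescale_le_iff hr).2 hxs)
    have h2 : superpose S (fun _ => 1) w r x = 1 := by
      unfold superpose
      rw [Finset.sum_eq_single s _ (fun h => absurd hs h), h1, mul_one]
      intro t ht hts
      have := mul_rescale_eq_zero hr hw hS hR x s hs t ht hts.symm
      rwa [h1] at this
    rw [h2, sub_self, zero_mul]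
  · push Not at h
    have h2 : superpose S c ramp' (r * τ) x = 0 := by
      refine Finset.sum_eq_zero fun s hs => ?_
      have h3 : 1 < |(r * τ)⁻¹ * x + -((r * τ)⁻¹ * s)| := by
        rw [← not_le, abs_rescale_le_iff (mul_pos hr hτ), not_le, one_mul, mul_comm]
        exact h s hs
      have h4 : ramp' ((r * τ)⁻¹ * x + -((r * τ)⁻¹ * s)) = 0 := by
        unfold ramp'
        split_ifs with h5 h6
        · rfl
        · rw [abs_of_pos (not_le.1 h5)] at h3
          exact absurd h3 (not_lt.2 h6)
        · rfl
      rw [h4, mul_zero]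
    rw [h2, mul_zero]

end Separated

lemma PiecewiseRep.jumpEnergy_eq {a b α β : ℝ} {p : L1 a b × L1 a b} {G g κ : ℝ → ℝ}
    {S : Finset ℝ} (h : PiecewiseRep a b p.1 G g S κ) (hg : MemLp g 2 (volume.restrict (Ioo a b)))
    (hS : (S : Set ℝ) = approxDiscontSet a b p.1)
    (hp : MemSBV2 a b p.1 ∧ ∀ᵐ t ∂(volume.restrict (Ioo a b)), p.2 t = 1) :
    jumpEnergy a b α β p = (ENNReal.ofReal α * ENNReal.ofReal (∫ x in Ioo a b, g x ^ 2)) +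
      ENNReal.ofReal β * S.card := by
  rw [jumpEnergy, if_pos hp, ← hS, encard_coe_eq_coe_finsetCard,
    ofReal_integral_eq_lintegral_ofReal hg.integrable_sq (ae_of_all _ fun x => sq_nonneg _)]
  congr 2
  refine lintegral_congr_ae ?_
  filter_upwards [h.approxDeriv_ae_eq] with x hx
  rw [hx]

lemma eventually_exists_edgeEnergy_le {a b α β : ℝ} (hab : a < b) (hα : 0 < α) (hβ : 0 < β)
    (p : L1 a b × L1 a b) {η : ℝ} (hη : 0 < η) :
    ∀ᶠ r in 𝓝[>] (0 : ℝ), ∃ y : L1 a b × L1 a b, dist y p < η ∧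
      edgeEnergy a b α β r y ≤ jumpEnergy a b α β p + ENNReal.ofReal η := by
  by_cases hp : MemSBV2 a b p.1 ∧ ∀ᵐ t ∂(volume.restrict (Ioo a b)), p.2 t = 1
  swap
  · refine Eventually.of_forall fun r => ⟨p, by simpa using hη, ?_⟩
    rw [jumpEnergy, if_neg hp, top_add]
    exact le_top
  obtain ⟨G, g, S, κ, hrep, hg, hS⟩ := hp.1.exists_piecewiseRep hab
  have h22 := two_sqrt_two_pos
  set N : ℝ := (S.card : ℝ) with hN
  have hN0 : 0 ≤ N := Nat.cast_nonneg _
  -- The slack is chosen so that, after multiplication by `β / (2√2)` and by the number `N` of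
  -- jumps, it totals at most `η / 2`; `N + 1` covers the case without jumps.
  obtain ⟨τ, R, w, w', w'', hτ, hτR, hw, hw', hw2, hw1, hwR, hwE⟩ :=
    exists_profile (η := η * (2 * √2) / (2 * β * (N + 1))) (by positivity)
  obtain ⟨C, hC⟩ : ∃ C, ∀ t, |w t| ≤ C := by
    have hcs : HasCompactSupport w := HasCompactSupport.of_support_subset_isCompact
      (isCompact_closedBall (0 : ℝ) R) fun t ht => by
        rw [mem_closedBall_zero_iff, Real.norm_eq_abs]
        exact not_lt.1 fun h => ht (hwR t h).1
    exact hw.continuous.bounded_above_of_compact_support hcs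
  have hwz : ∀ t, R < |t| → w t = 0 := fun t ht => (hwR t ht).1
  have hwm : Measurable w := hw.continuous.measurable
  have hwi : Integrable fun t => w t ^ 2 + w'' t ^ 2 :=
    ((hw.continuous.pow 2).integrable_of_hasCompactSupport
      (HasCompactSupport.of_support_subset_isCompact
        (isCompact_closedBall (0 : ℝ) R) fun t ht => by
          rw [mem_closedBall_zero_iff, Real.norm_eq_abs]
          exact not_lt.1 fun h => ht (by simp [hwz t h]))).add hw2.integrable_sq
  obtain ⟨δ, hδ, hδ0⟩ := ((eventually_separated hrep.subset).and self_mem_nhdsWithin).exists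
  have hδ0 : 0 < δ := hδ0
  have hRr : ∀ᶠ r in 𝓝[>] (0 : ℝ), R * r < δ := by
    have h1 : Tendsto (fun r : ℝ => R * r) (𝓝[>] 0) (𝓝 (R * 0)) :=
      ((continuous_const.mul continuous_id).tendsto 0).mono_left nhdsWithin_le_nhds
    rw [mul_zero] at h1
    exact h1.eventually (Iio_mem_nhds hδ0)
  have hscale : Tendsto (fun r : ℝ => r * τ) (𝓝[>] 0) (𝓝[>] 0) := by
    refine tendsto_nhdsWithin_iff.2 ⟨?_, ?_⟩
    · have h1 : Tendsto (fun r : ℝ => r * τ) (𝓝[>] 0) (𝓝 (0 * τ)) :=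
        ((continuous_id.mul continuous_const).tendsto 0).mono_left nhdsWithin_le_nhds
      rwa [zero_mul] at h1
    · filter_upwards [self_mem_nhdsWithin] with r hr using mul_pos hr hτ
  -- The ramp minus the unit step is bounded and compactly supported, so replacing jumps by ramps is
  -- a small change in `L¹`.
  set ρ : ℝ → ℝ := fun t => ramp t - if 0 < t then 1 else 0 with hρ
  have hdU := (tendsto_integral_abs_superpose a b S κ (w := ρ) (R := 1) (C := 1)
    (isPrimitive_ramp.continuous.measurable.sub
      (Measurable.ite measurableSet_Ioi measurable_const measurable_const))
    abs_ramp_sub_le (fun t ht => by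
      simp only [hρ, ramp]
      rcases le_or_gt t 0 with h | h
      · simp [h, not_lt.2 h]
      · rw [abs_of_pos h] at ht
        simp [h, not_le.2 h, not_le.2 ht])).comp hscale
  have hdV := tendsto_integral_abs_superpose a b S (fun _ => 1) hwm hC hwz
  have hD := tendsto_integral_sq_one_sub_superpose S (fun _ => 1) hwm hC hwz hg
  have hηα : 0 < η / (2 * α) := by positivity
  filter_upwards [hRr, self_mem_nhdsWithin, hdU.eventually (Iio_mem_nhds hη),
    hdV.eventually (Iio_mem_nhds hη), hD.eventually (Iio_mem_nhds (lt_add_of_pos_right _ hηα))]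
    with r hRr hr0 hdU hdV hD
  have hr : 0 < r := hr0
  have hrτ : 0 < r * τ := mul_pos hr hτ
  have hU : IsPrimitive (fun x => G x + superpose S κ ramp (r * τ) x) _ :=
    hrep.isPrimitive.add (isPrimitive_superpose S κ isPrimitive_ramp hrτ.ne')
  have hV : IsPrimitive (fun x => 1 - superpose S (fun _ => 1) w r x) _ :=
    (IsPrimitive.const 1).sub (isPrimitive_superpose S (fun _ => 1) hw hr.ne')
  have hV' := (IsPrimitive.const 0).sub (isPrimitive_superpose S (fun _ => r⁻¹ * 1) hw' hr.ne')
  obtain ⟨y, hy1, hy2, hyE⟩ := exists_edgeEnergy_eq (a := a) (b := b) α β r hU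
    (hg.add ((memLp_superpose S _ memLp_ramp' hrτ.ne').restrict _)) hV hV'
    ((memLp_const 0).sub ((memLp_superpose S _ hw2 hr.ne').restrict _))
  refine ⟨y, ?_, ?_⟩
  · rw [Prod.dist_eq, max_lt_iff, ← integral_abs_sub_eq_dist, ← integral_abs_sub_eq_dist]
    constructor
    · refine lt_of_le_of_lt (le_of_eq (integral_congr_ae ?_)) hdU
      filter_upwards [hy1, hrep.ae_eq] with x h1 h2
      rw [h1, h2, stepSum_eq_superpose S κ hrτ, add_sub_add_left_eq_sub]
      unfold superpose
      rw [← Finset.sum_sub_distrib]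
      simp only [hρ, ← mul_sub]
    · refine lt_of_le_of_lt (le_of_eq (integral_congr_ae ?_)) hdV
      filter_upwards [hy2, hp.2] with x h1 h2
      rw [h1, h2, sub_sub_cancel_left, abs_neg]
  · have e1 : ∀ t, (1 - superpose S (fun _ => 1) w r t) ^ 2 *
        (g t + superpose S (fun s => (r * τ)⁻¹ * κ s) ramp' (r * τ) t) ^ 2
        = (1 - superpose S (fun _ => 1) w r t) ^ 2 * g t ^ 2 := fun t => by
      have := one_sub_superpose_mul_ramp' hτ hr hwz hw1 hδ.2 hRr
        (fun s => (r * τ)⁻¹ * κ s) t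
      rw [← mul_pow, mul_add, this, add_zero, mul_pow]
    have e2 : ∀ t, (1 - superpose S (fun _ => 1) w r t - 1) ^ 2 / r
        + r ^ 3 * (0 - superpose S (fun _ => r⁻¹ * (r⁻¹ * 1)) w'' r t) ^ 2
        = ∑ s ∈ S, r⁻¹ * (w (r⁻¹ * t + -(r⁻¹ * s)) ^ 2 + w'' (r⁻¹ * t + -(r⁻¹ * s)) ^ 2) :=
      fun t => by
        rw [← superposed_penalty_eq hr hwR hδ.2 hRr]
        ring
    have hi := integral_superposed_energy_le (S := S) hwi hr
    have hnn : ∀ t, 0 ≤ ∑ s ∈ S, r⁻¹ * (w (r⁻¹ * t + -(r⁻¹ * s)) ^ 2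
        + w'' (r⁻¹ * t + -(r⁻¹ * s)) ^ 2) := fun t => Finset.sum_nonneg fun s _ => by positivity
    have b1 : ∫⁻ t in Ioo a b, ENNReal.ofReal ((1 - superpose S (fun _ => 1) w r t) ^ 2 *
        (g t + superpose S (fun s => (r * τ)⁻¹ * κ s) ramp' (r * τ) t) ^ 2)
        ≤ ENNReal.ofReal ((∫ x in Ioo a b, g x ^ 2) + η / (2 * α)) := by
      simp only [e1]
      rw [← ofReal_integral_eq_lintegral_ofReal _
        (ae_of_all _ fun x => mul_nonneg (sq_nonneg _) (sq_nonneg _))]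
      · exact ENNReal.ofReal_le_ofReal (le_of_lt hD)
      · have := (memLp_mul_of_continuous hV.continuous hg).integrable_sq
        simpa only [mul_pow] using this
    have b2 : ∫⁻ t in Ioo a b, ENNReal.ofReal ((1 - superpose S (fun _ => 1) w r t - 1) ^ 2 / r
        + r ^ 3 * (0 - superpose S (fun _ => r⁻¹ * (r⁻¹ * 1)) w'' r t) ^ 2)
        ≤ ENNReal.ofReal (N * (2 * √2 + η * (2 * √2) / (2 * β * (N + 1)))) := by
      simp only [e2]
      -- Integrating over the whole line only increases the cost and makes it exactly `N` times that
      -- of one profile.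
      refine (setLIntegral_le_lintegral _ _).trans ?_
      rw [← ofReal_integral_eq_lintegral_ofReal hi.1 (ae_of_all _ hnn), hi.2]
      exact ENNReal.ofReal_le_ofReal (mul_le_mul_of_nonneg_left hwE hN0)
    rw [hyE, hrep.jumpEnergy_eq hg hS hp]
    have hI : 0 ≤ ∫ x in Ioo a b, g x ^ 2 := integral_nonneg fun x => sq_nonneg _
    refine (add_le_add (mul_le_mul_right b1 _) (mul_le_mul_right b2 _)).trans ?_
    rw [← ENNReal.ofReal_natCast, ← ENNReal.ofReal_mul hα.le, ← ENNReal.ofReal_mul (by positivity),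
      ← ENNReal.ofReal_mul hα.le, ← ENNReal.ofReal_mul hβ.le,
      ← ENNReal.ofReal_add (by positivity) (by positivity),
      ← ENNReal.ofReal_add (by positivity) (by positivity),
      ← ENNReal.ofReal_add (by positivity) hη.le]
    refine ENNReal.ofReal_le_ofReal ?_
    have c1 : α * ((∫ x in Ioo a b, g x ^ 2) + η / (2 * α))
        = α * (∫ x in Ioo a b, g x ^ 2) + η / 2 := by field_simp
    have c2 : β / (2 * √2) * (N * (2 * √2 + η * (2 * √2) / (2 * β * (N + 1))))
        = β * N + η / 2 * (N / (N + 1)) := by field_simp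
    have c3 : N / (N + 1) ≤ 1 := (div_le_one (by positivity)).2 (by linarith)
    have c4 : η / 2 * (N / (N + 1)) ≤ η / 2 * 1 := mul_le_mul_of_nonneg_left c3 (by positivity)
    rw [c1, c2]
    linarith

/-- `Γ`-convergence of the edge penalization energies to the Mumford-Shah functional. -/
theorem gammaConverges_edgeEnergy {a b α β : ℝ} (hab : a < b) (hα : 0 < α) (hβ : 0 < β)
    {ε : ℕ → ℝ} (hε_pos : ∀ j, 0 < ε j) (hε_lim : Tendsto ε atTop (𝓝 0)) :
    GammaConverges (fun j => edgeEnergy a b α β (ε j)) (jumpEnergy a b α β) := by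
  refine ⟨fun p y hy => jumpEnergy_le_liminf hab hα hβ hε_pos hε_lim hy, fun p => ?_⟩
  have hε : Tendsto ε atTop (𝓝[>] 0) :=
    tendsto_nhdsWithin_iff.2 ⟨hε_lim, Eventually.of_forall hε_pos⟩
  exact exists_recovery_sequence fun η hη =>
    hε.eventually (eventually_exists_edgeEnergy_le hab hα hβ p hη)

end EdgePenalization

end

theorem theorem4p1 (a b α β : ℝ) (hab : a < b) (hα : 0 < α) (hβ : 0 < β)
    (ε : ℕ → ℝ) (hε_pos : ∀ j, 0 < ε j) (hε_anti : StrictAnti ε)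
    (hε_lim : Tendsto ε atTop (𝓝 0)) :
    EdgePenalization.GammaConverges
      (fun j => EdgePenalization.energy a b α β (ε j))
      (EdgePenalization.mumfordShah a b α β) := by
  -- Both functionals acquire the same constant `α * β * (b - a)`, which is positive, so the
  -- convergence already proved applies with it in place of `β`.
  rw [EdgePenalization.mumfordShah_eq_jumpEnergy hα.le hβ.le]
  simp only [EdgePenalization.energy_eq_edgeEnergy hα.le hβ.le]
  exact EdgePenalization.gammaConverges_edgeEnergy hab hα
    (mul_pos (mul_pos hα hβ) (sub_pos.2 hab)) hε_pos hε_lim
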